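/- Let $n,m,q,r$ be positive integers with $m>n$ and $q>1$. \emph{The hash function.} Let $\hat\alpha=(\alpha_1,\alpha_2,\dots)$ be a sequence of words such that, for every $l\ge 1$, the set of letters occurring in $\alpha_l$ is exactly $\{1,\dots,l\}$ and each letter occurs at most $q$ times in $\alpha_l$. For a compression function $f:\{0,1\}^n\times\{0,1\}^m\to\{0,1\}^n$, an initial value $h_0\in\{0,1\}^n$ and a message $x=b_1b_2\cdots b_l$ with $l\ge 1$ blocks $b_i\in\{0,1\}^m$, write $\alpha_l=i_1i_2\cdots i_s$, put $h_j=f(h_{j-1},b_{i_j})$ for $j=1,\dots,s$, and let $H_{\hat\alpha,f}(h_0,x)=h_s$. A $k$-collision in $H_{\hat\alpha,f}$ with initial value $h_0$ is a set of $k$ messages with the same number of blocks and the same value $H_{\hat\alpha,f}(h_0,\cdot)$. \emph{The number $N(M,q)$.} For a word $w$ and a set $A$ of letters, let $(w)_A$ be the word obtained from $w$ by deleting all letters outside $A$ and then replacing every maximal block of equal adjacent letters by one letter. For positive integers $M$ and $q$, $N(M,q)$ is the least positive integer $k$ such that for every word $w$ which has at least $k$ distinct letters, each occurring at most $q$ times,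 there are a set $A$ of $M$ letters of $w$, some $p\in\{1,\dots,q\}$ and a factorization $w=w_1w_2\cdots w_p$ such that in each $(w_i)_A$ every letter of $A$ occurs exactly once. \emph{Claim.} For every initial value $h_0$ there is a black-box $2^r$-collision attack on the $q$-bounded generalized iterated hash function $H_{\hat\alpha,f}$, that is, an adaptive query procedure which knows $\hat\alpha$ and $h_0$ but has access to $f$ only through queries $(h,b)\mapsto f(h,b)$, and which for every $f$ stops and outputs a $2^r$-collision in $H_{\hat\alpha,f}$ with initial value $h_0$. Its expected number of queries, when $f$ is chosen uniformly at random among all functions $\{0,1\}^n\times\{0,1\}^m\to\{0,1\}^n$, is at most $$\tilde a\,q\,N\bigl(n^{(q-1)^2}r^{2q-3},\,q\bigr)\,2^{n/2},\qquad \tilde a=2.5 .$$ -/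

import Mathlib

open scoped BigOperators

namespace Gihf

/-! ### Words and the number `N(m, q)` -/

/-- The word `(w)_A`: delete from `w` all letters outside `A`, then replace every maximal block
`a a ⋯ a` of equal adjacent letters by the single letter `a`. -/
def collapse (A : Finset ℕ) (w : List ℕ) : List ℕ :=
  (w.filter (fun a => a ∈ A)).destutter (fun a b => a ≠ b)

/-- `w` is a permutation of the alphabet `A`: a word over `A` in which every letter of `A`
occurs exactly once. -/
def IsPermutationOf (A : Finset ℕ) (w : List ℕ) : Prop :=
  (∀ a ∈ w, a ∈ A) ∧ ∀ a ∈ A, w.count a = 1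

/-- `α` has a set `A` of `m` letters and a factorization `α = α₁ α₂ ⋯ α_p` with `1 ≤ p ≤ q`
such that every `(α_i)_A` is a permutation of `A`. -/
def HasPermutationFactorization (m q : ℕ) (α : List ℕ) : Prop :=
  ∃ A : Finset ℕ, A ⊆ α.toFinset ∧ A.card = m ∧
    ∃ parts : List (List ℕ), 1 ≤ parts.length ∧ parts.length ≤ q ∧ parts.flatten = α ∧
      ∀ β ∈ parts, IsPermutationOf A (collapse A β)

/-- `N(m, q)`: the least positive integer `k` such that every word with at least `k` distinct
letters, each occurring at most `q` times, has a permutation factorization as above. (Letters are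
natural numbers; this covers every finite alphabet.) -/
noncomputable def N (m q : ℕ) : ℕ :=
  sInf {k : ℕ | 0 < k ∧ ∀ α : List ℕ, k ≤ α.toFinset.card → (∀ a ∈ α, α.count a ≤ q) →
    HasPermutationFactorization m q α}

/-! ### Generalized iterated hash functions -/

/-- Hash values: `{0,1}^n`. -/
abbrev HashValue (n : ℕ) : Type := Fin n → Bool

/-- Message blocks: `{0,1}^m`. -/
abbrev Block (m : ℕ) : Type := Fin m → Bool

/-- Compression functions `{0,1}^n × {0,1}^m → {0,1}^n`. -/
abbrev Compression (n m : ℕ) : Type := HashValue n → Block m → HashValue n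

/-- Messages: nonempty sequences of blocks, with their number of blocks. -/
abbrev Message (m : ℕ) : Type := Σ l : ℕ+, (Fin l → Block m)

/-- The iterated compression function `f_α(h, b₁ ⋯ b_l)`, for a word `α = i₁ i₂ ⋯ i_s`: it feeds
the blocks with numbers `i₁, i₂, …, i_s` successively into `f`, starting from `h`. -/
def iteratedCompression {n m l : ℕ} (f : Compression n m) (α : List (Fin l))
    (h : HashValue n) (b : Fin l → Block m) : HashValue n :=
  (α.map b).foldl f h

/-- The generalized iterated hash function based on the words `α₁, α₂, …` and on `f`. -/
def hash {n m : ℕ} (α : (l : ℕ+) → List (Fin l)) (f : Compression n m)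
    (h : HashValue n) (x : Message m) : HashValue n :=
  iteratedCompression f (α x.1) h x.2

/-- The sequence is `q`-bounded: every letter occurs at most `q` times in every word. -/
def IsBounded (q : ℕ) (α : (l : ℕ+) → List (Fin l)) : Prop :=
  ∀ (l : ℕ+) (i : Fin l), (α l).count i ≤ q

/-- `C` is a `k`-collision with initial value `h₀`: a set of `k` messages of the same length and
with the same hash value. -/
def IsCollision {n m : ℕ} (α : (l : ℕ+) → List (Fin l)) (f : Compression n m)
    (h₀ : HashValue n) (k : ℕ) (C : Finset (Message m)) : Prop :=
  C.card = k ∧ ∀ u ∈ C, ∀ v ∈ C, u.1 = v.1 ∧ hash α f h₀ u = hash α f h₀ v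

/-! ### Black-box attacks -/

/-- A black-box attacker: an adaptive query procedure which either stops and outputs a finite set
of messages, or queries the compression function at `(h, b)` and continues in a way that depends
on the response. -/
inductive Attack (n m : ℕ) : Type
  | output (C : Finset (Message m)) : Attack n m
  | query (h : HashValue n) (b : Block m) (next : HashValue n → Attack n m) : Attack n m

/-- The set of messages that the attacker outputs when the compression function is `f`. -/
def Attack.result {n m : ℕ} (f : Compression n m) : Attack n m → Finset (Message m)
  | .output C => C
  | .query h b next => (next (f h b)).result f

/-- The number of queries made when the compression function is `f` (repeated queries are
counted each time). -/
def Attack.queries {n m : ℕ} (f : Compression n m) : Attack n m → ℕ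
  | .output _ => 0
  | .query h b next => (next (f h b)).queries f + 1

/-- The expected number of queries, for `f` chosen uniformly at random among all compression
functions. -/
noncomputable def Attack.expectedQueries {n m : ℕ} (A : Attack n m) : ℝ :=
  𝔼 f : Compression n m, (A.queries f : ℝ)

end Gihf

/-!
The attack follows the word `α_l` for `l = N(M, q)`, where `M = n ^ (q - 1) ^ 2 * r ^ (2 * q - 3)`.
Since `N(M, q)` is attained (`N_spec`, which needs that `N` is finite), there are `M` letters and a
factorization of `α_l` into at most `q` words in each of which the occurrences of these letters are
contiguous (`Contiguous`). All other letters are assigned a constant block `c`.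

*Combinatorics.* Some of these letters are chosen so that they can be merged into larger and larger
sets (`Mergeable`): in each of the words after the first, the present sets occupy separate segments,
and each `n` consecutive sets are united. The exponents in `M` are what is needed for `r` sets to remain
at the end (`exists_mergeable`).

*The attack.* In the first word, one finds for each chosen letter two blocks that lead to the same
hash value (`solvable_first_phase`). A set of letters with two alternative assignments is a `Box`;
the invariant (`State`) says that the hash value does not depend on the option followed in each box.
In each later word, a group of `n` boxes admits `2 ^ n` assignments, which are explored like a tree,
one segment after the other, until two of them collide; these two are the options of a new box
(`solvable_tree`, `State.merge`). The `r` boxes that remain give `2 ^ r` messages with one hash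
value (`State.exists_isCollision`).

*Expected cost.* Attacks are composed in terms of what is known of the compression function:
`Solvable P Q f₀ Φ` refers to the functions that agree with `f₀` on the set `Q` of queried points.
Two facts about a random function control the searches. If a block has been queried at few points
only, then chains that read it first at distinct values have independent continuations, whatever
else is known (`sum_nodup_same_blocks_le`); in each box one letter with this property is kept alive.
Chains that read different new blocks are independent and identically distributed
(`sum_nodup_distinct_blocks_le`), and among all distributions the uniform one makes collisions least
likely (`card_injOn_le`). Hence `t` chains have distinct ends with probability at most
`∏ i < t, (1 - i / 2 ^ n)`, up to the few exceptions, and the expected number of chains in a search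
is at most `1.65 * 2 ^ (n / 2)`, up to small terms (`sum_noCollision_min_sub_le`). So a word `w` costs
little more than `1.65 * 2 ^ (n / 2) * |w|` queries, which leaves room for lower-order terms in the
factor `2.5`.

*Small parameters.* A search that runs out of chains is followed by an exhaustive search with
`2 ^ (n + 1)` queries (`solvable_exhaustive`), and the whole attack is replaced by the exhaustive
search if `2 ^ (n + 1)` is within the bound. Otherwise `(M - 1) ^ 2 < N(M, q)` (`sq_lt_N`) shows that
`n ≥ 20` and that `2 ^ (n / 2)` is large in comparison with `q * N(M, q)`, which makes all lower-order
terms small (`cost_le`).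
-/

namespace Gihf

/-! ### Words in which the occurrences of each letter of `A` are contiguous -/

/-- Every letter of `A` occurs in `v`, and two distinct letters of `A` never alternate as
`a … b … a` in `v`. Equivalently, the collapsed word `(v)_A` is a permutation of `A`
(`isPermutationOf_collapse_iff`). Unlike that formulation, this one passes to subsets of `A`
at once. -/
def Contiguous (A : Finset ℕ) (v : List ℕ) : Prop :=
  (∀ a ∈ A, a ∈ v) ∧ ∀ a ∈ A, ∀ b ∈ A, a ≠ b → ¬ [a, b, a].Sublist v

lemma Contiguous.mono {A A' : Finset ℕ} {v : List ℕ} (h : Contiguous A v) (hA : A' ⊆ A) :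
    Contiguous A' v :=
  ⟨fun a ha => h.1 a (hA ha), fun a ha b hb => h.2 a (hA ha) b (hA hb)⟩

lemma sublist_destutter'_of_isChain (l : List ℕ) : ∀ (a : ℕ) (l' : List ℕ), l'.Sublist (a :: l) →
    l'.IsChain (fun a b => a ≠ b) → l'.Sublist (l.destutter' (fun a b => a ≠ b) a) := by
  induction l with
  | nil => intro a l' h _; simpa using h
  | cons b l ih =>
    intro a l' h hc
    by_cases hab : a ≠ b
    · rw [List.destutter'_cons_pos _ hab]
      rcases List.sublist_cons_iff.1 h with h' | ⟨r, rfl, h'⟩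
      · exact (ih b l' h' hc).cons _
      · exact (ih b r h' hc.tail).cons_cons _
    · rw [List.destutter'_cons_neg _ hab]
      push Not at hab
      subst hab
      rcases List.sublist_cons_iff.1 h with h' | ⟨r, rfl, h'⟩
      · exact ih a l' h' hc
      · refine ih a _ ?_ hc
        rcases List.sublist_cons_iff.1 h' with h'' | ⟨r', rfl, -⟩
        · exact h''.cons_cons _
        · simp at hc

/-- Destuttering keeps every subword without equal neighbours. -/
lemma sublist_destutter_of_isChain {l l' : List ℕ} (h : l'.Sublist l)
    (hc : l'.IsChain (fun a b => a ≠ b)) : l'.Sublist (l.destutter (fun a b => a ≠ b)) := by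
  cases l with
  | nil => simpa using h
  | cons a l => exact sublist_destutter'_of_isChain l a l' h hc

lemma mem_collapse {A : Finset ℕ} {v : List ℕ} {a : ℕ} : a ∈ collapse A v ↔ a ∈ A ∧ a ∈ v := by
  constructor
  · intro h
    have := (List.destutter_sublist _ _).subset h
    simp at this
    exact this.symm
  · rintro ⟨hA, hv⟩
    have : [a].Sublist (collapse A v) := by
      apply sublist_destutter_of_isChain
      · simp [hA, hv]
      · simp
    simpa using this

lemma collapse_sublist (A : Finset ℕ) (v : List ℕ) : (collapse A v).Sublist v :=
  (List.destutter_sublist _ _).trans List.filter_sublist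

lemma exists_alternation_of_two_le_count {a : ℕ} (l : List ℕ)
    (hc : l.IsChain (fun a b => a ≠ b)) (h : 2 ≤ l.count a) : ∃ b, a ≠ b ∧ [a, b, a].Sublist l := by
  induction l with
  | nil => simp at h
  | cons x l ih =>
    by_cases hx : x = a
    · subst hx
      rw [List.count_cons_self] at h
      cases l with
      | nil => simp at h
      | cons y l =>
        have hxy : x ≠ y := (List.isChain_cons_cons.1 hc).1
        refine ⟨y, hxy, List.Sublist.cons_cons _ (List.Sublist.cons_cons _ ?_)⟩
        rw [List.singleton_sublist]
        rw [List.count_cons_of_ne hxy.symm] at h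
        exact List.count_pos_iff.1 (by omega)
    · rw [List.count_cons_of_ne hx] at h
      obtain ⟨b, hb, hs⟩ := ih hc.tail h
      exact ⟨b, hb, hs.cons _⟩

lemma isPermutationOf_collapse_iff {A : Finset ℕ} {v : List ℕ} :
    IsPermutationOf A (collapse A v) ↔ Contiguous A v := by
  constructor
  · intro h
    refine ⟨fun a ha => ?_, fun a ha b hb hab hs => ?_⟩
    · exact (mem_collapse.1 (List.count_pos_iff.1 (by rw [h.2 a ha]; omega))).2
    · have hs' : [a, b, a].Sublist (v.filter (fun a => a ∈ A)) := by
        have := hs.filter (fun a => decide (a ∈ A))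
        simpa [ha, hb] using this
      have hs2 : [a, b, a].Sublist (collapse A v) :=
        sublist_destutter_of_isChain hs' (by simp [hab, hab.symm])
      have := hs2.count_le a
      rw [h.2 a ha] at this
      simp [List.count_cons] at this
  · intro h
    refine ⟨fun a ha => (mem_collapse.1 ha).1, fun a ha => ?_⟩
    have h1 : 0 < (collapse A v).count a := List.count_pos_iff.2 (mem_collapse.2 ⟨ha, h.1 a ha⟩)
    by_contra hne
    obtain ⟨b, hb, hs⟩ := exists_alternation_of_two_le_count (a := a) (collapse A v)
      (List.isChain_destutter _ _) (by omega)
    have hbA : b ∈ A := (mem_collapse.1 (hs.subset (by simp))).1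
    exact h.2 a ha b hbA hb (hs.trans (collapse_sublist A v))

/-! ### Finiteness of `N` -/

/-- The shortest prefix of `w` in which `K` distinct letters of `L` occur. -/
lemma exists_prefix_card_eq (L : Finset ℕ) (K : ℕ) (w : List ℕ)
    (hK : K ≤ (L.filter (· ∈ w)).card) :
    ∃ u v, w = u ++ v ∧ (L.filter (· ∈ u)).card = K := by
  induction w using List.reverseRecOn with
  | nil => exact ⟨[], [], rfl, by simp at hK ⊢; omega⟩
  | append_singleton w x ih =>
    by_cases h : K ≤ (L.filter (· ∈ w)).card
    · obtain ⟨u, v, rfl, huv⟩ := ih h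
      exact ⟨u, v ++ [x], by simp, huv⟩
    · refine ⟨w ++ [x], [], by simp, le_antisymm ?_ hK⟩
      have : L.filter (· ∈ w ++ [x]) ⊆ insert x (L.filter (· ∈ w)) := by
        intro a; simp; tauto
      have := (Finset.card_le_card this).trans (Finset.card_insert_le _ _)
      omega

/-- In a word with at least `M * K` letters, either `K` letters occur on both sides of a common
cut, or there are `M` letters whose ranges of occurrences are disjoint. -/
lemma exists_cut_or_contiguous (K : ℕ) : ∀ (M : ℕ) (w : List ℕ) (L : Finset ℕ),
    (∀ a ∈ L, a ∈ w) → M * K ≤ L.card → 0 < K →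
    (∃ u v, w = u ++ v ∧ ∃ L' ⊆ L, L'.card = K ∧ (∀ a ∈ L', a ∈ u) ∧ ∀ a ∈ L', a ∈ v) ∨
    ∃ A ⊆ L, A.card = M ∧ Contiguous A w := by
  intro M
  induction M with
  | zero =>
    intro w L _ _ _
    exact Or.inr ⟨∅, by simp, by simp, by simp [Contiguous]⟩
  | succ M ih =>
    intro w L hL hcard hK
    have hfull : L.filter (· ∈ w) = L := Finset.filter_true_of_mem hL
    obtain ⟨u, v, rfl, hu⟩ := exists_prefix_card_eq L K w (by rw [hfull]; nlinarith)
    by_cases hall : ∀ a ∈ L.filter (· ∈ u), a ∈ v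
    · exact Or.inl ⟨u, v, rfl, _, Finset.filter_subset _ _, hu,
        fun a ha => (Finset.mem_filter.1 ha).2, hall⟩
    · push Not at hall
      obtain ⟨a, ha, hav⟩ := hall
      rw [Finset.mem_filter] at ha
      have hcard' : M * K ≤ (L.filter (· ∉ u)).card := by
        have := Finset.card_filter_add_card_filter_not (s := L) (· ∈ u)
        rw [hu] at this
        have h2 : (M + 1) * K = M * K + K := by ring
        omega
      rcases ih v (L.filter (· ∉ u)) (fun b hb => by
        rw [Finset.mem_filter] at hb
        rcases List.mem_append.1 (hL b hb.1) with h | h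
        · exact absurd h hb.2
        · exact h) hcard' hK with h | h
      · obtain ⟨u', v', rfl, L', hL', hc, h1, h2⟩ := h
        exact Or.inl ⟨u ++ u', v', by simp, L', hL'.trans (Finset.filter_subset _ _), hc,
          fun a ha => by simp [h1 a ha], h2⟩
      · obtain ⟨A, hA, hc, hcon⟩ := h
        have haA : a ∉ A := fun h => (Finset.mem_filter.1 (hA h)).2 ha.2
        have hnu : ∀ b ∈ A, b ∉ u := fun b hb => (Finset.mem_filter.1 (hA hb)).2
        refine Or.inr ⟨insert a A, ?_, by rw [Finset.card_insert_of_notMem haA, hc], ?_, ?_⟩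
        · exact Finset.insert_subset ha.1 (hA.trans (Finset.filter_subset _ _))
        · intro b hb
          rcases Finset.mem_insert.1 hb with rfl | hb
          · simp [ha.2]
          · simp [hcon.1 b hb]
        · intro x hx y hy hxy hs
          rcases Finset.mem_insert.1 hx with rfl | hx
          · have hyA := (Finset.mem_insert.1 hy).resolve_left (Ne.symm hxy)
            rw [List.sublist_append_iff] at hs
            obtain ⟨l1, l2, heq, h1, h2⟩ := hs
            have hy1 : y ∉ l1 := fun h => hnu y hyA (h1.subset h)
            have hx2 : x ∉ l2 := fun h => hav (h2.subset h)
            rcases l1 with _ | ⟨p, _ | ⟨p', l1⟩⟩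
            · simp at heq; subst heq; simp at hx2
            · simp at heq; obtain ⟨_, rfl⟩ := heq; simp at hx2
            · simp at heq; obtain ⟨_, rfl, _⟩ := heq; simp at hy1
          · rw [List.sublist_append_iff] at hs
            obtain ⟨l1, l2, heq, h1, h2⟩ := hs
            have hx1 : x ∉ l1 := fun h => hnu x hx (h1.subset h)
            rcases l1 with _ | ⟨p, l1⟩
            · simp at heq
              subst heq
              rcases Finset.mem_insert.1 hy with rfl | hy
              · exact hav (h2.subset (by simp))
              · exact hcon.2 x hx y hy hxy h2
            · simp at heq; obtain ⟨rfl, _⟩ := heq; simp at hx1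

lemma exists_card_le_filter_eq (L : Finset ℕ) (c : ℕ → ℕ) (q K : ℕ) (hc : ∀ a ∈ L, c a < q)
    (hL : q * K < L.card) : ∃ i < q, K ≤ (L.filter (fun a => c a = i)).card := by
  by_contra h
  push Not at h
  have h1 : L.card = ∑ i ∈ Finset.range q, (L.filter (fun a => c a = i)).card :=
    Finset.card_eq_sum_card_fiberwise (fun a ha => by simpa using hc a ha)
  have h2 : ∑ i ∈ Finset.range q, (L.filter (fun a => c a = i)).card ≤ q * K := by
    calc _ ≤ ∑ i ∈ Finset.range q, K :=
          Finset.sum_le_sum fun i hi => (h i (by simpa using hi)).le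
      _ = q * K := by simp
  omega

/-- The finiteness behind `N`, by strong induction on `q`: if many letters cross a common cut, then
among these many have the same number of occurrences on the left, and the two sides are treated one
after the other; otherwise one factor suffices. -/
lemma exists_contiguous_factorization (q : ℕ) : ∀ M : ℕ, ∃ k : ℕ, ∀ (w : List ℕ) (L : Finset ℕ),
    (∀ a ∈ L, a ∈ w) → (∀ a ∈ L, w.count a ≤ q) → k ≤ L.card →
    ∃ A ⊆ L, A.card = M ∧ ∃ parts : List (List ℕ), 1 ≤ parts.length ∧ (1 ≤ q → parts.length ≤ q) ∧
      parts.flatten = w ∧ ∀ β ∈ parts, Contiguous A β := by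
  induction q using Nat.strong_induction_on with
  | _ q ih =>
    intro M
    choose! k hk using ih
    set K : ℕ := ∑ i ∈ Finset.range q, k i (k (q - i) M) + 1 with hKdef
    refine ⟨max 1 (M * (q * K + 1)), ?_⟩
    intro w L hL hcount hcard
    rcases exists_cut_or_contiguous (q * K + 1) M w L hL (le_trans (le_max_right _ _) hcard)
      (by omega) with h | h
    · obtain ⟨u, v, rfl, L', hL', hc, h1, h2⟩ := h
      have hpos : ∀ a ∈ L', 0 < u.count a ∧ 0 < v.count a := fun a ha =>
        ⟨List.count_pos_iff.2 (h1 a ha), List.count_pos_iff.2 (h2 a ha)⟩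
      have hsum : ∀ a ∈ L', u.count a + v.count a ≤ q := fun a ha => by
        have := hcount a (hL' ha)
        rwa [List.count_append] at this
      obtain ⟨i, hi, hcardi⟩ := exists_card_le_filter_eq L' (fun a => u.count a) q K
        (fun a ha => by have := hpos a ha; have := hsum a ha; show u.count a < q; omega) (by omega)
      obtain ⟨a₀, ha₀⟩ : (L'.filter (fun a => u.count a = i)).Nonempty :=
        Finset.card_pos.1 (by omega)
      have ha₀' := Finset.mem_filter.1 ha₀
      have h3 := hpos a₀ ha₀'.1
      have h4 := hsum a₀ ha₀'.1
      have hi0 : 0 < i := by have := ha₀'.2; omega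
      have hle : k i (k (q - i) M) ≤ K := (Finset.single_le_sum
        (f := fun i => k i (k (q - i) M)) (fun _ _ => Nat.zero_le _)
        (Finset.mem_range.2 hi)).trans (Nat.le_succ _)
      obtain ⟨A, hA, hAc, P, hP1, hP2, hP3, hP4⟩ := hk i hi (k (q - i) M) u
        (L'.filter (fun a => u.count a = i)) (fun a ha => h1 a (Finset.mem_filter.1 ha).1)
        (fun a ha => (Finset.mem_filter.1 ha).2.le) (hle.trans hcardi)
      have hAL : A ⊆ L' := hA.trans (Finset.filter_subset _ _)
      obtain ⟨A', hA', hAc', P', hP1', hP2', hP3', hP4'⟩ := hk (q - i) (by omega) M v A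
        (fun b hb => h2 b (hAL hb))
        (fun b hb => by
          have h5 := hsum b (hAL hb)
          have h6 := (Finset.mem_filter.1 (hA hb)).2
          omega) (by rw [hAc])
      refine ⟨A', hA'.trans (hAL.trans hL'), hAc', P ++ P', by simp; omega, ?_,
        by simp [hP3, hP3'], ?_⟩
      · intro _
        have := hP2 (by omega)
        have := hP2' (by omega)
        simp; omega
      · intro β hβ
        rcases List.mem_append.1 hβ with h | h
        · exact (hP4 β h).mono hA'
        · exact hP4' β h
    · obtain ⟨A, hA, hc, hcon⟩ := h
      exact ⟨A, hA, hc, [w], by simp, by simp, by simp, by simpa using hcon⟩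

/-- The set whose infimum is `N M q` is nonempty, so `N M q` belongs to it. -/
lemma N_spec (M q : ℕ) (hq : 1 ≤ q) : 0 < N M q ∧ ∀ α : List ℕ, N M q ≤ α.toFinset.card →
    (∀ a ∈ α, α.count a ≤ q) → HasPermutationFactorization M q α := by
  have hne : {k : ℕ | 0 < k ∧ ∀ α : List ℕ, k ≤ α.toFinset.card → (∀ a ∈ α, α.count a ≤ q) →
      HasPermutationFactorization M q α}.Nonempty := by
    obtain ⟨k, hk⟩ := exists_contiguous_factorization q M
    refine ⟨k + 1, by omega, fun α hα hcount => ?_⟩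
    obtain ⟨A, hA, hAc, P, h1, h2, h3, h4⟩ := hk α α.toFinset (by simp) (by simpa using hcount)
      (by omega)
    exact ⟨A, hA, hAc, P, h1, h2 hq, h3, fun β hβ => isPermutationOf_collapse_iff.2 (h4 β hβ)⟩
  exact Nat.sInf_mem hne

/-! ### A quadratic lower bound for `N` -/

/-- The `i`-th row of an array of letters with `s` columns. -/
def row (s i : ℕ) : List ℕ := (List.range s).map (Nat.pair i)

/-- The word `u₀ u₀ u₁ u₁ ⋯`, where `uᵢ` is the `i`-th row of an array with `t` rows and `s`
columns. -/
def doubledRows (s t : ℕ) : List ℕ := (List.range t).flatMap fun i => row s i ++ row s i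

lemma mem_row {s i a : ℕ} : a ∈ row s i ↔ ∃ j < s, Nat.pair i j = a := by simp [row]

lemma mem_doubledRows {s t a : ℕ} : a ∈ doubledRows s t ↔ ∃ i < t, ∃ j < s, Nat.pair i j = a := by
  simp [doubledRows, mem_row]

lemma unpair_fst_of_mem_row {s i a : ℕ} (h : a ∈ row s i) : a.unpair.1 = i := by
  obtain ⟨j, _, rfl⟩ := mem_row.1 h
  simp

lemma nodup_row (s i : ℕ) : (row s i).Nodup :=
  List.nodup_range.map fun _ _ h => (Nat.pair_eq_pair.1 h).2

lemma doubledRows_succ (s t : ℕ) :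
    doubledRows s (t + 1) = doubledRows s t ++ (row s t ++ row s t) := by
  simp [doubledRows, List.range_succ]

lemma unpair_fst_lt_of_mem_doubledRows {s t a : ℕ} (h : a ∈ doubledRows s t) :
    a.unpair.1 < t := by
  obtain ⟨i, hi, j, _, rfl⟩ := mem_doubledRows.1 h
  simpa using hi

lemma count_doubledRows_le (s t a : ℕ) : (doubledRows s t).count a ≤ 2 := by
  induction t with
  | zero => simp [doubledRows]
  | succ t ih =>
    rw [doubledRows_succ, List.count_append, List.count_append]
    by_cases ha : a ∈ row s t
    · have h0 : (doubledRows s t).count a = 0 := List.count_eq_zero.2 fun h => by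
        have := unpair_fst_lt_of_mem_doubledRows h
        rw [unpair_fst_of_mem_row ha] at this
        omega
      have := List.nodup_iff_count_le_one.1 (nodup_row s t) a
      omega
    · rw [List.count_eq_zero.2 ha]
      omega

lemma pairwise_doubledRows (s t : ℕ) :
    (doubledRows s t).Pairwise fun a b => a.unpair.1 ≤ b.unpair.1 := by
  induction t with
  | zero => simp [doubledRows]
  | succ t ih =>
    have hrow : ∀ a ∈ row s t ++ row s t, a.unpair.1 = t := by
      intro a ha
      rcases List.mem_append.1 ha with h | h <;> exact unpair_fst_of_mem_row h
    rw [doubledRows_succ, List.pairwise_append]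
    refine ⟨ih, List.Pairwise.imp_of_mem (R := fun _ _ => True) (fun ha hb _ => ?_)
      (List.pairwise_of_forall fun _ _ => trivial), ?_⟩
    · rw [hrow _ ha, hrow _ hb]
    · intro a ha b hb
      rw [hrow b hb]
      exact (unpair_fst_lt_of_mem_doubledRows ha).le

lemma pair_sublist_or {l : List ℕ} {a b : ℕ} (ha : a ∈ l) (hb : b ∈ l) (hab : a ≠ b) :
    [a, b].Sublist l ∨ [b, a].Sublist l := by
  obtain ⟨l1, l2, rfl⟩ := List.append_of_mem ha
  rcases List.mem_append.1 hb with h | h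
  · right
    exact (List.singleton_sublist.2 h).append (List.singleton_sublist.2 (by simp))
  · left
    rcases List.mem_cons.1 h with h | h
    · exact absurd h.symm hab
    · exact ((List.singleton_sublist.2 h).cons_cons a).trans (List.sublist_append_right _ _)

/-- In `u₀ u₀ u₁ u₁ ⋯`, two letters of the same row alternate, so a single factor holds at most one
letter of each row; and two factors share letters of one row only. -/
lemma card_le_of_factorization_doubledRows {s : ℕ} {A : Finset ℕ} {parts : List (List ℕ)}
    (hlen : 1 ≤ parts.length) (hflat : parts.flatten = doubledRows s s)
    (hA : A ⊆ (doubledRows s s).toFinset) (hcon : ∀ β ∈ parts, Contiguous A β) : A.card ≤ s := by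
  have hA' : ∀ a ∈ A, ∃ i < s, a ∈ row s i := fun a ha => by
    have := hA ha
    rw [List.mem_toFinset, mem_doubledRows] at this
    obtain ⟨i, hi, h⟩ := this
    exact ⟨i, hi, mem_row.2 h⟩
  rcases parts with _ | ⟨β, _ | ⟨γ, rest⟩⟩
  · simp at hlen
  · have hβ := hcon β (by simp)
    simp only [List.flatten_cons, List.flatten_nil, List.append_nil] at hflat
    have hinj : Set.InjOn (fun a : ℕ => a.unpair.1) A := by
      intro a ha b hb hab
      by_contra hne
      obtain ⟨i, hi, hai⟩ := hA' a ha
      obtain ⟨j, hj, hbj⟩ := hA' b hb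
      have hij : i = j := by
        have := unpair_fst_of_mem_row hai
        have := unpair_fst_of_mem_row hbj
        simp only at hab
        omega
      subst hij
      have hsub : (row s i ++ row s i).Sublist β := by
        rw [hflat, doubledRows]
        exact List.sublist_flatten_of_mem (by simp; exact ⟨i, hi, rfl⟩)
      rcases pair_sublist_or hai hbj hne with h | h
      · exact hβ.2 a ha b hb hne ((h.append (List.singleton_sublist.2 hai)).trans hsub)
      · exact hβ.2 b hb a ha (Ne.symm hne) ((h.append (List.singleton_sublist.2 hbj)).trans hsub)
    have := Finset.card_le_card_of_injOn (t := Finset.range s) _ (fun a ha => by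
      have h := hA ha
      rw [List.mem_toFinset] at h
      simpa using unpair_fst_lt_of_mem_doubledRows h) hinj
    simpa using this
  · have hβ := hcon β (by simp)
    have hγ := hcon γ (by simp)
    have hle : ∀ a ∈ A, ∀ b ∈ A, a.unpair.1 ≤ b.unpair.1 := by
      intro a ha b hb
      have hs : [a, b].Sublist (doubledRows s s) := by
        rw [← hflat]
        simp only [List.flatten_cons]
        exact (List.singleton_sublist.2 (hβ.1 a ha)).append
          ((List.singleton_sublist.2 (hγ.1 b hb)).trans (List.sublist_append_left _ _))
      have := (pairwise_doubledRows s s).sublist hs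
      simpa using this
    rcases A.eq_empty_or_nonempty with rfl | ⟨a, ha⟩
    · simp
    · obtain ⟨i, hi, hai⟩ := hA' a ha
      have hsub : A ⊆ (row s i).toFinset := by
        intro b hb
        obtain ⟨j, hj, hbj⟩ := hA' b hb
        have h1 := unpair_fst_of_mem_row hai
        have h2 := unpair_fst_of_mem_row hbj
        have h3 := hle a ha b hb
        have h4 := hle b hb a ha
        have : i = j := by omega
        subst this
        simpa using hbj
      calc A.card ≤ (row s i).toFinset.card := Finset.card_le_card hsub
        _ ≤ (row s i).length := List.toFinset_card_le _
        _ = s := by simp [row]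

lemma sq_lt_N (M q : ℕ) (hM : 1 ≤ M) (hq : 2 ≤ q) : (M - 1) ^ 2 < N M q := by
  by_contra hlt
  push Not at hlt
  have hcard : (doubledRows (M - 1) (M - 1)).toFinset.card = (M - 1) ^ 2 := by
    have : (doubledRows (M - 1) (M - 1)).toFinset =
        (Finset.range (M - 1) ×ˢ Finset.range (M - 1)).image fun p => Nat.pair p.1 p.2 := by
      ext a
      simp only [List.mem_toFinset, mem_doubledRows, Finset.mem_image, Finset.mem_product,
        Finset.mem_range, Prod.exists]
      constructor
      · rintro ⟨i, hi, j, hj, h⟩; exact ⟨i, j, ⟨hi, hj⟩, h⟩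
      · rintro ⟨i, j, ⟨hi, hj⟩, h⟩; exact ⟨i, hi, j, hj, h⟩
    rw [this, Finset.card_image_of_injective _ (fun p p' h => by
      have := Nat.pair_eq_pair.1 h
      exact Prod.ext this.1 this.2)]
    simp [sq]
  obtain ⟨A, hA, hAc, parts, h1, -, h3, h4⟩ := (N_spec M q (by omega)).2 (doubledRows (M - 1) (M - 1))
    (by rw [hcard]; exact hlt) (fun a _ => (count_doubledRows_le _ _ a).trans hq)
  have := card_le_of_factorization_doubledRows h1 h3 hA
    (fun β hβ => isPermutationOf_collapse_iff.1 (h4 β hβ))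
  omega

/-! ### Nested groupings of letters -/

/-- The word `v` is cut into segments, each assigned to a set of letters, such that a segment
contains no letter of the sets assigned to the other segments. -/
def Segmented (v : List ℕ) (L : List (Finset ℕ × List ℕ)) : Prop :=
  (L.map Prod.snd).flatten = v ∧
    L.Pairwise fun p p' => (∀ a ∈ p.2, a ∉ p'.1) ∧ ∀ a ∈ p'.2, a ∉ p.1

/-- The sets of letters `Fs` can be merged repeatedly, along the words `vs`: in the first word they
occur separately and in an order in which each `n` consecutive ones may be united; the unions can
be merged along the remaining words; and `r` sets remain at the end. -/
def Mergeable (n r : ℕ) : List (List ℕ) → List (Finset ℕ) → Prop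
  | [], Fs => Fs.length = r
  | v :: vs, Fs => ∃ G : List (List (Finset ℕ × List ℕ)), (∀ g ∈ G, g.length = n) ∧
      (G.flatten.map Prod.fst).Perm Fs ∧ Segmented v G.flatten ∧
      Mergeable n r vs (G.map fun g => g.foldr (fun p S => p.1 ∪ S) ∅)

lemma mem_foldr_union {ι : Type*} (f : ι → Finset ℕ) (g : List ι) (a : ℕ) :
    a ∈ g.foldr (fun p S => f p ∪ S) ∅ ↔ ∃ p ∈ g, a ∈ f p := by
  induction g with
  | nil => simp
  | cons p g ih => simp [ih]

lemma Mergeable.perm {n r : ℕ} {vs : List (List ℕ)} {Fs Fs' : List (Finset ℕ)}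
    (h : Mergeable n r vs Fs) (hp : Fs.Perm Fs') : Mergeable n r vs Fs' := by
  cases vs with
  | nil => exact hp.length_eq.symm.trans h
  | cons v vs =>
    obtain ⟨G, h1, h2, h3, h4⟩ := h
    exact ⟨G, h1, h2.trans hp, h3, h4⟩

lemma Mergeable.inter {n r : ℕ} (Z : Finset ℕ) {vs : List (List ℕ)} : ∀ {Fs : List (Finset ℕ)},
    Mergeable n r vs Fs → Mergeable n r vs (Fs.map (· ∩ Z)) := by
  induction vs with
  | nil => intro Fs h; simpa [Mergeable] using h
  | cons v vs ih =>
    rintro Fs ⟨G, h1, h2, h3, h4⟩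
    refine ⟨G.map (List.map fun p => (p.1 ∩ Z, p.2)), ?_, ?_, ?_, ?_⟩
    · intro g hg
      obtain ⟨g', hg', rfl⟩ := List.mem_map.1 hg
      simpa using h1 g' hg'
    · have := h2.map (· ∩ Z)
      rw [← List.map_flatten, List.map_map]
      rwa [List.map_map] at this
    · rw [← List.map_flatten]
      refine ⟨?_, ?_⟩
      · rw [List.map_map]; exact h3.1
      · refine List.pairwise_map.2 (h3.2.imp ?_)
        intro p p' h
        exact ⟨fun a ha hb => h.1 a ha (Finset.mem_inter.1 hb).1,
          fun a ha hb => h.2 a ha (Finset.mem_inter.1 hb).1⟩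
    · have := ih h4
      rw [List.map_map] at this ⊢
      convert this using 2
      ext g a
      simp only [Function.comp, Finset.mem_inter]
      rw [mem_foldr_union Prod.fst, mem_foldr_union Prod.fst]
      simp
      tauto

lemma Segmented.mem_segment {v : List ℕ} {L : List (Finset ℕ × List ℕ)} (h : Segmented v L)
    {p : Finset ℕ × List ℕ} (hp : p ∈ L) {a : ℕ} (ha : a ∈ p.1) (hav : a ∈ v) : a ∈ p.2 := by
  rw [← h.1] at hav
  obtain ⟨u, hu, hau⟩ := List.mem_flatten.1 hav
  obtain ⟨p', hp', rfl⟩ := List.mem_map.1 hu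
  by_cases hpp : p = p'
  · rwa [hpp]
  · have hsymm : Std.Symm fun p p' : Finset ℕ × List ℕ =>
        (∀ a ∈ p.2, a ∉ p'.1) ∧ ∀ a ∈ p'.2, a ∉ p.1 := ⟨fun _ _ h => ⟨h.2, h.1⟩⟩
    exact absurd ha ((h.2.forall hp hp' hpp).2 a hau)

lemma Segmented.pairwise_disjoint {v : List ℕ} {L : List (Finset ℕ × List ℕ)}
    (h : Segmented v L) (hv : ∀ p ∈ L, ∀ a ∈ p.1, a ∈ v) : (L.map Prod.fst).Pairwise Disjoint := by
  refine List.pairwise_map.2 (h.2.imp_of_mem fun {p p'} hp hp' hpp => ?_)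
  refine Finset.disjoint_left.2 fun a ha ha' => ?_
  exact hpp.1 a (h.mem_segment hp ha (hv p hp a ha)) ha'

/-- The shortest prefix `u` of `v` in which all occurrences of at least `V` letters of one of the
sets `Us` lie. As letters do not alternate, `u` contains few letters of the other sets. -/
lemma exists_prefix_completing {A : Finset ℕ} {V : ℕ} {Us : List (Finset ℕ)} {v : List ℕ}
    (hA : Contiguous A v) (hUs : ∀ U ∈ Us, U ⊆ A) (hne : Us ≠ []) (hV : ∀ U ∈ Us, V ≤ U.card) :
    ∃ u v', v = u ++ v' ∧ (∃ U ∈ Us, V ≤ (U.filter (· ∉ v')).card) ∧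
      ∀ U ∈ Us, (U.filter (· ∈ u)).card ≤ V := by
  classical
  have hex : ∃ i, ∃ U ∈ Us, V ≤ (U.filter (· ∉ v.drop i)).card := by
    obtain ⟨U, hU⟩ := List.exists_mem_of_ne_nil _ hne
    exact ⟨v.length, U, hU, by simpa using hV U hU⟩
  refine ⟨v.take (Nat.find hex), v.drop (Nat.find hex), (List.take_append_drop _ _).symm,
    Nat.find_spec hex, ?_⟩
  rcases hi : Nat.find hex with _ | j
  · simp
  · have hspec := Nat.find_spec hex
    have hmin := Nat.find_min hex (m := j) (by omega)
    rw [hi] at hspec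
    push Not at hmin
    by_cases hj : j < v.length
    · have hdrop : v.drop j = v[j] :: v.drop (j + 1) := List.drop_eq_getElem_cons hj
      have htake : v.take (j + 1) = v.take j ++ [v[j]] := by simp
      have hxA : v[j] ∈ A := by
        obtain ⟨U, hU, hc⟩ := hspec
        by_contra hx
        have : U.filter (· ∉ v.drop (j + 1)) = U.filter (· ∉ v.drop j) := by
          refine Finset.filter_congr fun a ha => ?_
          rw [hdrop, List.mem_cons]
          have : a ≠ v[j] := fun h => hx (h ▸ hUs U hU ha)
          tauto
        rw [this] at hc
        exact absurd (hmin U hU) (by omega)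
      intro U hU
      have hsub : U.filter (· ∈ v.take (j + 1)) ⊆ insert v[j] (U.filter (· ∉ v.drop j)) := by
        intro y hy
        obtain ⟨hyU, hy⟩ := Finset.mem_filter.1 hy
        rw [Finset.mem_insert, Finset.mem_filter]
        by_cases hyx : y = v[j]
        · exact Or.inl hyx
        · -- A letter with occurrences before and after position `j` would alternate with `v[j]`.
          refine Or.inr ⟨hyU, fun hyd => ?_⟩
          rw [htake, List.mem_append, List.mem_singleton] at hy
          have hy1 := hy.resolve_right hyx
          have hy2 : y ∈ v.drop (j + 1) := by
            rw [hdrop, List.mem_cons] at hyd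
            exact hyd.resolve_left hyx
          refine hA.2 y (hUs U hU hyU) v[j] hxA hyx ?_
          have h1 := (List.singleton_sublist.2 hy1).append
            (((List.singleton_sublist.2 hy2).cons_cons v[j]))
          rw [← hdrop, List.take_append_drop] at h1
          exact h1
      have := (Finset.card_le_card hsub).trans (Finset.card_insert_le _ _)
      have := hmin U hU
      omega
    · exfalso
      obtain ⟨U, hU⟩ := List.exists_mem_of_ne_nil _ hne
      have := hmin U hU
      rw [List.drop_eq_nil_of_le (by omega)] at this
      simp at this
      exact absurd (hV U hU) (by omega)

/-- Greedy selection of separated sets: out of `k` sets of at least `k * V` letters each, one can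
select `V` letters each such that the selected sets occur separately in `v`. -/
lemma exists_segmented {V : ℕ} : ∀ (k : ℕ) {A : Finset ℕ} {Us : List (Finset ℕ)} {v : List ℕ},
    Us.length = k + 1 → Contiguous A v → (∀ U ∈ Us, U ⊆ A) →
    (∀ U ∈ Us, (k + 1) * V ≤ U.card) →
    ∃ L₀ L : List (Finset ℕ × List ℕ), List.Forall₂ (fun U p => p.1 ⊆ U ∧ p.1.card = V) Us L₀ ∧
      L₀.Perm L ∧ Segmented v L := by
  intro k
  induction k with
  | zero =>
    intro A Us v hlen hA hUs hV
    obtain ⟨U, rfl⟩ := List.length_eq_one_iff.1 hlen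
    obtain ⟨T, hT, hTc⟩ := Finset.exists_subset_card_eq (s := U) (n := V) (by simpa using hV U)
    exact ⟨[(T, v)], [(T, v)], by simp [hT, hTc], List.Perm.refl _, by simp [Segmented]⟩
  | succ k ih =>
    intro A Us v hlen hA hUs hV
    obtain ⟨u, v', rfl, ⟨U, hU, hUc⟩, hu⟩ := exists_prefix_completing (V := V) hA hUs
      (by rintro rfl; simp at hlen) (fun U hU => le_trans (by nlinarith) (hV U hU))
    obtain ⟨T, hT, hTc⟩ := Finset.exists_subset_card_eq hUc
    have hperm := List.perm_cons_erase hU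
    have hmem : ∀ W ∈ Us.erase U, W ∈ Us := fun W hW => List.mem_of_mem_erase hW
    set A' : Finset ℕ := A.filter (· ∉ u) with hA'
    have hcon : Contiguous A' v' := by
      refine ⟨fun a ha => ?_, fun a ha b hb hab hs => ?_⟩
      · obtain ⟨haA, hau⟩ := Finset.mem_filter.1 ha
        exact (List.mem_append.1 (hA.1 a haA)).resolve_left hau
      · exact hA.2 a (Finset.mem_filter.1 ha).1 b (Finset.mem_filter.1 hb).1 hab
          (hs.trans (List.sublist_append_right _ _))
    obtain ⟨L₀, L, h1, h2, h3⟩ := ih (A := A') (Us := (Us.erase U).map (·.filter (· ∉ u))) (v := v')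
      (by rw [List.length_map, List.length_erase_of_mem hU, hlen]; rfl) hcon
      (by
        intro W hW
        obtain ⟨W, hW', rfl⟩ := List.mem_map.1 hW
        exact Finset.filter_subset_filter _ (hUs W (hmem W hW')))
      (by
        intro W hW
        obtain ⟨W, hW', rfl⟩ := List.mem_map.1 hW
        have h4 := Finset.card_filter_add_card_filter_not (s := W) (· ∈ u)
        have h5 := hu W (hmem W hW')
        have h6 := hV W (hmem W hW')
        have h7 : (k + 1 + 1) * V = (k + 1) * V + V := by ring
        omega)
    rw [List.forall₂_map_left_iff] at h1
    have hrel : List.Forall₂ (fun (U : Finset ℕ) (p : Finset ℕ × List ℕ) =>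
        p.1 ⊆ U ∧ p.1.card = V) (U :: Us.erase U) ((T, u) :: L₀) :=
      List.Forall₂.cons ⟨hT.trans (Finset.filter_subset _ _), hTc⟩
        (h1.imp fun U p h => ⟨h.1.trans (Finset.filter_subset _ _), h.2⟩)
    obtain ⟨L₁, h4, h5⟩ := List.perm_comp_forall₂ hperm hrel
    refine ⟨L₁, (T, u) :: L, h4, h5.trans (h2.cons _), ?_, ?_⟩
    · simp [h3.1]
    · refine List.pairwise_cons.2 ⟨fun p hp => ?_, h3.2⟩
      obtain ⟨W, -, hWp⟩ : ∃ W ∈ Us.erase U, p.1 ⊆ W.filter (· ∉ u) := by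
        have hp0 : p ∈ L₀ := h2.symm.subset hp
        obtain ⟨i, hi, rfl⟩ := List.getElem_of_mem hp0
        have hl := h1.length_eq
        exact ⟨_, List.getElem_mem (by omega), ((List.forall₂_iff_get.1 h1).2 i (by omega) hi).1⟩
      refine ⟨fun a ha hap => (Finset.mem_filter.1 (hWp hap)).2 ha, fun a ha haT => ?_⟩
      have hav' : a ∈ v' := by
        rw [← h3.1]
        exact List.mem_flatten.2 ⟨p.2, List.mem_map_of_mem hp, ha⟩
      exact (Finset.mem_filter.1 (hT haT)).2 hav'

lemma exists_segmented_of_card {A : Finset ℕ} {v : List ℕ} (hA : Contiguous A v) {k V : ℕ}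
    (hk : 0 < k) (hc : k * V ≤ A.card) : ∃ L : List (Finset ℕ × List ℕ), L.length = k ∧
      (∀ p ∈ L, p.1 ⊆ A ∧ p.1.card = V) ∧ Segmented v L := by
  obtain ⟨k, rfl⟩ : ∃ k', k = k' + 1 := ⟨k - 1, by omega⟩
  obtain ⟨L₀, L, h1, h2, h3⟩ := exists_segmented (V := V) k (Us := List.replicate (k + 1) A)
    (by simp) hA (fun U hU => by rw [List.eq_of_mem_replicate hU])
    (fun U hU => by rwa [List.eq_of_mem_replicate hU])
  refine ⟨L, by rw [← h2.length_eq, ← h1.length_eq, List.length_replicate], fun p hp => ?_, h3⟩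
  have hp0 : p ∈ L₀ := h2.symm.subset hp
  obtain ⟨i, hi, rfl⟩ := List.getElem_of_mem hp0
  have hl := h1.length_eq
  have := (List.forall₂_iff_get.1 h1).2 i (by omega) hi
  simpa using this

/-- One more word in front: the selected subsets of the sets `Us` are cut into `n` pieces each,
along the new word `v`. -/
lemma exists_mergeable_cons {A : Finset ℕ} {v : List ℕ} {vs : List (List ℕ)} {n r W : ℕ}
    (hn : 0 < n) (hA : Contiguous A v) {Us : List (Finset ℕ)} (hUs : ∀ U ∈ Us, U ⊆ A)
    (hdisj : Us.Pairwise Disjoint) {L₀ L : List (Finset ℕ × List ℕ)}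
    (h1 : List.Forall₂ (fun U p => p.1 ⊆ U ∧ p.1.card = n * W) Us L₀) (h2 : L₀.Perm L)
    (h3 : Segmented v L) (hm : Mergeable n r vs Us) :
    ∃ Fs : List (Finset ℕ), Fs.length = n * Us.length ∧ Fs.Pairwise Disjoint ∧
      (∀ S ∈ Fs, S ⊆ A ∧ S.card = W) ∧ Mergeable n r (v :: vs) Fs := by
  have hl := h1.length_eq
  have hget : ∀ i (hi : i < Us.length), L₀[i].1 ⊆ Us[i] ∧ L₀[i].1.card = n * W := fun i hi => by
    simpa using (List.forall₂_iff_get.1 h1).2 i hi (by omega)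
  have hL : ∀ p ∈ L, p.1 ⊆ A ∧ p.1.card = n * W := by
    intro p hp
    obtain ⟨i, hi, rfl⟩ := List.getElem_of_mem (h2.symm.subset hp)
    have := hget i (by omega)
    exact ⟨this.1.trans (hUs _ (List.getElem_mem _)), this.2⟩
  have hsubl : ∀ p ∈ L, p.2.Sublist v := fun p hp => by
    rw [← h3.1]
    exact List.sublist_flatten_of_mem (List.mem_map_of_mem hp)
  have hcut : ∀ p ∈ L, ∃ C : List (Finset ℕ × List ℕ), C.length = n ∧
      (∀ t ∈ C, t.1 ⊆ p.1 ∧ t.1.card = W) ∧ Segmented p.2 C := by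
    intro p hp
    refine exists_segmented_of_card (A := p.1) ⟨fun a ha => ?_, fun a ha b hb hab hs => ?_⟩ hn
      (hL p hp).2.ge
    · exact h3.mem_segment hp ha (hA.1 a ((hL p hp).1 ha))
    · exact hA.2 a ((hL p hp).1 ha) b ((hL p hp).1 hb) hab (hs.trans (hsubl p hp))
  choose! C hC1 hC2 hC3 using hcut
  have hseg : Segmented v (L.map C).flatten := by
    refine ⟨?_, List.pairwise_flatten.2 ⟨?_, ?_⟩⟩
    · rw [← h3.1, List.map_flatten, List.flatten_flatten, List.map_map, List.map_map]
      congr 1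
      exact List.map_congr_left fun p hp => (hC3 p hp).1
    · intro l hl
      obtain ⟨p, hp, rfl⟩ := List.mem_map.1 hl
      exact (hC3 p hp).2
    · refine List.pairwise_map.2 (h3.2.imp_of_mem fun {p p'} hp hp' h t ht t' ht' => ?_)
      have hsub : ∀ q ∈ L, ∀ s ∈ C q, ∀ a ∈ s.2, a ∈ q.2 := fun q hq s hs a ha => by
        rw [← (hC3 q hq).1]
        exact List.mem_flatten.2 ⟨s.2, List.mem_map_of_mem hs, ha⟩
      exact ⟨fun a ha ha' => h.1 a (hsub p hp t ht a ha) ((hC2 p' hp' t' ht').1 ha'),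
        fun a ha ha' => h.2 a (hsub p' hp' t' ht' a ha) ((hC2 p hp t ht).1 ha')⟩
  have hmem : ∀ t ∈ (L.map C).flatten, t.1 ⊆ A ∧ t.1.card = W := by
    intro t ht
    obtain ⟨l, hl, htl⟩ := List.mem_flatten.1 ht
    obtain ⟨p, hp, rfl⟩ := List.mem_map.1 hl
    exact ⟨(hC2 p hp t htl).1.trans (hL p hp).1, (hC2 p hp t htl).2⟩
  -- Letters of `Us` that were not selected are dropped, so the unions are `U ∩ Z` for `U` in `Us`.
  refine ⟨(L.map C).flatten.map Prod.fst, ?_, ?_, ?_, L.map C, ?_, List.Perm.refl _, hseg, ?_⟩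
  · rw [List.length_map, List.length_flatten, List.map_map, hl, h2.length_eq]
    rw [List.map_congr_left (f := List.length ∘ C) (g := fun _ => n) fun p hp => hC1 p hp]
    simp [mul_comm]
  · exact hseg.pairwise_disjoint fun p hp a ha => hA.1 a ((hmem p hp).1 ha)
  · intro S hS
    obtain ⟨t, ht, rfl⟩ := List.mem_map.1 hS
    exact hmem t ht
  · intro g hg
    obtain ⟨p, hp, rfl⟩ := List.mem_map.1 hg
    exact hC1 p hp
  · set un : List (Finset ℕ × List ℕ) → Finset ℕ := fun g => g.foldr (fun p S => p.1 ∪ S) ∅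
    set Z : Finset ℕ := un (L.map C).flatten
    refine (hm.inter Z).perm ?_
    have heq : Us.map (· ∩ Z) = L₀.map fun p => un (C p) := by
      refine List.ext_getElem (by simpa using hl) fun i hi hi' => ?_
      simp only [List.length_map] at hi hi'
      simp only [List.getElem_map]
      have hiL : L₀[i] ∈ L := h2.subset (List.getElem_mem _)
      ext a
      rw [Finset.mem_inter, show a ∈ Z ↔ _ from mem_foldr_union Prod.fst _ a,
        show a ∈ un (C L₀[i]) ↔ _ from mem_foldr_union Prod.fst _ a]
      constructor
      · rintro ⟨haU, t, ht, hat⟩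
        obtain ⟨l, hl', htl⟩ := List.mem_flatten.1 ht
        obtain ⟨p, hp, rfl⟩ := List.mem_map.1 hl'
        obtain ⟨j, hj, rfl⟩ := List.getElem_of_mem (h2.symm.subset hp)
        have haj : a ∈ Us[j] := (hget j (by omega)).1 ((hC2 _ hp t htl).1 hat)
        have hij : i = j := by
          rcases lt_trichotomy i j with h | h | h
          · exact absurd haj (Finset.disjoint_left.1
              (List.pairwise_iff_getElem.1 hdisj i j hi (by omega) h) haU)
          · exact h
          · exact absurd haU (Finset.disjoint_left.1
              (List.pairwise_iff_getElem.1 hdisj j i (by omega) hi h) haj)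
        subst hij
        exact ⟨t, htl, hat⟩
      · rintro ⟨t, ht, hat⟩
        refine ⟨(hget i hi).1 ((hC2 _ hiL t ht).1 hat), t, ?_, hat⟩
        exact List.mem_flatten.2 ⟨_, List.mem_map_of_mem hiL, ht⟩
    rw [heq, List.map_map]
    exact h2.map _

/-- A set of `n ^ (d + 1) ^ 2 * r ^ (2 * d + 1)` letters, contiguous in each of `d + 1` words,
contains `n ^ (d + 1) * r` letters that can be merged along these words. For the induction on `d`
the letters are blown up to sets of `W` letters. -/
lemma exists_mergeable {n r : ℕ} (hn : 0 < n) (hr : 0 < r) : ∀ (d : ℕ) (vs : List (List ℕ)),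
    vs.length = d + 1 → ∀ (W : ℕ) (A : Finset ℕ),
    n ^ (d + 1) ^ 2 * r ^ (2 * d + 1) * W ≤ A.card → (∀ v ∈ vs, Contiguous A v) →
    ∃ Fs : List (Finset ℕ), Fs.length = n ^ (d + 1) * r ∧ Fs.Pairwise Disjoint ∧
      (∀ S ∈ Fs, S ⊆ A ∧ S.card = W) ∧ Mergeable n r vs Fs := by
  intro d
  induction d with
  | zero =>
    intro vs hvs W A hcard hcon
    obtain ⟨v, rfl⟩ := List.length_eq_one_iff.1 hvs
    have hv := hcon v (by simp)
    obtain ⟨L, h1, h2, h3⟩ := exists_segmented_of_card hv hr (V := n * W) (by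
      refine le_trans (le_of_eq ?_) hcard
      simp; ring)
    obtain ⟨Fs, h4, h5, h6, h7⟩ := exists_mergeable_cons (r := r) (vs := []) hn hv
      (Us := L.map Prod.fst) (L₀ := L) (L := L)
      (by intro U hU; obtain ⟨p, hp, rfl⟩ := List.mem_map.1 hU; exact (h2 p hp).1)
      (h3.pairwise_disjoint fun p hp a ha => hv.1 a ((h2 p hp).1 ha))
      (by
        rw [List.forall₂_map_left_iff]
        exact List.forall₂_same.2 fun p hp => ⟨subset_rfl, (h2 p hp).2⟩)
      (List.Perm.refl _) h3 (by simpa [Mergeable] using h1)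
    exact ⟨Fs, by rw [h4, List.length_map, h1]; simp, h5, h6, h7⟩
  | succ d ih =>
    intro vs hvs W A hcard hcon
    rcases vs with _ | ⟨v, vs⟩
    · simp at hvs
    have hv := hcon v (by simp)
    -- The later words are treated first. Of the sets obtained, of size `n ^ (d + 1) * r * (n * W)`,
    -- parts of size `n * W` are separated in `v` and split into `n` pieces each.
    obtain ⟨Us, h1, h2, h3, h4⟩ := ih vs (by simpa using hvs) (n ^ (d + 1) * r * (n * W)) A (by
        refine le_trans ?_ hcard
        calc n ^ (d + 1) ^ 2 * r ^ (2 * d + 1) * (n ^ (d + 1) * r * (n * W))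
            = n ^ ((d + 1) ^ 2 + (d + 1) + 1) * r ^ (2 * d + 1 + 1) * W := by ring
          _ ≤ n ^ (d + 1 + 1) ^ 2 * r ^ (2 * (d + 1) + 1) * W := by
            have h1 := Nat.pow_le_pow_right hn
              (show (d + 1) ^ 2 + (d + 1) + 1 ≤ (d + 1 + 1) ^ 2 by nlinarith)
            have h2 := Nat.pow_le_pow_right hr
              (show 2 * d + 1 + 1 ≤ 2 * (d + 1) + 1 by omega)
            gcongr)
      (fun v hv => hcon v (by simp [hv]))
    have hpos : 0 < n ^ (d + 1) * r := by positivity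
    obtain ⟨L₀, L, h5, h6, h7⟩ := exists_segmented (V := n * W) (n ^ (d + 1) * r - 1) (Us := Us)
      (by omega) hv (fun U hU => (h3 U hU).1) (fun U hU => by
        rw [(h3 U hU).2, Nat.sub_add_cancel hpos])
    obtain ⟨Fs, h8, h9, h10, h11⟩ := exists_mergeable_cons hn hv (fun U hU => (h3 U hU).1) h2 h5 h6
      h7 h4
    exact ⟨Fs, by rw [h8, h1]; ring, h9, h10, h11⟩

/-! ### The birthday problem for an arbitrary distribution -/

/-- For independent draws `v₁, …, v_k` with weights `p`, the total weight of the outcomes in which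
the draws are distinct and lie in `U`. -/
def distinctWeight {ι : Type*} [DecidableEq ι] (p : ι → ℝ) : ℕ → Finset ι → ℝ
  | 0, _ => 1
  | k + 1, U => ∑ v ∈ U, p v * distinctWeight p k (U.erase v)

/-- The probability that `t` independent uniform draws from `N` values are distinct. -/
noncomputable def noCollision (N : ℝ) (t : ℕ) : ℝ := ∏ i ∈ Finset.range t, (1 - i / N)

section distinctWeight

variable {ι : Type*} [DecidableEq ι] {p : ι → ℝ}

lemma distinctWeight_nonneg (hp : ∀ v, 0 ≤ p v) (k : ℕ) : ∀ U : Finset ι,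
    0 ≤ distinctWeight p k U := by
  induction k with
  | zero => intro U; simp [distinctWeight]
  | succ k ih => intro U; exact Finset.sum_nonneg fun v _ => mul_nonneg (hp v) (ih _)

lemma distinctWeight_succ_eq_erase (k : ℕ) : ∀ (U : Finset ι) {v : ι}, v ∈ U →
    distinctWeight p (k + 1) U = distinctWeight p (k + 1) (U.erase v) +
      (k + 1) * p v * distinctWeight p k (U.erase v) := by
  induction k with
  | zero =>
    intro U v hv
    simp only [distinctWeight, mul_one]
    rw [← Finset.sum_erase_add _ _ hv]
    simp
  | succ k ih =>
    intro U v hv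
    have h1 : distinctWeight p (k + 1 + 1) U = ∑ u ∈ U.erase v,
        p u * distinctWeight p (k + 1) (U.erase u) + p v * distinctWeight p (k + 1) (U.erase v) :=
      (Finset.sum_erase_add _ _ hv).symm
    have h2 : ∑ u ∈ U.erase v, p u * distinctWeight p (k + 1) (U.erase u) =
        ∑ u ∈ U.erase v, (p u * distinctWeight p (k + 1) ((U.erase v).erase u) +
          (k + 1) * p v * (p u * distinctWeight p k ((U.erase v).erase u))) := by
      refine Finset.sum_congr rfl fun u hu => ?_
      have hvu : v ∈ U.erase u :=
        Finset.mem_erase.2 ⟨(Finset.mem_erase.1 hu).1.symm, hv⟩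
      rw [ih (U.erase u) hvu, Finset.erase_right_comm]
      ring
    rw [h1, h2, Finset.sum_add_distrib, ← Finset.mul_sum]
    have h3 : ∑ u ∈ U.erase v, p u * distinctWeight p k ((U.erase v).erase u) =
        distinctWeight p (k + 1) (U.erase v) := rfl
    have h4 : ∑ u ∈ U.erase v, p u * distinctWeight p (k + 1) ((U.erase v).erase u) =
        distinctWeight p (k + 1 + 1) (U.erase v) := rfl
    rw [h3, h4]
    push_cast
    ring

/-- Uniform draws are the least likely to collide. The Chebyshev sum inequality applies because
the weight of the distinct draws that contain `v` increases with `p v`. -/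
lemma card_mul_distinctWeight_succ_le (hp : ∀ v, 0 ≤ p v) (U : Finset ι) (hU : ∑ v ∈ U, p v = 1)
    (k : ℕ) : U.card * distinctWeight p (k + 1) U ≤ distinctWeight p k U * (U.card - k) := by
  rcases k with _ | k
  · simp [distinctWeight, hU]
  · set w : ι → ℝ := fun v => p v * distinctWeight p k (U.erase v) with hw
    have hmono : MonovaryOn p w U := by
      refine MonovaryOn.symm fun i hi j hj hij => ?_
      have hne : i ≠ j := fun h => by subst h; exact lt_irrefl _ hij
      simp only [hw]
      rcases k with _ | k
      · simpa [distinctWeight] using hij.le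
      · rw [distinctWeight_succ_eq_erase k (U.erase i) (Finset.mem_erase.2 ⟨hne.symm, hj⟩),
          distinctWeight_succ_eq_erase k (U.erase j) (Finset.mem_erase.2 ⟨hne, hi⟩),
          Finset.erase_right_comm]
        have := mul_le_mul_of_nonneg_right hij.le
          (distinctWeight_nonneg hp (k + 1) ((U.erase j).erase i))
        nlinarith
    have hcheb := hmono.sum_mul_sum_le_card_mul_sum
    have hsw : ∑ v ∈ U, w v = distinctWeight p (k + 1) U := rfl
    rw [hU, one_mul, hsw] at hcheb
    have h1 : distinctWeight p (k + 1) U = distinctWeight p (k + 1 + 1) U +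
        (k + 1) * ∑ v ∈ U, p v * w v := by
      calc distinctWeight p (k + 1) U = ∑ v ∈ U, p v * distinctWeight p (k + 1) U := by
            rw [← Finset.sum_mul, hU, one_mul]
        _ = ∑ v ∈ U, (p v * distinctWeight p (k + 1) (U.erase v) + (k + 1) * (p v * w v)) := by
            refine Finset.sum_congr rfl fun v hv => ?_
            rw [distinctWeight_succ_eq_erase k U hv, hw]
            ring
        _ = _ := by
            rw [Finset.sum_add_distrib, ← Finset.mul_sum]
            rfl
    have h2 : (0 : ℝ) ≤ (k + 1 : ℝ) := by positivity
    push_cast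
    nlinarith [mul_le_mul_of_nonneg_left hcheb h2]

end distinctWeight

lemma noCollision_succ (N : ℝ) (t : ℕ) :
    noCollision N (t + 1) = noCollision N t * (1 - t / N) := Finset.prod_range_succ _ _

lemma noCollision_nonneg (N t : ℕ) : 0 ≤ noCollision N t := by
  by_cases h : t ≤ N
  · refine Finset.prod_nonneg fun i hi => ?_
    have : (i : ℝ) ≤ N := by exact_mod_cast (Finset.mem_range.1 hi).le.trans h
    have := div_le_one_of_le₀ this (by positivity)
    linarith
  · rcases Nat.eq_zero_or_pos N with rfl | hN
    · simp [noCollision]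
    · refine (Finset.prod_eq_zero (i := N) (by simp; omega) ?_).ge
      rw [div_self (by positivity), sub_self]

lemma noCollision_antitone (N : ℕ) : Antitone (noCollision N) := by
  refine antitone_nat_of_succ_le fun t => ?_
  rw [noCollision_succ]
  have h1 := noCollision_nonneg N t
  have h2 : (0 : ℝ) ≤ t / N := by positivity
  nlinarith

lemma noCollision_le_one (N t : ℕ) : noCollision N t ≤ 1 := by
  simpa [noCollision] using noCollision_antitone N (Nat.zero_le t)

lemma distinctWeight_le_noCollision {ι : Type*} [DecidableEq ι] {p : ι → ℝ} (hp : ∀ v, 0 ≤ p v)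
    (U : Finset ι) (hU : ∑ v ∈ U, p v = 1) (k : ℕ) :
    distinctWeight p k U ≤ noCollision U.card k := by
  induction k with
  | zero => simp [distinctWeight, noCollision]
  | succ k ih =>
    have hne : U.Nonempty := by
      by_contra h
      rw [Finset.not_nonempty_iff_eq_empty] at h
      subst h
      simp at hU
    have hpos : (0 : ℝ) < U.card := by exact_mod_cast Finset.card_pos.2 hne
    have h1 := card_mul_distinctWeight_succ_le hp U hU k
    have h2 : distinctWeight p (k + 1) U ≤ distinctWeight p k U * (1 - k / U.card) := by
      rw [← mul_le_mul_iff_right₀ hpos]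
      refine h1.trans (le_of_eq ?_)
      field_simp
    by_cases h : (0 : ℝ) ≤ 1 - k / U.card
    · rw [noCollision_succ]
      exact h2.trans (mul_le_mul_of_nonneg_right ih h)
    · push Not at h
      exact (h2.trans (mul_nonpos_of_nonneg_of_nonpos (distinctWeight_nonneg hp _ _) h.le)).trans
        (noCollision_nonneg _ _)

section counting

open Classical

variable {I Y V : Type*} [Fintype I] [DecidableEq I] [Fintype Y] [DecidableEq V]

/-- The value at `i` is independent of an event that does not depend on it. -/
lemma card_filter_and_mul_card (i : I) (P : Y → Prop) (E : (I → Y) → Prop)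
    (hE : ∀ ψ y, E (Function.update ψ i y) ↔ E ψ) :
    (Finset.univ.filter fun ψ : I → Y => P (ψ i) ∧ E ψ).card * Fintype.card Y =
      (Finset.univ.filter P).card * (Finset.univ.filter E).card := by
  rw [← Finset.card_univ (α := Y), ← Finset.card_product, ← Finset.card_product]
  refine Finset.card_nbij' (fun x => (x.1 i, Function.update x.1 i x.2))
    (fun x => (Function.update x.2 i x.1, x.2 i)) ?_ ?_ ?_ ?_
  · rintro ⟨ψ, y⟩ h
    simp only [Finset.coe_product, Set.mem_prod, Finset.mem_coe, Finset.mem_filter,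
      Finset.mem_univ, true_and, and_true] at h ⊢
    exact ⟨h.1, (hE _ _).2 h.2⟩
  · rintro ⟨y, ψ⟩ h
    simp only [Finset.coe_product, Set.mem_prod, Finset.mem_coe, Finset.mem_filter,
      Finset.mem_univ, true_and, and_true] at h ⊢
    exact ⟨by simpa using h.1, (hE _ _).2 h.2⟩
  · rintro ⟨ψ, y⟩ _; simp
  · rintro ⟨y, ψ⟩ _; simp

lemma card_injOn_eq [Nonempty Y] (G : Y → V) (s : Finset I) : ∀ U : Finset V,
    ((Finset.univ.filter fun ψ : I → Y =>
        (∀ i ∈ s, G (ψ i) ∈ U) ∧ Set.InjOn (fun i => G (ψ i)) s).card : ℝ) =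
      distinctWeight (fun v => ((Finset.univ.filter fun y => G y = v).card : ℝ) / Fintype.card Y)
        s.card U * Fintype.card (I → Y) := by
  have hY : (Fintype.card Y : ℝ) ≠ 0 := by exact_mod_cast Fintype.card_ne_zero
  induction s using Finset.induction_on with
  | empty => intro U; simp [distinctWeight]
  | insert i s hi ih =>
    intro U
    rw [Finset.card_insert_of_notMem hi, distinctWeight]
    set E : V → (I → Y) → Prop := fun v ψ =>
      (∀ j ∈ s, G (ψ j) ∈ U.erase v) ∧ Set.InjOn (fun j => G (ψ j)) s
    have hsplit : (Finset.univ.filter fun ψ : I → Y =>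
        (∀ j ∈ insert i s, G (ψ j) ∈ U) ∧ Set.InjOn (fun j => G (ψ j)) (insert i s : Finset I)) =
        U.biUnion fun v => Finset.univ.filter fun ψ : I → Y => G (ψ i) = v ∧ E v ψ := by
      ext ψ
      simp only [Finset.mem_filter, Finset.mem_univ, true_and, Finset.mem_biUnion, E,
        Finset.forall_mem_insert, Finset.coe_insert, Finset.mem_erase]
      rw [Set.injOn_insert (by simpa using hi)]
      constructor
      · rintro ⟨⟨h1, h2⟩, h3, h4⟩
        exact ⟨_, h1, rfl, fun j hj => ⟨fun h => h4 ⟨j, hj, h⟩, h2 j hj⟩, h3⟩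
      · rintro ⟨v, hv, rfl, h1, h2⟩
        exact ⟨⟨hv, fun j hj => (h1 j hj).2⟩, h2, fun ⟨j, hj, h⟩ => (h1 j hj).1 h⟩
    rw [hsplit, Finset.card_biUnion]
    · rw [Nat.cast_sum, Finset.sum_mul]
      refine Finset.sum_congr rfl fun v _ => ?_
      have hind := card_filter_and_mul_card i (fun y => G y = v) (E v) (fun ψ y => by
        have h : ∀ j ∈ s, Function.update ψ i y j = ψ j := fun j hj =>
          Function.update_of_ne (by rintro rfl; exact hi hj) _ _
        simp only [E]
        refine and_congr (forall₂_congr fun j hj => by rw [h j hj]) ?_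
        exact Set.EqOn.injOn_iff fun j hj => by rw [h j hj])
      have hind' : ((Finset.univ.filter fun ψ : I → Y => G (ψ i) = v ∧ E v ψ).card : ℝ) *
          Fintype.card Y = (Finset.univ.filter fun y => G y = v).card *
            (Finset.univ.filter (E v)).card := by
        rw [← Nat.cast_mul, ← Nat.cast_mul]
        congr 1
        convert hind
      rw [ih (U.erase v)] at hind'
      rw [← mul_left_inj' hY, hind']
      field_simp
    · intro v _ v' _ hne
      refine Finset.disjoint_left.2 fun ψ h h' => hne ?_
      rw [← (Finset.mem_filter.1 h).2.1, (Finset.mem_filter.1 h').2.1]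

/-- Birthday bound: for independent draws, of any distribution on `V`, indexed by `s`. -/
lemma card_injOn_le [Fintype V] [Nonempty Y] (G : Y → V) (s : Finset I) :
    ((Finset.univ.filter fun ψ : I → Y => Set.InjOn (fun i => G (ψ i)) s).card : ℝ) ≤
      noCollision (Fintype.card V) s.card * Fintype.card (I → Y) := by
  have hY : (Fintype.card Y : ℝ) ≠ 0 := by exact_mod_cast Fintype.card_ne_zero
  have h := card_injOn_eq G s Finset.univ
  simp only [Finset.mem_univ, implies_true, true_and] at h
  rw [h]
  refine mul_le_mul_of_nonneg_right ?_ (by positivity)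
  refine distinctWeight_le_noCollision (fun v => by positivity) _ ?_ _
  rw [← Finset.sum_div, div_eq_one_iff_eq hY, ← Nat.cast_sum]
  congr 1
  exact (Finset.card_eq_sum_card_fiberwise (f := G) (fun _ _ => Finset.mem_univ _)).symm

end counting

/-! ### Expected number of draws -/

lemma sum_mul_noCollision (N : ℕ) (hN : 0 < N) (K : ℕ) :
    ∑ t ∈ Finset.range K, t * noCollision N t = N * (1 - noCollision N K) := by
  have hN' : (N : ℝ) ≠ 0 := by positivity
  induction K with
  | zero => simp [noCollision]
  | succ K ih =>
    rw [Finset.sum_range_succ, ih, noCollision_succ]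
    field_simp
    ring

lemma noCollision_mul_le (N : ℕ) (hN : 0 < N) (K : ℕ) :
    noCollision N K * (K * (K - 1)) ≤ 2 * N := by
  have h1 := sum_mul_noCollision N hN K
  have h2 : ∑ t ∈ Finset.range K, (t : ℝ) * noCollision N K ≤
      ∑ t ∈ Finset.range K, t * noCollision N t :=
    Finset.sum_le_sum fun t ht => mul_le_mul_of_nonneg_left
      (noCollision_antitone N (Finset.mem_range.1 ht).le) (by positivity)
  rw [← Finset.sum_mul, h1] at h2
  have h3 : (∑ t ∈ Finset.range K, (t : ℝ)) * 2 = K * (K - 1) := by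
    induction K with
    | zero => simp
    | succ K ih => clear ih h1 h2; induction K + 1 with
      | zero => simp
      | succ K ih => rw [Finset.sum_range_succ, add_mul, ih]; push_cast; ring
  have h4 := noCollision_nonneg N K
  have h5 : (0 : ℝ) < N := by positivity
  nlinarith

lemma sum_max_le {s : ℝ} (hs : 0 < s) (K : ℕ) :
    ∑ t ∈ Finset.range K, max (1 - t / s) 0 ≤ s / 2 + 1 := by
  have key : ∀ K : ℕ, ∑ t ∈ Finset.range K, max (1 - ((t + 1 : ℕ) : ℝ) / s) 0 ≤
      s / 2 - s / 2 * (max (1 - K / s) 0) ^ 2 := by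
    intro K
    induction K with
    | zero => simp
    | succ K ih =>
      rw [Finset.sum_range_succ]
      have hstep : (1 - ((K + 1 : ℕ) : ℝ) / s) = (1 - K / s) - 1 / s := by push_cast; ring
      have hinv : 0 < 1 / s := by positivity
      rcases le_total (1 - ((K + 1 : ℕ) : ℝ) / s) 0 with h | h
      · rw [max_eq_right h]
        have : 0 ≤ s / 2 * (max (1 - K / s) 0) ^ 2 := by positivity
        simp only [ne_eq, OfNat.ofNat_ne_zero, not_false_eq_true, zero_pow, mul_zero]
        linarith
      · have h' : 0 ≤ 1 - (K : ℝ) / s := by rw [hstep] at h; linarith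
        rw [max_eq_left h', hstep] at *
        rw [max_eq_left h]
        have : s / 2 * (1 - K / s) ^ 2 = s / 2 * (1 - K / s - 1 / s) ^ 2 +
            (1 - K / s - 1 / s) + 1 / s / 2 := by field_simp; ring
        linarith
  have h1 : ∑ t ∈ Finset.range K, max (1 - (t : ℝ) / s) 0 ≤
      ∑ t ∈ Finset.range (K + 1), max (1 - (t : ℝ) / s) 0 :=
    Finset.sum_le_sum_of_subset_of_nonneg (Finset.range_mono (Nat.le_succ K))
      fun _ _ _ => le_max_right _ _
  rw [Finset.sum_range_succ'] at h1
  have h2 := key K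
  have h3 : 0 ≤ s / 2 * (max (1 - K / s) 0) ^ 2 := by positivity
  simp at h1 h2 h3 ⊢
  linarith

/-- Up to `K` uniform draws are made, stopping at the first collision, and `K` more if there is
none: the expected number of draws. The parameter `s = 4 R / 5` of the proof nearly minimizes the
bound that the identity `∑ t * P t = N * (1 - P K)` yields. -/
lemma sum_noCollision_add_le (N : ℕ) {R : ℝ} (hR : 1 ≤ R) (hRN : R ^ 2 = N) (K : ℕ) :
    ∑ t ∈ Finset.range K, noCollision N t + K * noCollision N K ≤ 33 / 20 * R + 2 := by
  have hN : 0 < N := by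
    have : (0 : ℝ) < N := by rw [← hRN]; positivity
    exact_mod_cast this
  set P := noCollision N K with hP
  set s : ℝ := 4 / 5 * R with hs
  have hs0 : 0 < s := by positivity
  have h1 := sum_mul_noCollision N hN K
  rw [← hP] at h1
  have hP0 : 0 ≤ P := noCollision_nonneg N K
  have hP1 : P ≤ 1 := noCollision_le_one N K
  -- `∑ t * noCollision N t` is known exactly, so `∑ noCollision N t` is compared with it; where
  -- `1 - t / s` is positive, `noCollision N t` is bounded by `1`.
  have h2 : ∑ t ∈ Finset.range K, (1 - t / s) * (noCollision N t - P) ≤ (s / 2 + 1) * (1 - P) := by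
    calc _ ≤ ∑ t ∈ Finset.range K, max (1 - t / s) 0 * (1 - P) := by
          refine Finset.sum_le_sum fun t ht => ?_
          have h3 : P ≤ noCollision N t := noCollision_antitone N (Finset.mem_range.1 ht).le
          have h4 := noCollision_le_one N t
          exact mul_le_mul (le_max_left _ _) (by linarith) (by linarith) (le_max_right _ _)
      _ ≤ _ := by
          rw [← Finset.sum_mul]
          exact mul_le_mul_of_nonneg_right (sum_max_le hs0 K) (by linarith)
  have hsumt : ∑ t ∈ Finset.range K, (t : ℝ) = K * (K - 1) / 2 := by
    have := Finset.sum_range_id_mul_two K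
    rcases K with _ | K
    · simp
    · have h : ((∑ i ∈ Finset.range (K + 1), i : ℕ) : ℝ) * 2 = (K + 1 : ℕ) * (K : ℕ) := by
        exact_mod_cast this
      push_cast at h ⊢
      linarith
  have h3 : ∑ t ∈ Finset.range K, (1 - t / s) * (noCollision N t - P) =
      ∑ t ∈ Finset.range K, noCollision N t - N * (1 - P) / s - P * (K - K * (K - 1) / 2 / s) := by
    have : ∀ t ∈ Finset.range K, (1 - t / s) * (noCollision N t - P) =
        noCollision N t - t * noCollision N t / s - P * (1 - t / s) := fun t _ => by ring
    rw [Finset.sum_congr rfl this, Finset.sum_sub_distrib, Finset.sum_sub_distrib,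
      ← Finset.sum_div, h1, ← Finset.mul_sum, Finset.sum_sub_distrib, ← Finset.sum_div, hsumt]
    simp
  have h4 : (N : ℝ) / s = 5 / 4 * R := by
    rw [hs, ← hRN]; field_simp
  -- The left side is quadratic in `K`, with its maximum near `K = 2 * s`.
  have h5 : 2 * (K : ℝ) - K * (K - 1) / 2 / s ≤ 33 / 20 * R + 2 := by
    have h6 : 2 * (K : ℝ) - K * (K - 1) / 2 / s =
        2 * s + 1 + 1 / (8 * s) - (K - (2 * s + 1 / 2)) ^ 2 / (2 * s) := by
      field_simp; ring
    have h7 : 0 ≤ (K - (2 * s + 1 / 2)) ^ 2 / (2 * s) := by positivity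
    have h8 : 1 / (8 * s) ≤ 1 := by
      rw [div_le_one (by positivity)]; rw [hs]; linarith
    rw [h6]
    have : 2 * s = 8 / 5 * R := by rw [hs]; ring
    linarith
  have h6 : N * (1 - P) / s = (1 - P) * (5 / 4 * R) := by rw [← h4]; ring
  have h7 : ∑ t ∈ Finset.range K, noCollision N t + K * P ≤
      (1 - P) * (33 / 20 * R + 1) + P * (2 * (K : ℝ) - K * (K - 1) / 2 / s) := by
    have : s / 2 + 1 = 2 / 5 * R + 1 := by rw [hs]; ring
    rw [this, h3, h6] at h2
    nlinarith
  have h8 := mul_le_mul_of_nonneg_left h5 hP0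
  have h9 : 0 ≤ 1 - P := by linarith
  linarith

lemma sum_noCollision_le (N : ℕ) {R : ℝ} (hR : 1 ≤ R) (hRN : R ^ 2 = N) (K : ℕ) :
    ∑ t ∈ Finset.range K, noCollision N t ≤ 33 / 20 * R + 2 := by
  have h1 := sum_noCollision_add_le N hR hRN K
  have h2 : 0 ≤ K * noCollision N K := mul_nonneg (by positivity) (noCollision_nonneg N K)
  linarith

/-- The same when `e` of the draws need not be random and may be wasted. -/
lemma sum_noCollision_min_sub_le (N : ℕ) {R : ℝ} (hR : 1 ≤ R) (hRN : R ^ 2 = N) (K e : ℕ) :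
    ∑ t ∈ Finset.range (K + K), noCollision N (min t K - e) ≤ 33 / 20 * R + 2 + 2 * e := by
  rw [Finset.sum_range_add]
  -- The second half of the draws is made only if the first half has led to no collision.
  have h1 : ∑ t ∈ Finset.range K, noCollision N (min (K + t) K - e) =
      K * noCollision N (K - e) := by
    rw [Finset.sum_congr rfl fun t _ => by rw [min_eq_right (Nat.le_add_right K t)]]
    simp
  have h2 : ∑ t ∈ Finset.range K, noCollision N (min t K - e) =
      ∑ t ∈ Finset.range K, noCollision N (t - e) :=
    Finset.sum_congr rfl fun t ht => by rw [min_eq_left (Finset.mem_range.1 ht).le]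
  rw [h1, h2]
  rcases le_total K e with h | h
  · have h3 : ∑ t ∈ Finset.range K, noCollision N (t - e) ≤ ∑ t ∈ Finset.range K, (1 : ℝ) :=
      Finset.sum_le_sum fun t _ => noCollision_le_one _ _
    have h4 : K * noCollision N (K - e) ≤ K :=
      mul_le_of_le_one_right (by positivity) (noCollision_le_one _ _)
    have h5 : (K : ℝ) ≤ e := by exact_mod_cast h
    simp at h3
    linarith
  · obtain ⟨k, rfl⟩ := Nat.exists_eq_add_of_le h
    rw [Finset.sum_range_add]
    have h3 : ∑ t ∈ Finset.range e, noCollision N (t - e) ≤ ∑ t ∈ Finset.range e, (1 : ℝ) :=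
      Finset.sum_le_sum fun t _ => noCollision_le_one _ _
    have h4 := sum_noCollision_add_le N hR hRN k
    have h5 := mul_le_of_le_one_right (show (0 : ℝ) ≤ e by positivity) (noCollision_le_one N k)
    simp only [Nat.add_sub_cancel_left] at *
    simp at h3
    push_cast
    linarith

/-! ### Attacks with partial knowledge of the compression function -/

open Classical in
/-- The compression functions that agree with `f₀` at the points of `Q`. -/
noncomputable def agreeing {n m : ℕ} (Q : Finset (HashValue n × Block m)) (f₀ : Compression n m) :
    Finset (Compression n m) :=
  Finset.univ.filter fun f => ∀ p ∈ Q, f p.1 p.2 = f₀ p.1 p.2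

/-- Given that the compression function agrees with `f₀` on `Q`, some attack outputs sets with the
property `P`, and its expected number of queries is at most that of `Φ`. -/
def Solvable {n m : ℕ} (P : Compression n m → Finset (Message m) → Prop)
    (Q : Finset (HashValue n × Block m)) (f₀ : Compression n m) (Φ : Compression n m → ℝ) : Prop :=
  ∃ attack : Attack n m, (∀ f ∈ agreeing Q f₀, P f (attack.result f)) ∧
    ∑ f ∈ agreeing Q f₀, (attack.queries f : ℝ) ≤ ∑ f ∈ agreeing Q f₀, Φ f

/-- The number of points of `Q` with message block `b`. -/
def blockCount {n m : ℕ} (Q : Finset (HashValue n × Block m)) (b : Block m) : ℕ :=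
  (Q.filter fun p => p.2 = b).card

/-- The hash value at the end of a chain: it starts at `p.1` and reads the blocks `p.2`. -/
def chainEnd {n m : ℕ} (f : Compression n m) (p : HashValue n × List (Block m)) : HashValue n :=
  p.2.foldl f p.1

section Solvable

variable {n m : ℕ} {P : Compression n m → Finset (Message m) → Prop}
  {Q : Finset (HashValue n × Block m)} {f₀ : Compression n m} {Φ Φ' : Compression n m → ℝ}

lemma mem_agreeing {f : Compression n m} :
    f ∈ agreeing Q f₀ ↔ ∀ p ∈ Q, f p.1 p.2 = f₀ p.1 p.2 := by simp [agreeing]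

lemma self_mem_agreeing : f₀ ∈ agreeing Q f₀ := mem_agreeing.2 fun _ _ => rfl

lemma agreeing_trans {Q' : Finset (HashValue n × Block m)} {f f₁ : Compression n m}
    (hQ : Q ⊆ Q') (h₁ : f₁ ∈ agreeing Q f₀) (hf : f ∈ agreeing Q' f₁) : f ∈ agreeing Q f₀ :=
  mem_agreeing.2 fun p hp => (mem_agreeing.1 hf p (hQ hp)).trans (mem_agreeing.1 h₁ p hp)

lemma Solvable.mono (h : Solvable P Q f₀ Φ)
    (hΦ : ∑ f ∈ agreeing Q f₀, Φ f ≤ ∑ f ∈ agreeing Q f₀, Φ' f) : Solvable P Q f₀ Φ' := by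
  obtain ⟨attack, h1, h2⟩ := h
  exact ⟨attack, h1, h2.trans hΦ⟩

lemma Solvable.mono_const {C C' : ℝ} (h : Solvable P Q f₀ fun _ => C) (hC : C ≤ C') :
    Solvable P Q f₀ fun _ => C' :=
  h.mono (Finset.sum_le_sum fun _ _ => hC)

lemma solvable_output {C : Finset (Message m)} (h : ∀ f ∈ agreeing Q f₀, P f C) :
    Solvable P Q f₀ fun _ => 0 :=
  ⟨.output C, h, by simp [Attack.queries]⟩

lemma solvable_query (x : HashValue n) (b : Block m)
    (h : ∀ f₁ ∈ agreeing Q f₀, Solvable P (insert (x, b) Q) f₁ Φ) :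
    Solvable P Q f₀ fun f => Φ f + 1 := by
  classical
  have hfib : ∀ f₁ ∈ agreeing Q f₀, agreeing (insert (x, b) Q) f₁ =
      (agreeing Q f₀).filter fun f => f x b = f₁ x b := by
    intro f₁ h₁
    ext f
    rw [Finset.mem_filter, mem_agreeing, mem_agreeing, Finset.forall_mem_insert]
    constructor
    · rintro ⟨h2, h3⟩
      exact ⟨fun p hp => (h3 p hp).trans (mem_agreeing.1 h₁ p hp), h2⟩
    · rintro ⟨h2, h3⟩
      exact ⟨h3, fun p hp => (h2 p hp).trans (mem_agreeing.1 h₁ p hp).symm⟩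
  have hex : ∀ v : HashValue n, ∃ attack : Attack n m,
      (∀ f ∈ (agreeing Q f₀).filter fun f => f x b = v, P f (attack.result f)) ∧
      ∑ f ∈ (agreeing Q f₀).filter fun f => f x b = v, (attack.queries f : ℝ) ≤
        ∑ f ∈ (agreeing Q f₀).filter fun f => f x b = v, Φ f := by
    intro v
    by_cases hv : ∃ f₁ ∈ agreeing Q f₀, f₁ x b = v
    · obtain ⟨f₁, h₁, rfl⟩ := hv
      have := h f₁ h₁
      rwa [Solvable, hfib f₁ h₁] at this
    · have : (agreeing Q f₀).filter (fun f => f x b = v) = ∅ :=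
        Finset.filter_eq_empty_iff.2 fun f hf hfv => hv ⟨f, hf, hfv⟩
      exact ⟨.output ∅, by simp [this], by simp [this]⟩
  choose next hn1 hn2 using hex
  refine ⟨.query x b next, fun f hf => ?_, ?_⟩
  · exact hn1 (f x b) f (Finset.mem_filter.2 ⟨hf, rfl⟩)
  · simp only [Attack.queries, Nat.cast_add, Nat.cast_one, Finset.sum_add_distrib]
    refine add_le_add ?_ le_rfl
    rw [← Finset.sum_fiberwise (agreeing Q f₀) (fun f => f x b) fun f => Φ f,
      ← Finset.sum_fiberwise (agreeing Q f₀) (fun f => f x b)]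
    refine Finset.sum_le_sum fun v _ => le_trans (le_of_eq ?_) (hn2 v)
    refine Finset.sum_congr rfl fun f hf => ?_
    rw [(Finset.mem_filter.1 hf).2]

lemma blockCount_insert_le (x : HashValue n) (b b' : Block m) :
    blockCount (insert (x, b) Q) b' ≤ blockCount Q b' + if b = b' then 1 else 0 := by
  unfold blockCount
  rw [Finset.filter_insert]
  split_ifs with h
  · exact Finset.card_insert_le _ _
  · exact le_rfl

lemma solvable_chain (bs : List (Block m)) : ∀ {Q : Finset (HashValue n × Block m)}
    {f₀ : Compression n m} (x : HashValue n),
    (∀ Q' f₁, f₁ ∈ agreeing Q f₀ → Q ⊆ Q' →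
      (∀ b, blockCount Q' b ≤ blockCount Q b + bs.count b) →
      (∀ f ∈ agreeing Q' f₁, chainEnd f (x, bs) = chainEnd f₁ (x, bs)) → Solvable P Q' f₁ Φ) →
    Solvable P Q f₀ fun f => Φ f + bs.length := by
  induction bs with
  | nil =>
    intro Q f₀ x h
    have := h Q f₀ self_mem_agreeing subset_rfl (by simp) (by simp [chainEnd])
    simpa using this
  | cons b bs ih =>
    intro Q f₀ x h
    have : Solvable P Q f₀ fun f => (Φ f + bs.length) + 1 := by
      refine solvable_query x b fun f₁ h₁ => ih (f₁ x b) fun Q' f₂ h₂ hQ hcol hval => ?_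
      refine h Q' f₂ (agreeing_trans (Finset.subset_insert _ _) h₁ h₂)
        ((Finset.subset_insert _ _).trans hQ) (fun b' => ?_) (fun f hf => ?_)
      · have h3 := blockCount_insert_le (Q := Q) x b b'
        have h4 := hcol b'
        rw [List.count_cons]
        simp only [beq_iff_eq]
        omega
      · have h3 : f x b = f₁ x b :=
          mem_agreeing.1 (agreeing_trans hQ h₂ hf) (x, b) (Finset.mem_insert_self _ _)
        have h4 : f₂ x b = f₁ x b := mem_agreeing.1 h₂ (x, b) (Finset.mem_insert_self _ _)
        have := hval f hf
        simp only [chainEnd, List.foldl_cons] at this ⊢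
        rw [h3, h4, this]
    convert this using 2
    push_cast [List.length_cons]
    ring

open Classical in
/-- Evaluate the chains `todo` one after the other, until the end of one coincides with the end of
an earlier one. -/
lemma solvable_search_aux (ℓ : ℕ) : ∀ (todo done : List (HashValue n × List (Block m)))
    {Q : Finset (HashValue n × Block m)} {f₀ : Compression n m},
    (∀ p ∈ todo, p.2.length = ℓ) →
    (∀ f ∈ agreeing Q f₀, done.map (chainEnd f) = done.map (chainEnd f₀)) →
    (done.map (chainEnd f₀)).Nodup →
    (∀ Q' f₁, f₁ ∈ agreeing Q f₀ → Q ⊆ Q' →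
      (∀ b, blockCount Q' b ≤ blockCount Q b + (todo.map fun p => p.2.count b).sum) →
      ∀ p p', [p, p'].Sublist (done ++ todo) →
      (∀ f ∈ agreeing Q' f₁, chainEnd f p = chainEnd f₁ p ∧ chainEnd f p' = chainEnd f₁ p) →
      Solvable P Q' f₁ Φ) →
    (∀ Q' f₁, f₁ ∈ agreeing Q f₀ → Q ⊆ Q' →
      (∀ b, blockCount Q' b ≤ blockCount Q b + (todo.map fun p => p.2.count b).sum) →
      (∀ f ∈ agreeing Q' f₁, (done ++ todo).map (chainEnd f) = (done ++ todo).map (chainEnd f₁)) →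
      ((done ++ todo).map (chainEnd f₁)).Nodup → Solvable P Q' f₁ Φ) →
    Solvable P Q f₀ fun f => Φ f + ℓ * ∑ t ∈ Finset.range todo.length,
      if ((done ++ todo.take t).map (chainEnd f)).Nodup then 1 else 0 := by
  intro todo
  induction todo with
  | nil =>
    intro done Q f₀ _ hdone hnd _ hno
    have := hno Q f₀ self_mem_agreeing subset_rfl (by simp) (by simpa using hdone) (by simpa using hnd)
    simpa using this
  | cons p todo ih =>
    intro done Q f₀ hlen hdone hnd hcoll hno
    have hp := hlen p (by simp)
    have hmain : Solvable P Q f₀ fun f => (Φ f + ℓ * ∑ t ∈ Finset.range todo.length,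
        if ((done ++ [p] ++ todo.take t).map (chainEnd f)).Nodup then 1 else 0) + p.2.length := by
      refine solvable_chain p.2 p.1 fun Q' f₁ h₁ hQ hcol hval => ?_
      have hdone₁ : done.map (chainEnd f₁) = done.map (chainEnd f₀) := hdone f₁ h₁
      have hdone' : ∀ f ∈ agreeing Q' f₁, done.map (chainEnd f) = done.map (chainEnd f₁) :=
        fun f hf => (hdone f (agreeing_trans hQ h₁ hf)).trans hdone₁.symm
      have hcol' : ∀ b, blockCount Q' b ≤ blockCount Q b +
          ((p :: todo).map fun p => p.2.count b).sum := fun b => by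
        have := hcol b
        simp only [List.map_cons, List.sum_cons]
        omega
      by_cases hmem : chainEnd f₁ p ∈ done.map (chainEnd f₁)
      · obtain ⟨p', hp', hpp⟩ := List.mem_map.1 hmem
        refine (hcoll Q' f₁ h₁ hQ hcol' p' p ?_ fun f hf => ?_).mono
          (Finset.sum_le_sum fun f _ => ?_)
        · exact (List.singleton_sublist.2 hp').append (List.singleton_sublist.2 (by simp))
        · have h2 : chainEnd f p' = chainEnd f₁ p' := List.map_inj_left.1 (hdone' f hf) p' hp'
          exact ⟨h2, (hval f hf).trans hpp.symm⟩
        · have : (0 : ℝ) ≤ ∑ t ∈ Finset.range todo.length,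
              if ((done ++ [p] ++ todo.take t).map (chainEnd f)).Nodup then (1 : ℝ) else 0 :=
            Finset.sum_nonneg fun t _ => by split_ifs <;> norm_num
          have h3 : (0 : ℝ) ≤ ℓ := by positivity
          nlinarith
      · refine ih (done ++ [p]) (fun p hp => hlen p (by simp [hp])) ?_ ?_ ?_ ?_
        · intro f hf
          rw [List.map_append, List.map_append, hdone' f hf]
          have := hval f hf
          simp only [List.map_cons, List.map_nil]
          rw [this]
        · rw [List.map_append, List.nodup_append]
          refine ⟨by rw [hdone₁]; exact hnd, by simp, ?_⟩
          intro a ha b hb hab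
          simp only [List.map_cons, List.map_nil, List.mem_singleton] at hb
          subst hab hb
          exact hmem ha
        · intro Q'' f₂ h₂ hQ' hcol2 q q' hqq hval2
          refine hcoll Q'' f₂ (agreeing_trans hQ h₁ h₂) (hQ.trans hQ') (fun b => ?_) q q'
            (by simpa using hqq) hval2
          have h3 := hcol b
          have h4 := hcol2 b
          simp only [List.map_cons, List.sum_cons]
          omega
        · intro Q'' f₂ h₂ hQ' hcol2 hval2 hnd2
          refine hno Q'' f₂ (agreeing_trans hQ h₁ h₂) (hQ.trans hQ') (fun b => ?_)
            (by simpa using hval2) (by simpa using hnd2)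
          have h3 := hcol b
          have h4 := hcol2 b
          simp only [List.map_cons, List.sum_cons]
          omega
    refine hmain.mono (Finset.sum_le_sum fun f hf => ?_)
    rw [List.length_cons, Finset.sum_range_succ', hp]
    have h2 : ((done ++ (p :: todo).take 0).map (chainEnd f)).Nodup := by
      simpa [hdone f hf] using hnd
    rw [if_pos h2]
    have h3 : ∀ t, done ++ [p] ++ todo.take t = done ++ (p :: todo).take (t + 1) := fun t => by simp
    simp only [h3]
    linarith

open Classical in
/-- The search for two chains with the same end, in terms of bounds `pr t` for the probability that
the first `t` chains have distinct ends. The cost of what remains to be done is `C₁` after a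
successful search and `C₂` after an unsuccessful one. -/
lemma solvable_search (cs : List (HashValue n × List (Block m))) {ℓ : ℕ}
    (hlen : ∀ p ∈ cs, p.2.length = ℓ) {C₁ C₂ : ℝ} (hC : C₁ ≤ C₂) (pr : ℕ → ℝ)
    (hpr : ∀ t ≤ cs.length, ∑ f ∈ agreeing Q f₀,
      (if ((cs.take t).map (chainEnd f)).Nodup then (1 : ℝ) else 0) ≤
        pr t * (agreeing Q f₀).card)
    (hcoll : ∀ Q' f₁, f₁ ∈ agreeing Q f₀ → Q ⊆ Q' →
      (∀ b, blockCount Q' b ≤ blockCount Q b + (cs.map fun p => p.2.count b).sum) →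
      ∀ p p', [p, p'].Sublist cs →
      (∀ f ∈ agreeing Q' f₁, chainEnd f p = chainEnd f₁ p ∧ chainEnd f p' = chainEnd f₁ p) →
      Solvable P Q' f₁ fun _ => C₁)
    (hno : ∀ Q' f₁, f₁ ∈ agreeing Q f₀ → Q ⊆ Q' →
      (∀ b, blockCount Q' b ≤ blockCount Q b + (cs.map fun p => p.2.count b).sum) →
      (∀ f ∈ agreeing Q' f₁, cs.map (chainEnd f) = cs.map (chainEnd f₁)) →
      (cs.map (chainEnd f₁)).Nodup → Solvable P Q' f₁ fun _ => C₂) :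
    Solvable P Q f₀ fun _ => C₁ + (C₂ - C₁) * pr cs.length +
      ℓ * ∑ t ∈ Finset.range cs.length, pr t := by
  set Φ : Compression n m → ℝ := fun f =>
    C₁ + (C₂ - C₁) * if (cs.map (chainEnd f)).Nodup then 1 else 0 with hΦ
  have h := solvable_search_aux (P := P) (Φ := Φ) ℓ cs [] (Q := Q) (f₀ := f₀) hlen
    (by simp) (by simp) ?_ ?_
  · refine h.mono ?_
    simp only [List.nil_append, hΦ]
    rw [Finset.sum_add_distrib, Finset.sum_add_distrib, ← Finset.mul_sum, ← Finset.mul_sum,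
      Finset.sum_comm]
    have h1 := hpr cs.length le_rfl
    rw [List.take_length] at h1
    have h2 : ∑ t ∈ Finset.range cs.length, ∑ f ∈ agreeing Q f₀,
        (if ((cs.take t).map (chainEnd f)).Nodup then (1 : ℝ) else 0) ≤
        ∑ t ∈ Finset.range cs.length, pr t * (agreeing Q f₀).card :=
      Finset.sum_le_sum fun t ht => hpr t (Finset.mem_range.1 ht).le
    rw [← Finset.sum_mul] at h2
    simp only [Finset.sum_const, nsmul_eq_mul]
    have h3 := mul_le_mul_of_nonneg_left h1 (sub_nonneg.2 hC)
    have h4 := mul_le_mul_of_nonneg_left h2 (show (0 : ℝ) ≤ ℓ by positivity)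
    linarith
  · intro Q' f₁ h₁ hQ hcol p p' hpp hval
    refine (hcoll Q' f₁ h₁ hQ hcol p p' (by simpa using hpp) hval).mono
      (Finset.sum_le_sum fun f _ => ?_)
    simp only [hΦ]
    have : 0 ≤ (C₂ - C₁) * if (cs.map (chainEnd f)).Nodup then (1 : ℝ) else 0 :=
      mul_nonneg (sub_nonneg.2 hC) (by split_ifs <;> norm_num)
    linarith
  · intro Q' f₁ h₁ hQ hcol hval hnd
    simp only [List.nil_append] at hval hnd
    refine (hno Q' f₁ h₁ hQ hcol hval hnd).mono (Finset.sum_le_sum fun f hf => ?_)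
    simp only [hΦ]
    rw [hval f hf, if_pos hnd]
    linarith

end Solvable

/-! ### Resampling unknown values -/

section resample

open Classical

variable {n m : ℕ} {Q : Finset (HashValue n × Block m)} {f₀ : Compression n m}

/-- The compression function `ψ` on `D`, and `f` elsewhere. -/
noncomputable def override (D : Set (HashValue n × Block m)) (f ψ : Compression n m) :
    Compression n m :=
  fun x b => if (x, b) ∈ D then ψ x b else f x b

/-- Values at points outside `Q` may be replaced by fresh independent ones: `(f, ψ)` and
`(f with ψ on D, ψ with f on D)` have the same distribution. -/
lemma sum_agreeing_override (D : Set (HashValue n × Block m)) (hD : ∀ p ∈ D, p ∉ Q)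
    (F : Compression n m → ℝ) :
    (∑ f ∈ agreeing Q f₀, F f) * Fintype.card (Compression n m) =
      ∑ f ∈ agreeing Q f₀, ∑ ψ : Compression n m, F (override D f ψ) := by
  have h1 : ∑ f ∈ agreeing Q f₀, ∑ ψ : Compression n m, F (override D f ψ) =
      ∑ x ∈ agreeing Q f₀ ×ˢ (Finset.univ : Finset (Compression n m)),
        F (override D x.1 x.2) := by
    rw [Finset.sum_product]
  have h2 : (∑ f ∈ agreeing Q f₀, F f) * Fintype.card (Compression n m) =
      ∑ x ∈ agreeing Q f₀ ×ˢ (Finset.univ : Finset (Compression n m)), F x.1 := by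
    rw [Finset.sum_product, Finset.sum_mul]
    refine Finset.sum_congr rfl fun f _ => ?_
    simp only
    rw [Finset.sum_const, Finset.card_univ, nsmul_eq_mul, mul_comm]
  rw [h1, h2]
  clear h1 h2
  have hmem : ∀ x ∈ agreeing Q f₀ ×ˢ (Finset.univ : Finset (Compression n m)),
      (override D x.1 x.2, override D x.2 x.1) ∈
        agreeing Q f₀ ×ˢ (Finset.univ : Finset (Compression n m)) := by
    rintro ⟨f, ψ⟩ h
    rw [Finset.mem_product] at h ⊢
    refine ⟨mem_agreeing.2 fun p hp => ?_, Finset.mem_univ _⟩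
    have hpD : (p.1, p.2) ∉ D := fun h => hD p h hp
    simp only [override, if_neg hpD]
    exact mem_agreeing.1 h.1 p hp
  have hinv : ∀ x : Compression n m × Compression n m,
      (override D (override D x.1 x.2) (override D x.2 x.1),
        override D (override D x.2 x.1) (override D x.1 x.2)) = x := by
    rintro ⟨f, ψ⟩
    refine Prod.ext ?_ ?_ <;>
    · funext y b
      simp only [override]
      split_ifs <;> rfl
  exact Finset.sum_nbij' (fun x => (override D x.1 x.2, override D x.2 x.1))
    (fun x => (override D x.1 x.2, override D x.2 x.1)) hmem hmem (fun x _ => hinv x)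
    (fun x _ => hinv x) (fun x _ => (congrArg (fun y => F y.1) (hinv x)).symm)

lemma sum_agreeing_le_of_override (D : Set (HashValue n × Block m)) (hD : ∀ p ∈ D, p ∉ Q)
    (E : Compression n m → Prop) [DecidablePred E] {c : ℝ}
    (h : ∀ f ∈ agreeing Q f₀, ((Finset.univ.filter fun ψ => E (override D f ψ)).card : ℝ) ≤
      c * Fintype.card (Compression n m)) :
    ∑ f ∈ agreeing Q f₀, (if E f then (1 : ℝ) else 0) ≤ c * (agreeing Q f₀).card := by
  have hpos : (0 : ℝ) < Fintype.card (Compression n m) := by exact_mod_cast Fintype.card_pos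
  rw [← mul_le_mul_iff_left₀ hpos, sum_agreeing_override D hD]
  calc _ ≤ ∑ f ∈ agreeing Q f₀, c * Fintype.card (Compression n m) := by
        refine Finset.sum_le_sum fun f hf => ?_
        rw [← Finset.sum_filter, Finset.sum_const, nsmul_eq_mul, mul_one]
        exact h f hf
    _ = _ := by rw [Finset.sum_const, nsmul_eq_mul]; ring

lemma foldl_override_of_notMem {D : Set (HashValue n × Block m)} (f ψ : Compression n m)
    (bs : List (Block m)) (h : ∀ b ∈ bs, ∀ x, (x, b) ∉ D) : ∀ x : HashValue n,
    bs.foldl (override D f ψ) x = bs.foldl f x := by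
  induction bs with
  | nil => intro x; rfl
  | cons b bs ih =>
    intro x
    have hb : override D f ψ x b = f x b := if_neg (h b (by simp) x)
    rw [List.foldl_cons, List.foldl_cons, hb, ih fun b' hb' => h b' (by simp [hb'])]

/-- Chains that read the same blocks, among them a block `b` that has been queried at few points:
the points at which they first read `b` are distinct unless two chains have merged, so up to `e`
exceptions the values there are independent. -/
lemma sum_nodup_same_blocks_le (xs : List (HashValue n)) (bs₁ bs₂ : List (Block m)) (b : Block m)
    (hb : b ∉ bs₁) {e : ℕ} (he : blockCount Q b ≤ e) :
    ∑ f ∈ agreeing Q f₀,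
      (if (xs.map fun x => (bs₁ ++ b :: bs₂).foldl f x).Nodup then (1 : ℝ) else 0) ≤
      noCollision (2 ^ n : ℕ) (xs.length - e) * (agreeing Q f₀).card := by
  set D : Set (HashValue n × Block m) := {p | p.2 = b ∧ p ∉ Q} with hDdef
  refine sum_agreeing_le_of_override D (fun p hp => hp.2)
    (fun f => (xs.map fun x => (bs₁ ++ b :: bs₂).foldl f x).Nodup) fun f _ => ?_
  set zs : List (HashValue n) := xs.map fun x => bs₁.foldl f x with hzs
  have hval : ∀ ψ, (xs.map fun x => (bs₁ ++ b :: bs₂).foldl (override D f ψ) x) =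
      (zs.map fun z => override D f ψ z b).map fun y => bs₂.foldl (override D f ψ) y := by
    intro ψ
    rw [hzs, List.map_map, List.map_map]
    refine List.map_congr_left fun x _ => ?_
    rw [List.foldl_append, List.foldl_cons]
    simp only [Function.comp]
    have hD1 : ∀ b' ∈ bs₁, ∀ y, (y, b') ∉ D := by
      rintro b' hb' y ⟨rfl, -⟩
      exact hb hb'
    rw [foldl_override_of_notMem f ψ bs₁ hD1]
  set s : Finset (HashValue n) := zs.toFinset.filter fun z => (z, b) ∉ Q with hs
  -- Distinct ends need distinct points `zs` before `b` is read, and distinct values there.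
  have hsub : (Finset.univ.filter fun ψ =>
        (xs.map fun x => (bs₁ ++ b :: bs₂).foldl (override D f ψ) x).Nodup) ⊆
      Finset.univ.filter fun ψ : Compression n m =>
        zs.Nodup ∧ Set.InjOn (fun z => (fun y : Block m → HashValue n => y b) (ψ z)) s := by
    intro ψ hψ
    rw [Finset.mem_filter, hval] at hψ
    have h1 := hψ.2.of_map
    refine Finset.mem_filter.2 ⟨Finset.mem_univ _, h1.of_map, fun z hz z' hz' hzz => ?_⟩
    rw [Finset.mem_coe, hs, Finset.mem_filter, List.mem_toFinset] at hz hz'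
    refine List.inj_on_of_nodup_map h1 hz.1 hz'.1 ?_
    have hz2 : (z, b) ∈ D := ⟨rfl, hz.2⟩
    have hz2' : (z', b) ∈ D := ⟨rfl, hz'.2⟩
    simpa only [override, if_pos hz2, if_pos hz2'] using hzz
  have hcard := card_injOn_le (I := HashValue n) (fun y : Block m → HashValue n => y b) s
  by_cases hnd : zs.Nodup
  · have hsc : xs.length - e ≤ s.card := by
      have h1 : zs.toFinset.card = xs.length := by
        rw [List.toFinset_card_of_nodup hnd, hzs, List.length_map]
      have h2 := Finset.card_filter_add_card_filter_not (s := zs.toFinset) fun z => (z, b) ∉ Q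
      have h3 : (zs.toFinset.filter fun z => ¬ (z, b) ∉ Q).card ≤ blockCount Q b := by
        refine Finset.card_le_card_of_injOn (fun z => (z, b)) (fun z hz => ?_) (fun z _ z' _ h => ?_)
        · rw [Finset.mem_coe, Finset.mem_filter, not_not] at hz
          rw [Finset.mem_coe, Finset.mem_filter]
          exact ⟨hz.2, rfl⟩
        · exact (Prod.mk.inj h).1
      rw [← hs] at h2
      omega
    have hV : Fintype.card (HashValue n) = 2 ^ n := by simp [HashValue]
    rw [hV] at hcard
    calc _ ≤ ((Finset.univ.filter fun ψ : Compression n m =>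
          Set.InjOn (fun z => (fun y : Block m → HashValue n => y b) (ψ z)) s).card : ℝ) := by
            refine Nat.cast_le.2 (Finset.card_le_card (hsub.trans fun ψ h => ?_))
            rw [Finset.mem_filter] at h ⊢
            exact ⟨h.1, h.2.2⟩
      _ ≤ _ := hcard
      _ ≤ _ := mul_le_mul_of_nonneg_right (noCollision_antitone _ hsc) (by positivity)
  · have : (Finset.univ.filter fun ψ =>
        (xs.map fun x => (bs₁ ++ b :: bs₂).foldl (override D f ψ) x).Nodup) = ∅ := by
      refine Finset.subset_empty.1 (hsub.trans fun ψ h => ?_)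
      exact absurd (Finset.mem_filter.1 h).2.1 hnd
    rw [this]
    simp only [Finset.card_empty, Nat.cast_zero]
    exact mul_nonneg (noCollision_nonneg _ _) (by positivity)

/-- Chains that start at the same value and differ in the block `b` that they read in place of the
letter `a`, where none of these blocks has been queried: the chain for `b` depends on the function
`x ↦ f x b`, and these functions are independent and identically distributed. -/
lemma sum_nodup_distinct_blocks_le (u : List ℕ) (a : ℕ) (c : Block m) (h : HashValue n)
    (bl : List (Block m)) (hbl : bl.Nodup) (hc : c ∉ bl) (hQ : ∀ b ∈ bl, blockCount Q b = 0) :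
    ∑ f ∈ agreeing Q f₀,
      (if (bl.map fun b => (u.map fun a' => if a' = a then b else c).foldl f h).Nodup
        then (1 : ℝ) else 0) ≤
      noCollision (2 ^ n : ℕ) bl.length * (agreeing Q f₀).card := by
  set D : Set (HashValue n × Block m) := {p | p.2 ∈ bl} with hDdef
  refine sum_agreeing_le_of_override D (fun p hp hpQ => ?_)
    (fun f => (bl.map fun b => (u.map fun a' => if a' = a then b else c).foldl f h).Nodup)
    fun f _ => ?_
  · exact Finset.filter_eq_empty_iff.1 (Finset.card_eq_zero.1 (hQ p.2 hp)) hpQ rfl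
  -- With the values for the other blocks fixed, the end of the chain for `b` is `G (ψ · b)`.
  set G : (HashValue n → HashValue n) → HashValue n := fun φ =>
    u.foldl (fun x a' => if a' = a then φ x else f x c) h with hG
  have hval : ∀ ψ : Compression n m, ∀ b ∈ bl,
      (u.map fun a' => if a' = a then b else c).foldl (override D f ψ) h = G fun x => ψ x b := by
    intro ψ b hb
    rw [hG, List.foldl_map]
    congr 1
    funext x a'
    split_ifs with ha
    · exact if_pos hb
    · exact if_neg hc
  have hV : Fintype.card (HashValue n) = 2 ^ n := by simp [HashValue]
  have hcard := card_injOn_le (I := Block m) G bl.toFinset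
  rw [hV, List.toFinset_card_of_nodup hbl] at hcard
  have hcc : Fintype.card (Compression n m) =
      Fintype.card (Block m → HashValue n → HashValue n) :=
    Fintype.card_congr (Equiv.piComm _)
  rw [hcc]
  refine le_trans ?_ hcard
  refine Nat.cast_le.2 (Finset.card_le_card_of_injOn (fun ψ b x => ψ x b) (fun ψ hψ => ?_)
    fun ψ _ ψ' _ h => ?_)
  · rw [Finset.mem_coe, Finset.mem_filter] at hψ ⊢
    refine ⟨Finset.mem_univ _, fun b hb b' hb' hbb => ?_⟩
    rw [Finset.mem_coe, List.mem_toFinset] at hb hb'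
    refine List.inj_on_of_nodup_map hψ.2 hb hb' ?_
    rw [hval ψ b hb, hval ψ b' hb']
    exact hbb
  · funext x b
    exact congrFun (congrFun h b) x

end resample

/-! ### Boxes: sets of letters with two alternative assignments of blocks -/

/-- A set of letters together with two assignments of blocks to them. -/
structure Box (m : ℕ) where
  /-- The letters whose blocks are assigned. -/
  letters : Finset ℕ
  /-- The two assignments; only the values at `letters` matter. -/
  opt : Bool → ℕ → Block m

/-- The block assignment `g` follows in each box one of its two options, and is constantly `c`
outside the boxes. -/
def Admissible {m : ℕ} (c : Block m) (Bs : List (Box m)) (g : ℕ → Block m) : Prop :=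
  (∀ B ∈ Bs, ∃ s, ∀ a ∈ B.letters, g a = B.opt s a) ∧ ∀ a, (∀ B ∈ Bs, a ∉ B.letters) → g a = c

/-- The hash value after reading the word `w`, with the blocks that `g` assigns to its letters. -/
def run {n m : ℕ} (f : Compression n m) (h : HashValue n) (w : List ℕ) (g : ℕ → Block m) :
    HashValue n :=
  (w.map g).foldl f h

lemma run_append {n m : ℕ} (f : Compression n m) (h : HashValue n) (w w' : List ℕ)
    (g : ℕ → Block m) : run f h (w ++ w') g = run f (run f h w g) w' g := by
  simp [run]

lemma run_congr {n m : ℕ} (f : Compression n m) (h : HashValue n) {w : List ℕ}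
    {g g' : ℕ → Block m} (hg : ∀ a ∈ w, g a = g' a) : run f h w g = run f h w g' := by
  rw [run, run, List.map_congr_left hg]

section merging

variable {n m : ℕ} {c : Block m} {cand : ℕ → Finset (Block m)}

/-- The blocks read in a segment by the option `s` of its box. -/
def blocks (c : Block m) (p : Box m × List ℕ) (s : Bool) : List (Block m) :=
  p.2.map (p.1.letters.piecewise (p.1.opt s) fun _ => c)

lemma mem_blocks {p : Box m × List ℕ} (hopt : ∀ s, ∀ a ∈ p.1.letters, p.1.opt s a ∈ cand a)
    {s : Bool} {b : Block m} (hb : b ∈ blocks c p s) : b = c ∨ ∃ a ∈ p.1.letters, b ∈ cand a := by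
  obtain ⟨a, -, rfl⟩ := List.mem_map.1 hb
  by_cases ha : a ∈ p.1.letters
  · rw [Finset.piecewise_eq_of_mem _ _ _ ha]
    exact Or.inr ⟨a, ha, hopt s a ha⟩
  · rw [Finset.piecewise_eq_of_notMem _ _ _ ha]
    exact Or.inl rfl

/-- The boxes of `rest`, with their segments, can be processed after the word `up`, where the boxes
of `done` have been processed. The options of a letter `a` are taken from the set `cand a` of
candidate blocks. -/
structure Ready (cand : ℕ → Finset (Block m)) (done : List (Box m)) (up : List ℕ)
    (rest : List (Box m × List ℕ)) : Prop where
  pairwise : rest.Pairwise fun p p' => (∀ a ∈ p.2, a ∉ p'.1.letters) ∧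
    (∀ a ∈ p'.2, a ∉ p.1.letters) ∧ Disjoint p.1.letters p'.1.letters
  notMem_up : ∀ p ∈ rest, ∀ a ∈ up, a ∉ p.1.letters
  disjoint : ∀ B ∈ done, ∀ p ∈ rest, Disjoint B.letters p.1.letters ∧ ∀ a ∈ p.2, a ∉ B.letters
  opt_mem : ∀ p ∈ rest, ∀ s, ∀ a ∈ p.1.letters, p.1.opt s a ∈ cand a
  opt_ne : ∀ p ∈ rest, ∃ a ∈ p.1.letters, p.1.opt false a ≠ p.1.opt true a

lemma Ready.step {done : List (Box m)} {up : List ℕ} {p : Box m × List ℕ}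
    {rest : List (Box m × List ℕ)} (h : Ready cand done up (p :: rest)) :
    Ready cand (done ++ [p.1]) (up ++ p.2) rest := by
  have hp := List.pairwise_cons.1 h.pairwise
  refine ⟨hp.2, fun p' hp' a ha => ?_, fun B hB p' hp' => ?_,
    fun p' hp' => h.opt_mem p' (by simp [hp']), fun p' hp' => h.opt_ne p' (by simp [hp'])⟩
  · rcases List.mem_append.1 ha with h' | h'
    · exact h.notMem_up p' (by simp [hp']) a h'
    · exact (hp.1 p' hp').1 a h'
  · rcases List.mem_append.1 hB with h' | h'
    · exact h.disjoint B h' p' (by simp [hp'])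
    · rw [List.mem_singleton] at h'
      subst h'
      exact ⟨(hp.1 p' hp').2.2, (hp.1 p' hp').2.1⟩

section step

variable {done : List (Box m)} {up : List ℕ} {p : Box m × List ℕ} {rest : List (Box m × List ℕ)}
  {γ γ' : ℕ → Block m}

lemma Ready.admissible (h : Ready cand done up (p :: rest)) (hγ : Admissible c done γ) (s : Bool) :
    Admissible c (done ++ [p.1]) (p.1.letters.piecewise (p.1.opt s) γ) := by
  refine ⟨fun B hB => ?_, fun a ha => ?_⟩
  · rcases List.mem_append.1 hB with hB | hB
    · obtain ⟨t, ht⟩ := hγ.1 B hB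
      refine ⟨t, fun a ha => ?_⟩
      have := Finset.disjoint_left.1 (h.disjoint B hB p (by simp)).1 ha
      rw [Finset.piecewise_eq_of_notMem _ _ _ this, ht a ha]
    · rw [List.mem_singleton] at hB
      subst hB
      exact ⟨s, fun a ha => Finset.piecewise_eq_of_mem _ _ _ ha⟩
  · rw [Finset.piecewise_eq_of_notMem _ _ _ (ha p.1 (by simp))]
    exact hγ.2 a fun B hB => ha B (by simp [hB])

lemma Ready.run_eq (h : Ready cand done up (p :: rest)) (hγ : Admissible c done γ) (s : Bool)
    (f : Compression n m) (h₀ : HashValue n) :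
    run f h₀ (up ++ p.2) (p.1.letters.piecewise (p.1.opt s) γ) =
      chainEnd f (run f h₀ up γ, blocks c p s) := by
  rw [run_append]
  have h1 : run f h₀ up (p.1.letters.piecewise (p.1.opt s) γ) = run f h₀ up γ :=
    run_congr f h₀ fun a ha =>
      Finset.piecewise_eq_of_notMem _ _ _ (h.notMem_up p (by simp) a ha)
  rw [h1, run, chainEnd, blocks]
  congr 1
  refine List.map_congr_left fun a ha => ?_
  by_cases hS : a ∈ p.1.letters
  · rw [Finset.piecewise_eq_of_mem _ _ _ hS, Finset.piecewise_eq_of_mem _ _ _ hS]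
  · rw [Finset.piecewise_eq_of_notMem _ _ _ hS, Finset.piecewise_eq_of_notMem _ _ _ hS]
    exact hγ.2 a fun B hB => (h.disjoint B hB p (by simp)).2 a ha

lemma Ready.piecewise_ne (h : Ready cand done up (p :: rest)) (hγ : Admissible c done γ)
    (hγ' : Admissible c done γ') (hne : γ ≠ γ') (s s' : Bool) :
    p.1.letters.piecewise (p.1.opt s) γ ≠ p.1.letters.piecewise (p.1.opt s') γ' := by
  obtain ⟨a, ha⟩ := Function.ne_iff.1 hne
  have haS : a ∉ p.1.letters := by
    intro haS
    have : ∀ B ∈ done, a ∉ B.letters := fun B hB haB =>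
      Finset.disjoint_left.1 (h.disjoint B hB p (by simp)).1 haB haS
    exact ha ((hγ.2 a this).trans (hγ'.2 a this).symm)
  intro heq
  have := congrFun heq a
  rw [Finset.piecewise_eq_of_notMem _ _ _ haS, Finset.piecewise_eq_of_notMem _ _ _ haS] at this
  exact ha this

lemma Ready.piecewise_ne_of_ne (h : Ready cand done up (p :: rest)) {y y' : (ℕ → Block m) × Bool}
    (hy : Admissible c done y.1) (hy' : Admissible c done y'.1) (hne : y ≠ y') :
    p.1.letters.piecewise (p.1.opt y.2) y.1 ≠ p.1.letters.piecewise (p.1.opt y'.2) y'.1 := by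
  by_cases hγ : y.1 = y'.1
  · have hs : y.2 ≠ y'.2 := fun hs => hne (Prod.ext hγ hs)
    obtain ⟨a, ha, hopt⟩ := h.opt_ne p (by simp)
    intro heq
    have h2 := congrFun heq a
    rw [Finset.piecewise_eq_of_mem _ _ _ ha, Finset.piecewise_eq_of_mem _ _ _ ha] at h2
    rcases hs1 : y.2 with _ | _ <;> rcases hs2 : y'.2 with _ | _ <;> rw [hs1, hs2] at h2 hs
    · exact hs rfl
    · exact hopt h2
    · exact hopt h2.symm
    · exact hs rfl
  · exact h.piecewise_ne hy hy' hγ y.2 y'.2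

end step

variable {P : Compression n m → Finset (Message m) → Prop}

/-- Once two assignments collide, the remaining segments of the group are evaluated with the first
option of their boxes. -/
lemma solvable_of_collision {C : ℝ} (h₀ : HashValue n) : ∀ (rest : List (Box m × List ℕ))
    {done : List (Box m)} {up : List ℕ} {γ γ' : ℕ → Block m}
    {Q : Finset (HashValue n × Block m)} {f₀ : Compression n m},
    Ready cand done up rest → Admissible c done γ → Admissible c done γ' → γ ≠ γ' →
    (∀ f ∈ agreeing Q f₀, run f h₀ up γ = run f₀ h₀ up γ ∧ run f h₀ up γ' = run f₀ h₀ up γ) →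
    (∀ Q' f₁, f₁ ∈ agreeing Q f₀ → Q ⊆ Q' →
      (∀ b, b ≠ c → (∀ p ∈ rest, ∀ a ∈ p.1.letters, b ∉ cand a) →
        blockCount Q' b ≤ blockCount Q b) →
      ∀ γ γ', Admissible c (done ++ rest.map Prod.fst) γ →
      Admissible c (done ++ rest.map Prod.fst) γ' → γ ≠ γ' →
      (∀ f ∈ agreeing Q' f₁,
        run f h₀ (up ++ (rest.map Prod.snd).flatten) γ =
          run f₁ h₀ (up ++ (rest.map Prod.snd).flatten) γ ∧
        run f h₀ (up ++ (rest.map Prod.snd).flatten) γ' =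
          run f₁ h₀ (up ++ (rest.map Prod.snd).flatten) γ) →
      Solvable P Q' f₁ fun _ => C) →
    Solvable P Q f₀ fun _ => C + (rest.map Prod.snd).flatten.length := by
  intro rest
  induction rest with
  | nil =>
    intro done up γ γ' Q f₀ _ hγ hγ' hne hval hK
    have := hK Q f₀ self_mem_agreeing subset_rfl (fun _ _ _ => le_rfl) γ γ' (by simpa using hγ)
      (by simpa using hγ') hne (by simpa using hval)
    simpa using this
  | cons p rest ih =>
    intro done up γ γ' Q f₀ hR hγ hγ' hne hval hK
    have hmain : Solvable P Q f₀ fun _ => (C + (rest.map Prod.snd).flatten.length) +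
        (blocks c p false).length := by
      refine solvable_chain (Φ := fun _ => C + (rest.map Prod.snd).flatten.length)
        (blocks c p false) (run f₀ h₀ up γ) fun Q' f₁ h₁ hQ hcol hend => ?_
      have hrun : ∀ f ∈ agreeing Q' f₁,
          run f h₀ (up ++ p.2) (p.1.letters.piecewise (p.1.opt false) γ) =
            chainEnd f₁ (run f₀ h₀ up γ, blocks c p false) ∧
          run f h₀ (up ++ p.2) (p.1.letters.piecewise (p.1.opt false) γ') =
            chainEnd f₁ (run f₀ h₀ up γ, blocks c p false) := by
        intro f hf
        have hv := hval f (agreeing_trans hQ h₁ hf)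
        rw [hR.run_eq hγ, hR.run_eq hγ', hv.1, hv.2, hend f hf]
        exact ⟨rfl, rfl⟩
      have hrun₁ := hrun f₁ self_mem_agreeing
      refine ih hR.step (hR.admissible hγ false) (hR.admissible hγ' false)
        (hR.piecewise_ne hγ hγ' hne false false)
        (fun f hf => by rw [(hrun f hf).1, (hrun f hf).2, hrun₁.1]; exact ⟨rfl, rfl⟩) ?_
      intro Q'' f₂ h₂ hQ' hcol' δ δ' hδ hδ' hne' hval'
      refine hK Q'' f₂ (agreeing_trans hQ h₁ h₂) (hQ.trans hQ') (fun b hbc hb => ?_) δ δ'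
        (by simpa using hδ) (by simpa using hδ') hne' (by simpa using hval')
      have h3 := hcol' b hbc fun p' hp' => hb p' (by simp [hp'])
      have h4 := hcol b
      have h5 : (blocks c p false).count b = 0 := List.count_eq_zero.2 fun hmem => by
        rcases mem_blocks (hR.opt_mem p (by simp)) hmem with h | ⟨a, ha, hab⟩
        · exact hbc h
        · exact hb p (by simp) a ha hab
      omega
    convert hmain using 2
    simp [blocks]
    ring

/-- How often the block `b` is read in the first segment, for the two options together. -/
def headCount (c : Block m) (rest : List (Box m × List ℕ)) (b : Block m) : ℕ :=
  match rest with
  | [] => 0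
  | p :: _ => (blocks c p false).count b + (blocks c p true).count b

lemma headCount_eq_zero {rest : List (Box m × List ℕ)} {b : Block m}
    (hopt : ∀ p ∈ rest, ∀ s, ∀ a ∈ p.1.letters, p.1.opt s a ∈ cand a) (hbc : b ≠ c)
    (hb : ∀ p ∈ rest, ∀ a ∈ p.1.letters, b ∉ cand a) : headCount c rest b = 0 := by
  rcases rest with _ | ⟨p, rest⟩
  · rfl
  · have : ∀ s, (blocks c p s).count b = 0 := fun s => List.count_eq_zero.2 fun hmem => by
      rcases mem_blocks (hopt p (by simp)) hmem with h | ⟨a, ha, hab⟩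
      · exact hbc h
      · exact hb p (by simp) a ha hab
    rw [headCount, this, this]

/-- If the live letter `a` of a box occurs in its segment, and the block that the first option
assigns to it has been queried at most `e` times, then the chains with the first option collide at
least as fast as random draws, up to `e` exceptions. -/
lemma sum_nodup_blocks_le (hcand : ∀ a a', a ≠ a' → Disjoint (cand a) (cand a'))
    (hc : ∀ a, c ∉ cand a) {p : Box m × List ℕ}
    (hopt : ∀ s, ∀ a ∈ p.1.letters, p.1.opt s a ∈ cand a) {a : ℕ} (ha : a ∈ p.1.letters)
    (hap : a ∈ p.2) {Q : Finset (HashValue n × Block m)} {f₀ : Compression n m} {e : ℕ}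
    (he : blockCount Q (p.1.opt false a) ≤ e) (xs : List (HashValue n)) :
    ∑ f ∈ agreeing Q f₀,
      (if (xs.map fun x => (blocks c p false).foldl f x).Nodup then (1 : ℝ) else 0) ≤
      noCollision (2 ^ n : ℕ) (xs.length - e) * (agreeing Q f₀).card := by
  obtain ⟨u₁, u₂, hu, hau⟩ := List.eq_append_cons_of_mem hap
  have hsplit : blocks c p false =
      u₁.map (p.1.letters.piecewise (p.1.opt false) fun _ => c) ++
        p.1.opt false a :: u₂.map (p.1.letters.piecewise (p.1.opt false) fun _ => c) := by
    rw [blocks, hu, List.map_append, List.map_cons, Finset.piecewise_eq_of_mem _ _ _ ha]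
  simp only [hsplit]
  refine sum_nodup_same_blocks_le xs _ _ _ (fun hmem => ?_) he
  obtain ⟨a', ha', heq⟩ := List.mem_map.1 hmem
  by_cases haS : a' ∈ p.1.letters
  · rw [Finset.piecewise_eq_of_mem _ _ _ haS] at heq
    have hne : a' ≠ a := fun h => hau (h ▸ ha')
    refine Finset.disjoint_left.1 (hcand a' a hne) (hopt false a' haS) ?_
    rw [heq]
    exact hopt false a ha
  · rw [Finset.piecewise_eq_of_notMem _ _ _ haS] at heq
    refine hc a ?_
    rw [heq]
    exact hopt false a ha

set_option maxHeartbeats 1000000 in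
/-- The collision search in a group of `n` boxes. After `j` segments there are `2 ^ j` assignments
`X` with distinct values; in the next segment each is continued with the first option of the box,
and then each with the second. -/
lemma solvable_tree (hcand : ∀ a a', a ≠ a' → Disjoint (cand a) (cand a')) (hc : ∀ a, c ∉ cand a)
    {R : ℝ} (hR1 : 1 ≤ R) (hRn : R ^ 2 = (2 ^ n : ℕ)) {e : ℕ} {κ : ℝ}
    (hκ : 33 / 20 * R + 2 + 2 * e ≤ κ) {C F : ℝ} (hF : 0 ≤ F)
    (hfall : ∀ Q f₀, Solvable P Q f₀ fun _ => F) (hC : 0 ≤ C)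
    (h₀ : HashValue n) : ∀ (rest : List (Box m × List ℕ))
    {done : List (Box m)} {up : List ℕ} {X : List (ℕ → Block m)} {j : ℕ}
    {Q : Finset (HashValue n × Block m)} {f₀ : Compression n m},
    rest ≠ [] → j + rest.length = n → X.length = 2 ^ j → Ready cand done up rest →
    (∀ γ ∈ X, Admissible c done γ) →
    (∀ f ∈ agreeing Q f₀, X.map (run f h₀ up) = X.map (run f₀ h₀ up)) →
    (X.map (run f₀ h₀ up)).Nodup →
    (∀ p ∈ rest, ∃ a ∈ p.1.letters, a ∈ p.2 ∧ blockCount Q (p.1.opt false a) ≤ e) →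
    (∀ Q' f₁, f₁ ∈ agreeing Q f₀ → Q ⊆ Q' →
      (∀ b, b ≠ c → (∀ p ∈ rest.tail, ∀ a ∈ p.1.letters, b ∉ cand a) →
        blockCount Q' b ≤ blockCount Q b + X.length * headCount c rest b) →
      ∀ γ γ', Admissible c (done ++ rest.map Prod.fst) γ →
      Admissible c (done ++ rest.map Prod.fst) γ' → γ ≠ γ' →
      (∀ f ∈ agreeing Q' f₁,
        run f h₀ (up ++ (rest.map Prod.snd).flatten) γ =
          run f₁ h₀ (up ++ (rest.map Prod.snd).flatten) γ ∧
        run f h₀ (up ++ (rest.map Prod.snd).flatten) γ' =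
          run f₁ h₀ (up ++ (rest.map Prod.snd).flatten) γ) →
      Solvable P Q' f₁ fun _ => C) →
    Solvable P Q f₀ fun _ => C + κ * (rest.map Prod.snd).flatten.length +
      F * noCollision (2 ^ n : ℕ) (2 ^ (n - 1) - e) := by
  have hκ1 : 1 ≤ κ := by
    have : (0 : ℝ) ≤ e := by positivity
    linarith
  intro rest
  induction rest with
  | nil => intro _ _ _ _ _ _ h; exact absurd rfl h
  | cons p rest ih =>
    intro done up X j Q f₀ _ hj hX hR hadm hval hnd hlive hK
    set K := X.length with hKdef
    set Y : List ((ℕ → Block m) × Bool) := X.map (·, false) ++ X.map (·, true) with hY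
    set ext : (ℕ → Block m) × Bool → ℕ → Block m := fun y =>
      p.1.letters.piecewise (p.1.opt y.2) y.1 with hext
    set ch : (ℕ → Block m) × Bool → HashValue n × List (Block m) := fun y =>
      (run f₀ h₀ up y.1, blocks c p y.2) with hch
    have hYX : ∀ y ∈ Y, y.1 ∈ X := by
      intro y hy
      rcases List.mem_append.1 hy with h | h <;> obtain ⟨γ, hγ, rfl⟩ := List.mem_map.1 h <;> exact hγ
    have hXnd : X.Nodup := hnd.of_map
    have hYnd : Y.Nodup := by
      rw [hY, List.nodup_append]
      refine ⟨hXnd.map fun _ _ h => (Prod.mk.inj h).1, hXnd.map fun _ _ h => (Prod.mk.inj h).1, ?_⟩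
      rintro y hy y' hy' rfl
      obtain ⟨γ, -, rfl⟩ := List.mem_map.1 hy
      obtain ⟨γ', -, h⟩ := List.mem_map.1 hy'
      simp at h
    have hYlen : Y.length = K + K := by simp [hY, hKdef]
    have hrunX : ∀ f ∈ agreeing Q f₀, ∀ γ ∈ X, run f h₀ up γ = run f₀ h₀ up γ :=
      fun f hf γ hγ => List.map_inj_left.1 (hval f hf) γ hγ
    have hextAdm : ∀ y ∈ Y, Admissible c (done ++ [p.1]) (ext y) := fun y hy =>
      hR.admissible (hadm _ (hYX y hy)) y.2
    have hextRun : ∀ f ∈ agreeing Q f₀, ∀ y ∈ Y,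
        run f h₀ (up ++ p.2) (ext y) = chainEnd f (ch y) := fun f hf y hy => by
      simp only [hext, hch]
      rw [hR.run_eq (hadm _ (hYX y hy)), hrunX f hf _ (hYX y hy)]
    have hextNe : ∀ y ∈ Y, ∀ y' ∈ Y, y ≠ y' → ext y ≠ ext y' :=
      fun y hy y' hy' hne => hR.piecewise_ne_of_ne (hadm _ (hYX _ hy)) (hadm _ (hYX _ hy')) hne
    have hcolsum : ∀ b, ((Y.map ch).map fun p => p.2.count b).sum = K * headCount c (p :: rest) b := by
      intro b
      simp only [hY, hch, List.map_append, List.map_map, List.sum_append, headCount]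
      have : ∀ s, (X.map fun γ : ℕ → Block m => (blocks c p s).count b).sum =
          K * (blocks c p s).count b := fun s => by
        rw [List.map_const', List.sum_replicate, smul_eq_mul]
      have h1 := this false
      have h2 := this true
      simp only [Function.comp_def]
      rw [h1, h2]
      ring
    obtain ⟨a, ha, hap, hae⟩ := hlive p (by simp)
    -- Only collisions among the first `K` chains, which follow the first option, are counted on.
    set pr : ℕ → ℝ := fun t => noCollision (2 ^ n : ℕ) (min t K - e) with hprdef
    have hpr : ∀ t ≤ (Y.map ch).length, ∑ f ∈ agreeing Q f₀,
        (if (((Y.map ch).take t).map (chainEnd f)).Nodup then (1 : ℝ) else 0) ≤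
          pr t * (agreeing Q f₀).card := by
      intro t _
      have h1 := sum_nodup_blocks_le (f₀ := f₀) hcand hc (hR.opt_mem p (by simp)) ha hap hae
        ((X.take (min t K)).map (run f₀ h₀ up))
      rw [List.length_map, List.length_take, min_eq_left (min_le_right t K)] at h1
      refine le_trans (Finset.sum_le_sum fun f _ => ?_) h1
      by_cases hnd' : (((Y.map ch).take t).map (chainEnd f)).Nodup
      · rw [if_pos hnd', if_pos]
        have hsub : (((X.take (min t K)).map (run f₀ h₀ up)).map fun x =>
            (blocks c p false).foldl f x).Sublist (((Y.map ch).take t).map (chainEnd f)) := by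
          have h2 : ((X.take (min t K)).map (run f₀ h₀ up)).map (fun x =>
              (blocks c p false).foldl f x) =
              (((X.map (·, false)).take t).map ch).map (chainEnd f) := by
            rw [← List.map_take, List.map_map, List.map_map, List.map_map]
            have h3 : X.take (min t K) = X.take t := by
              rcases le_total t K with h | h
              · rw [min_eq_left h]
              · rw [min_eq_right h, List.take_of_length_le h, List.take_of_length_le le_rfl]
            rw [h3]
            rfl
          have h3 : ((X.map (·, false)).take t).Sublist (Y.take t) := by
            rw [hY, List.take_append]
            exact List.sublist_append_left _ _
          rw [h2, show (Y.map ch).take t = (Y.take t).map ch from List.map_take.symm]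
          exact (h3.map ch).map (chainEnd f)
        exact hnd'.sublist hsub
      · rw [if_neg hnd']
        split_ifs <;> norm_num
    have hfinish : ∀ Q' f₁, f₁ ∈ agreeing Q f₀ → Q ⊆ Q' →
        (∀ b, blockCount Q' b ≤ blockCount Q b + K * headCount c (p :: rest) b) →
        ∀ y ∈ Y, ∀ y' ∈ Y, y ≠ y' →
        (∀ f ∈ agreeing Q' f₁, chainEnd f (ch y) = chainEnd f₁ (ch y) ∧
          chainEnd f (ch y') = chainEnd f₁ (ch y)) →
        Solvable P Q' f₁ fun _ => C + (rest.map Prod.snd).flatten.length := by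
      intro Q' f₁ h₁ hQ hcol y hy y' hy' hne hend
      refine solvable_of_collision h₀ rest hR.step (hextAdm y hy) (hextAdm y' hy')
        (hextNe y hy y' hy' hne) (fun f hf => ?_) ?_
      · rw [hextRun f (agreeing_trans hQ h₁ hf) y hy, hextRun f (agreeing_trans hQ h₁ hf) y' hy',
          hextRun f₁ h₁ y hy]
        exact hend f hf
      · intro Q'' f₂ h₂ hQ' hcol' δ δ' hδ hδ' hne' hval'
        refine hK Q'' f₂ (agreeing_trans hQ h₁ h₂) (hQ.trans hQ') (fun b hbc hb => ?_) δ δ'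
          (by simpa using hδ) (by simpa using hδ') hne' (by simpa using hval')
        exact (hcol' b hbc hb).trans (hcol b)
    have hextVal : ∀ Q' f₁, f₁ ∈ agreeing Q f₀ → Q ⊆ Q' →
        (∀ f ∈ agreeing Q' f₁, (Y.map ch).map (chainEnd f) = (Y.map ch).map (chainEnd f₁)) →
        ∀ f ∈ agreeing Q' f₁,
          (Y.map ext).map (run f h₀ (up ++ p.2)) = (Y.map ch).map (chainEnd f₁) := by
      intro Q' f₁ h₁ hQ hend f hf
      rw [← hend f hf, List.map_map, List.map_map]
      exact List.map_congr_left fun y hy => hextRun f (agreeing_trans hQ h₁ hf) y hy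
    have hpair : ∀ q q', [q, q'].Sublist (Y.map ch) → ∃ y ∈ Y, ∃ y' ∈ Y, y ≠ y' ∧
        ch y = q ∧ ch y' = q' := by
      intro q q' hqq
      obtain ⟨l, hl, hlq⟩ := List.sublist_map_iff.1 hqq
      rcases l with _ | ⟨y, _ | ⟨y', _ | ⟨z, l⟩⟩⟩ <;> simp at hlq
      have hnd2 := hYnd.sublist hl
      refine ⟨y, hl.subset (by simp), y', hl.subset (by simp), ?_, hlq.1.symm, hlq.2.symm⟩
      simpa using hnd2
    have hsum : ∑ t ∈ Finset.range (Y.map ch).length, pr t ≤ κ := by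
      rw [List.length_map, hYlen]
      exact (sum_noCollision_min_sub_le (2 ^ n) hR1 hRn K e).trans hκ
    have hchlen : ∀ q ∈ Y.map ch, q.2.length = p.2.length := by
      intro q hq
      obtain ⟨y, -, rfl⟩ := List.mem_map.1 hq
      simp [hch, blocks]
    have hlenpos : (0 : ℝ) ≤ p.2.length := by positivity
    have hcost : (p.2.length : ℝ) * ∑ t ∈ Finset.range (Y.map ch).length, pr t ≤
        κ * p.2.length := by
      rw [mul_comm κ]
      exact mul_le_mul_of_nonneg_left hsum hlenpos
    have hflat : (((p :: rest).map Prod.snd).flatten.length : ℝ) =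
        p.2.length + (rest.map Prod.snd).flatten.length := by simp
    -- After the last segment a failed search falls back on `hfall`; before, it enlarges the tree.
    rcases eq_or_ne rest [] with hrest | hrest
    · subst hrest
      have hlast : pr (Y.map ch).length = noCollision (2 ^ n : ℕ) (2 ^ (n - 1) - e) := by
        have h1 : n - 1 = j := by simp at hj; omega
        simp only [hprdef, List.length_map, hYlen]
        rw [min_eq_right (Nat.le_add_left K K), hX, h1]
      refine (solvable_search (Q := Q) (f₀ := f₀) (Y.map ch) hchlen (C₁ := C) (C₂ := C + F)
        (by linarith) pr hpr ?_ ?_).mono_const ?_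
      · intro Q' f₁ h₁ hQ hcol q q' hqq hend
        obtain ⟨y, hy, y', hy', hne, rfl, rfl⟩ := hpair q q' hqq
        have := hfinish Q' f₁ h₁ hQ (fun b => by rw [← hcolsum]; exact hcol b) y hy y' hy' hne hend
        simpa using this
      · intro Q' f₁ _ _ _ _ _
        exact (hfall Q' f₁).mono_const (by linarith)
      · rw [hlast, hflat]
        simp only [List.map_nil, List.flatten_nil, List.length_nil, Nat.cast_zero, add_zero]
        linarith
    · set φ := F * noCollision (2 ^ n : ℕ) (2 ^ (n - 1) - e) with hφ
      have hφ0 : 0 ≤ φ := mul_nonneg hF (noCollision_nonneg _ _)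
      set C' := C + κ * (rest.map Prod.snd).flatten.length + φ with hC'
      refine (solvable_search (Q := Q) (f₀ := f₀) (Y.map ch) hchlen (C₁ := C') (C₂ := C')
        le_rfl pr hpr ?_ ?_).mono_const ?_
      · intro Q' f₁ h₁ hQ hcol q q' hqq hend
        obtain ⟨y, hy, y', hy', hne, rfl, rfl⟩ := hpair q q' hqq
        refine (hfinish Q' f₁ h₁ hQ (fun b => by rw [← hcolsum]; exact hcol b) y hy y' hy' hne
          hend).mono_const ?_
        have : (0 : ℝ) ≤ (rest.map Prod.snd).flatten.length := by positivity
        nlinarith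
      · intro Q' f₁ h₁ hQ hcol hend hnd'
        have hmap := hextVal Q' f₁ h₁ hQ hend
        have hcol2 : ∀ b, blockCount Q' b ≤ blockCount Q b + K * headCount c (p :: rest) b :=
          fun b => by rw [← hcolsum]; exact hcol b
        refine ih (j := j + 1) (X := Y.map ext) hrest (by simp at hj; omega)
          (by rw [List.length_map, hYlen, hX, pow_succ]; ring) hR.step ?_ ?_ ?_ ?_ ?_
        · intro γ hγ
          obtain ⟨y, hy, rfl⟩ := List.mem_map.1 hγ
          exact hextAdm y hy
        · intro f hf
          rw [hmap f hf, hmap f₁ self_mem_agreeing]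
        · rw [hmap f₁ self_mem_agreeing]
          exact hnd'
        · intro p' hp'
          obtain ⟨a', ha', hap', hae'⟩ := hlive p' (by simp [hp'])
          refine ⟨a', ha', hap', le_trans ?_ hae'⟩
          have hmem := hR.opt_mem p' (by simp [hp']) false a' ha'
          refine (hcol2 _).trans (le_of_eq ?_)
          have hzero : headCount c [p] (p'.1.opt false a') = 0 := by
            refine headCount_eq_zero (cand := cand) (fun q hq => by
                rw [List.mem_singleton.1 hq]
                exact hR.opt_mem p List.mem_cons_self)
              (fun h => hc a' (h ▸ hmem)) fun q hq a₂ ha₂ hmem₂ => ?_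
            rw [List.mem_singleton] at hq
            subst hq
            have hne : a₂ ≠ a' := by
              rintro rfl
              exact Finset.disjoint_left.1
                ((List.pairwise_cons.1 hR.pairwise).1 p' hp').2.2 ha₂ ha'
            exact Finset.disjoint_left.1 (hcand a₂ a' hne) hmem₂ hmem
          have hzero' : headCount c (p :: rest) (p'.1.opt false a') = 0 := hzero
          rw [hzero']
          simp
        · intro Q'' f₂ h₂ hQ' hcol' δ δ' hδ hδ' hne' hval'
          refine hK Q'' f₂ (agreeing_trans hQ h₁ h₂) (hQ.trans hQ') (fun b hbc hb => ?_) δ δ'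
            (by simpa using hδ) (by simpa using hδ') hne' (by simpa using hval')
          have h3 := hcol' b hbc fun p' hp' => hb p' (List.mem_of_mem_tail hp')
          have hz : headCount c rest b = 0 := headCount_eq_zero (cand := cand)
            (fun p' hp' => hR.opt_mem p' (List.mem_cons_of_mem _ hp')) hbc hb
          rw [hz, mul_zero, add_zero] at h3
          exact h3.trans (hcol2 b)
      · rw [hC', hflat, sub_self, zero_mul]
        linarith

end merging

/-! ### Merging groups of boxes -/

section phases

variable {n m : ℕ} {c : Block m} {cand : ℕ → Finset (Block m)} {h₀ : HashValue n}

lemma Admissible.perm {Bs Bs' : List (Box m)} {g : ℕ → Block m} (h : Admissible c Bs g)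
    (hp : Bs.Perm Bs') : Admissible c Bs' g :=
  ⟨fun B hB => h.1 B (hp.mem_iff.2 hB), fun a ha => h.2 a fun B hB => ha B (hp.mem_iff.1 hB)⟩

/-- What is known after the word `pre` has been read: whatever option is followed in each of the
disjoint boxes `Bs`, the hash value is the same. Every box has a live letter, whose two blocks have
been queried at few points only. -/
structure State (c : Block m) (cand : ℕ → Finset (Block m)) (h₀ : HashValue n) (pre : List ℕ)
    (Q : Finset (HashValue n × Block m)) (f₀ : Compression n m) (Bs : List (Box m)) : Prop where
  value : ∃ h, ∀ f ∈ agreeing Q f₀, ∀ g, Admissible c Bs g → run f h₀ pre g = h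
  opt_mem : ∀ B ∈ Bs, ∀ s, ∀ a ∈ B.letters, B.opt s a ∈ cand a
  opt_ne : ∀ B ∈ Bs, ∃ a ∈ B.letters, B.opt false a ≠ B.opt true a
  disjoint : Bs.Pairwise fun B B' => Disjoint B.letters B'.letters
  live : ∀ B ∈ Bs, ∃ a ∈ B.letters, ∀ s, blockCount Q (B.opt s a) ≤ 2 * pre.count a

lemma State.perm {pre : List ℕ} {Q : Finset (HashValue n × Block m)} {f₀ : Compression n m}
    {Bs Bs' : List (Box m)} (h : State c cand h₀ pre Q f₀ Bs) (hp : Bs.Perm Bs') :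
    State c cand h₀ pre Q f₀ Bs' where
  value := by
    obtain ⟨x, hx⟩ := h.value
    exact ⟨x, fun f hf g hg => hx f hf g (hg.perm hp.symm)⟩
  opt_mem B hB := h.opt_mem B (hp.mem_iff.2 hB)
  opt_ne B hB := h.opt_ne B (hp.mem_iff.2 hB)
  disjoint := hp.pairwise h.disjoint fun h => h.symm
  live B hB := h.live B (hp.mem_iff.2 hB)

/-- The union of the sets of letters of the boxes of a group. -/
def groupLetters (g : List (Box m × List ℕ)) : Finset ℕ :=
  g.foldr (fun p S => p.1.letters ∪ S) ∅

lemma mem_groupLetters {g : List (Box m × List ℕ)} {a : ℕ} :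
    a ∈ groupLetters g ↔ ∃ p ∈ g, a ∈ p.1.letters :=
  mem_foldr_union (fun p : Box m × List ℕ => p.1.letters) g a

/-- The segments of the boxes do not contain letters of other boxes. -/
def CrossFree (p p' : Box m × List ℕ) : Prop :=
  (∀ a ∈ p.2, a ∉ p'.1.letters) ∧ ∀ a ∈ p'.2, a ∉ p.1.letters

/-- The box formed by a group of boxes and two assignments that collide. -/
lemma State.merge (hcand : ∀ a a', a ≠ a' → Disjoint (cand a) (cand a')) (hc : ∀ a, c ∉ cand a)
    {g : List (Box m × List ℕ)} (hne : g ≠ []) {E : List (Box m)} {pre : List ℕ}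
    {Q Q' : Finset (HashValue n × Block m)} {f₀ f₁ : Compression n m}
    (hS : State c cand h₀ pre Q f₀ (g.map Prod.fst ++ E))
    (havoid : ∀ p ∈ g, ∀ a ∈ p.2, ∀ B ∈ E, a ∉ B.letters)
    (h₁ : f₁ ∈ agreeing Q f₀) (hQ : Q ⊆ Q')
    (hcol : ∀ b, b ≠ c → (∀ p ∈ g.tail, ∀ a ∈ p.1.letters, b ∉ cand a) →
      blockCount Q' b ≤ blockCount Q b + headCount c g b)
    {x : HashValue n} (hx : ∀ f ∈ agreeing Q f₀, ∀ γ, Admissible c (g.map Prod.fst ++ E) γ →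
      run f h₀ pre γ = x) {γ : Bool → ℕ → Block m}
    (hγ : ∀ s, Admissible c (g.map Prod.fst) (γ s)) (hγne : γ false ≠ γ true) {y : HashValue n}
    (hval : ∀ s, ∀ f ∈ agreeing Q' f₁, run f x (g.map Prod.snd).flatten (γ s) = y) :
    State c cand h₀ (pre ++ (g.map Prod.snd).flatten) Q' f₁ (⟨groupLetters g, γ⟩ :: E) where
  value := by
    refine ⟨y, fun f hf G hG => ?_⟩
    obtain ⟨s, hs⟩ := hG.1 ⟨groupLetters g, γ⟩ (by simp)
    have hG' : Admissible c (g.map Prod.fst ++ E) G := by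
      refine ⟨fun B hB => ?_, fun a ha => hG.2 a fun B hB => ?_⟩
      · rcases List.mem_append.1 hB with hB | hB
        · obtain ⟨t, ht⟩ := (hγ s).1 B hB
          obtain ⟨p, hp, rfl⟩ := List.mem_map.1 hB
          exact ⟨t, fun a ha => (hs a (mem_groupLetters.2 ⟨p, hp, ha⟩)).trans (ht a ha)⟩
        · exact hG.1 B (by simp [hB])
      · rcases List.mem_cons.1 hB with rfl | hB
        · intro hmem
          obtain ⟨p, hp, hap⟩ := mem_groupLetters.1 hmem
          exact ha p.1 (List.mem_append_left _ (List.mem_map_of_mem hp)) hap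
        · exact ha B (by simp [hB])
    rw [run_append, hx f (agreeing_trans hQ h₁ hf) G hG', ← hval s f hf]
    refine run_congr f x fun a ha => ?_
    obtain ⟨u, hu, hau⟩ := List.mem_flatten.1 ha
    obtain ⟨p, hp, rfl⟩ := List.mem_map.1 hu
    by_cases hmem : a ∈ groupLetters g
    · exact hs a hmem
    · rw [hG.2 a fun B hB => ?_, (hγ s).2 a fun B hB => ?_]
      · obtain ⟨p', hp', rfl⟩ := List.mem_map.1 hB
        exact fun h => hmem (mem_groupLetters.2 ⟨p', hp', h⟩)
      · rcases List.mem_cons.1 hB with rfl | hB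
        · exact hmem
        · exact havoid p hp a hau B hB
  opt_mem := by
    intro B hB s a ha
    rcases List.mem_cons.1 hB with rfl | hB
    · obtain ⟨p, hp, hap⟩ := mem_groupLetters.1 ha
      obtain ⟨t, ht⟩ := (hγ s).1 p.1 (List.mem_map_of_mem hp)
      simp only [ht a hap]
      exact hS.opt_mem p.1 (List.mem_append_left _ (List.mem_map_of_mem hp)) t a hap
    · exact hS.opt_mem B (by simp [hB]) s a ha
  opt_ne := by
    intro B hB
    rcases List.mem_cons.1 hB with rfl | hB
    · obtain ⟨a, ha⟩ := Function.ne_iff.1 hγne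
      refine ⟨a, by_contra fun hmem => ha ?_, ha⟩
      have : ∀ B ∈ g.map Prod.fst, a ∉ B.letters := by
        intro B hB haB
        obtain ⟨p, hp, rfl⟩ := List.mem_map.1 hB
        exact hmem (mem_groupLetters.2 ⟨p, hp, haB⟩)
      rw [(hγ false).2 a this, (hγ true).2 a this]
    · exact hS.opt_ne B (by simp [hB])
  disjoint := by
    have h := List.pairwise_append.1 hS.disjoint
    refine List.pairwise_cons.2 ⟨fun B hB => Finset.disjoint_left.2 fun a ha => ?_, h.2.1⟩
    obtain ⟨p, hp, hap⟩ := mem_groupLetters.1 ha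
    exact Finset.disjoint_left.1 (h.2.2 p.1 (List.mem_map_of_mem hp) B hB) hap
  live := by
    have hopt : ∀ p ∈ g, ∀ s, ∀ a ∈ p.1.letters, p.1.opt s a ∈ cand a := fun p hp =>
      hS.opt_mem p.1 (List.mem_append_left _ (List.mem_map_of_mem hp))
    have hdisj := List.pairwise_append.1 hS.disjoint
    have hcne : ∀ {b a}, b ∈ cand a → b ≠ c := fun hb h => hc _ (h ▸ hb)
    intro B hB
    rcases List.mem_cons.1 hB with rfl | hB
    · rcases g with _ | ⟨p, g⟩
      · exact absurd rfl hne
      -- The live letter of the first box stays alive: in the first segment the search starts from a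
      -- single value, and afterwards the blocks of this letter are no longer read.
      obtain ⟨a, ha, hlive⟩ := hS.live p.1 (by simp)
      refine ⟨a, mem_groupLetters.2 ⟨p, by simp, ha⟩, fun s => ?_⟩
      obtain ⟨t, ht⟩ := (hγ s).1 p.1 (by simp)
      simp only [ht a ha]
      have hmem := hopt p (by simp) t a ha
      have h1 := hcol _ (hcne hmem) fun p' hp' a' ha' hmem' => by
        have hne : a' ≠ a := by
          rintro rfl
          exact Finset.disjoint_left.1 ((List.pairwise_cons.1 hdisj.1).1 p'.1
            (List.mem_map_of_mem hp')) ha ha'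
        exact Finset.disjoint_left.1 (hcand a' a hne) hmem' hmem
      have h2 : ∀ s', (blocks c p s').count (p.1.opt t a) ≤ p.2.count a := by
        intro s'
        rw [blocks, List.count, List.count, List.countP_map]
        refine List.countP_mono_left fun a' _ heq => ?_
        simp only [Function.comp, beq_iff_eq] at heq ⊢
        by_contra hne
        by_cases haS : a' ∈ p.1.letters
        · rw [Finset.piecewise_eq_of_mem _ _ _ haS] at heq
          refine Finset.disjoint_left.1 (hcand a' a hne) (hopt p (by simp) s' a' haS) ?_
          rw [heq]
          exact hmem
        · rw [Finset.piecewise_eq_of_notMem _ _ _ haS] at heq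
          exact hcne hmem heq.symm
      have h3 := hlive t
      have h4 := h2 false
      have h5 := h2 true
      simp only [headCount] at h1
      simp only [List.map_cons, List.flatten_cons, List.count_append]
      omega
    · obtain ⟨a, ha, hlive⟩ := hS.live B (by simp [hB])
      refine ⟨a, ha, fun s => ?_⟩
      have hmem := hS.opt_mem B (by simp [hB]) s a ha
      have hnot : ∀ p ∈ g, ∀ a' ∈ p.1.letters, B.opt s a ∉ cand a' := by
        intro p hp a' ha' hmem'
        have hne : a' ≠ a := by
          rintro rfl
          exact Finset.disjoint_left.1 (hdisj.2.2 p.1 (List.mem_map_of_mem hp) B hB) ha' ha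
        exact Finset.disjoint_left.1 (hcand a' a hne) hmem' hmem
      have h1 := hcol _ (hcne hmem) fun p hp => hnot p (List.mem_of_mem_tail hp)
      rw [headCount_eq_zero hopt (hcne hmem) hnot] at h1
      have h2 := hlive s
      rw [List.count_append]
      omega

variable {P : Compression n m → Finset (Message m) → Prop}

/-- One group of `n` boxes is merged into one box. -/
lemma solvable_group (hn : 0 < n) (hcand : ∀ a a', a ≠ a' → Disjoint (cand a) (cand a'))
    (hc : ∀ a, c ∉ cand a) {R : ℝ} (hR1 : 1 ≤ R) (hRn : R ^ 2 = (2 ^ n : ℕ)) {q : ℕ} {κ : ℝ}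
    {F : ℝ} (hF : 0 ≤ F) (hfall : ∀ Q f₀, Solvable P Q f₀ fun _ => F)
    (hκ : 33 / 20 * R + 2 + 2 * (2 * q : ℕ) +
      F * noCollision (2 ^ n : ℕ) (2 ^ (n - 1) - 2 * q) ≤ κ) {C : ℝ} (hC : 0 ≤ C)
    {g : List (Box m × List ℕ)} (hlen : g.length = n) {E : List (Box m)} {pre : List ℕ}
    {Q : Finset (HashValue n × Block m)} {f₀ : Compression n m}
    (hS : State c cand h₀ pre Q f₀ (g.map Prod.fst ++ E))
    (hcross : g.Pairwise CrossFree) (hmem : ∀ p ∈ g, ∀ a ∈ p.1.letters, a ∈ p.2)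
    (havoid : ∀ p ∈ g, ∀ a ∈ p.2, ∀ B ∈ E, a ∉ B.letters) (hq : ∀ a, pre.count a ≤ q)
    (hK : ∀ Q' f₁ B, B.letters = groupLetters g →
      State c cand h₀ (pre ++ (g.map Prod.snd).flatten) Q' f₁ (B :: E) →
      Solvable P Q' f₁ fun _ => C) :
    Solvable P Q f₀ fun _ => C + κ * (g.map Prod.snd).flatten.length := by
  obtain ⟨x, hx⟩ := hS.value
  have hgne : g ≠ [] := by
    rintro rfl
    simp at hlen
    omega
  have hdisj := (List.pairwise_append.1 hS.disjoint).1
  rw [List.pairwise_map] at hdisj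
  have hready : Ready cand [] [] g :=
    ⟨(hcross.and hdisj).imp fun h => ⟨h.1.1, h.1.2, h.2⟩, by simp, by simp,
      fun p hp => hS.opt_mem p.1 (List.mem_append_left _ (List.mem_map_of_mem hp)),
      fun p hp => hS.opt_ne p.1 (List.mem_append_left _ (List.mem_map_of_mem hp))⟩
  have hφ : 0 ≤ F * noCollision (2 ^ n : ℕ) (2 ^ (n - 1) - 2 * q) :=
    mul_nonneg hF (noCollision_nonneg _ _)
  refine (solvable_tree (P := P) hcand hc hR1 hRn (e := 2 * q) le_rfl hF hfall hC x g
    (X := [fun _ => c]) (j := 0) (Q := Q) (f₀ := f₀) hgne (by simpa using hlen) (by simp) hready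
    (by simp [Admissible]) (by simp [run]) (by simp) ?_ ?_).mono_const ?_
  · intro p hp
    obtain ⟨a, ha, hlive⟩ := hS.live p.1 (List.mem_append_left _ (List.mem_map_of_mem hp))
    refine ⟨a, ha, hmem p hp a ha, (hlive false).trans ?_⟩
    have := hq a
    omega
  · intro Q' f₁ h₁ hQ hcol γ γ' hγ hγ' hne hval
    refine hK Q' f₁ ⟨groupLetters g, fun s => cond s γ' γ⟩ rfl ?_
    refine hS.merge hcand hc hgne havoid h₁ hQ (by simpa using hcol) hx
      (γ := fun s => cond s γ' γ) ?_ hne (y := run f₁ x (g.map Prod.snd).flatten γ) ?_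
    · rintro (_ | _)
      · simpa using hγ
      · simpa using hγ'
    · rintro (_ | _) f hf
      · simpa using (hval f hf).1
      · simpa using (hval f hf).2
  · -- The cost of a failed search is charged to the group once, and its word is not empty.
    have h1 : (1 : ℝ) ≤ (g.map Prod.snd).flatten.length := by
      rcases g with _ | ⟨p, g⟩
      · exact absurd rfl hgne
      obtain ⟨a, ha, -⟩ := hS.opt_ne p.1 (by simp)
      have := List.length_pos_of_mem (hmem p (by simp) a ha)
      have h2 : 1 ≤ (((p :: g).map Prod.snd).flatten).length := by simp; omega
      exact_mod_cast h2
    nlinarith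

/-- All groups of one word are merged. -/
lemma solvable_phase (hn : 0 < n) (hcand : ∀ a a', a ≠ a' → Disjoint (cand a) (cand a'))
    (hc : ∀ a, c ∉ cand a) {R : ℝ} (hR1 : 1 ≤ R) (hRn : R ^ 2 = (2 ^ n : ℕ)) {q : ℕ} {κ : ℝ}
    {F : ℝ} (hF : 0 ≤ F) (hfall : ∀ Q f₀, Solvable P Q f₀ fun _ => F)
    (hκ : 33 / 20 * R + 2 + 2 * (2 * q : ℕ) +
      F * noCollision (2 ^ n : ℕ) (2 ^ (n - 1) - 2 * q) ≤ κ) (hκ0 : 0 ≤ κ)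
    {C : ℝ} (hC : 0 ≤ C) :
    ∀ (G : List (List (Box m × List ℕ))) {D : List (Box m)} {pre : List ℕ}
    {Q : Finset (HashValue n × Block m)} {f₀ : Compression n m}, (∀ g ∈ G, g.length = n) →
    State c cand h₀ pre Q f₀ (G.flatten.map Prod.fst ++ D) → G.flatten.Pairwise CrossFree →
    (∀ p ∈ G.flatten, ∀ a ∈ p.1.letters, a ∈ p.2) →
    (∀ p ∈ G.flatten, ∀ a ∈ p.2, ∀ B ∈ D, a ∉ B.letters) →
    (∀ a, (pre ++ (G.flatten.map Prod.snd).flatten).count a ≤ q) →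
    (∀ Q' f₁ Bs, (Bs.map Box.letters).Perm (G.map groupLetters ++ D.map Box.letters) →
      State c cand h₀ (pre ++ (G.flatten.map Prod.snd).flatten) Q' f₁ Bs →
      Solvable P Q' f₁ fun _ => C) →
    Solvable P Q f₀ fun _ => C + κ * (G.flatten.map Prod.snd).flatten.length := by
  intro G
  induction G with
  | nil =>
    intro D pre Q f₀ _ hS _ _ _ _ hK
    have := hK Q f₀ D (by simp) (by simpa using hS)
    simpa using this
  | cons g G ih =>
    intro D pre Q f₀ hlen hS hcross hmem havoid hq hK
    simp only [List.flatten_cons, List.map_append, List.flatten_append] at hS hcross hmem havoid hq hK ⊢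
    have hcr := List.pairwise_append.1 hcross
    have hcost : 0 ≤ κ * (G.flatten.map Prod.snd).flatten.length :=
      mul_nonneg hκ0 (Nat.cast_nonneg _)
    have hgroup := solvable_group (P := P) (h₀ := h₀) hn hcand hc hR1 hRn hF hfall hκ
      (C := C + κ * (G.flatten.map Prod.snd).flatten.length) (by linarith)
      (g := g) (hlen g (by simp)) (E := G.flatten.map Prod.fst ++ D) (pre := pre) (Q := Q)
      (f₀ := f₀) (by simpa using hS) hcr.1 (fun p hp => hmem p (by simp [hp])) ?_ ?_ ?_
    · refine hgroup.mono_const (le_of_eq ?_)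
      rw [List.length_append]
      push_cast
      ring
    · intro p hp a ha B hB
      rcases List.mem_append.1 hB with hB | hB
      · obtain ⟨p', hp', rfl⟩ := List.mem_map.1 hB
        exact (hcr.2.2 p hp p' hp').1 a ha
      · exact havoid p (by simp [hp]) a ha B hB
    · intro a
      refine le_trans ?_ (hq a)
      rw [List.count_append]
      exact Nat.le_add_right _ _
    · intro Q' f₁ B hB hS'
      refine ih (D := B :: D) (fun g' hg' => hlen g' (by simp [hg'])) (hS'.perm ?_) hcr.2.1
        (fun p hp => hmem p (List.mem_append_right _ hp)) ?_ ?_ ?_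
      · exact List.perm_middle.symm
      · intro p hp a ha B' hB'
        rcases List.mem_cons.1 hB' with rfl | hB'
        · rw [hB]
          intro hmem'
          obtain ⟨p', hp', hap'⟩ := mem_groupLetters.1 hmem'
          exact (hcr.2.2 p' hp' p hp).2 a ha hap'
        · exact havoid p (List.mem_append_right _ hp) a ha B' hB'
      · simpa using hq
      · intro Q'' f₂ Bs hBs hS''
        refine hK Q'' f₂ Bs (hBs.trans ?_) (by simpa using hS'')
        rw [List.map_cons, hB, List.map_cons, List.cons_append]
        exact List.perm_middle

lemma exists_map_eq_of_perm {β γ : Type*} (f : β → γ) {x y : List γ} (h : x.Perm y) :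
    ∀ l : List β, l.map f = x → ∃ l' : List β, l'.Perm l ∧ l'.map f = y := by
  induction h with
  | nil => exact fun l hl => ⟨l, .refl _, hl⟩
  | cons a _ ih =>
    intro l h
    obtain ⟨b, l, rfl, rfl, hl⟩ := List.map_eq_cons_iff.1 h
    obtain ⟨l', h1, h2⟩ := ih l hl
    exact ⟨b :: l', h1.cons _, by simp [h2]⟩
  | swap a a' x =>
    intro l h
    obtain ⟨b, l, rfl, rfl, hl⟩ := List.map_eq_cons_iff.1 h
    obtain ⟨b', l, rfl, rfl, hl'⟩ := List.map_eq_cons_iff.1 hl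
    exact ⟨b' :: b :: l, .swap _ _ _, by simp [hl']⟩
  | trans _ _ ih₁ ih₂ =>
    intro l hl
    obtain ⟨l', h1, h2⟩ := ih₁ l hl
    obtain ⟨l'', h3, h4⟩ := ih₂ l' h2
    exact ⟨l'', h3.trans h1, h4⟩

lemma exists_groups_of_map_eq {β γ δ : Type*} (f : β → γ) : ∀ (G : List (List (γ × δ)))
    (l : List β), l.map f = G.flatten.map Prod.fst →
    ∃ G' : List (List (β × δ)), G'.map (List.map (Prod.map f id)) = G ∧
      G'.flatten.map Prod.fst = l := by
  intro G
  induction G with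
  | nil => intro l hl; exact ⟨[], rfl, by simpa using hl.symm⟩
  | cons g G ih =>
    intro l hl
    rw [List.flatten_cons, List.map_append, List.map_eq_append_iff] at hl
    obtain ⟨l₁, l₂, rfl, h1, h2⟩ := hl
    obtain ⟨G', h3, h4⟩ := ih l₂ h2
    have hlen : l₁.length = g.length := by simpa using congrArg List.length h1
    refine ⟨l₁.zip (g.map Prod.snd) :: G', ?_, ?_⟩
    · rw [List.map_cons, h3, ← List.zip_map, h1, List.map_id]
      congr 1
      exact (List.zip_of_prod rfl rfl).symm
    · rw [List.flatten_cons, List.map_append, h4, List.map_fst_zip (by simp [hlen])]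

/-- The boxes are merged along all the words `vs`, until `r` boxes remain. -/
lemma solvable_phases (hn : 0 < n) (hcand : ∀ a a', a ≠ a' → Disjoint (cand a) (cand a'))
    (hc : ∀ a, c ∉ cand a) {R : ℝ} (hR1 : 1 ≤ R) (hRn : R ^ 2 = (2 ^ n : ℕ)) {q r : ℕ} {κ : ℝ}
    {F : ℝ} (hF : 0 ≤ F) (hfall : ∀ Q f₀, Solvable P Q f₀ fun _ => F)
    (hκ : 33 / 20 * R + 2 + 2 * (2 * q : ℕ) +
      F * noCollision (2 ^ n : ℕ) (2 ^ (n - 1) - 2 * q) ≤ κ) (hκ0 : 0 ≤ κ) :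
    ∀ (vs : List (List ℕ)) {Bs : List (Box m)} {pre : List ℕ}
    {Q : Finset (HashValue n × Block m)} {f₀ : Compression n m},
    Mergeable n r vs (Bs.map Box.letters) → (∀ B ∈ Bs, ∀ v ∈ vs, ∀ a ∈ B.letters, a ∈ v) →
    (∀ a, (pre ++ vs.flatten).count a ≤ q) → State c cand h₀ pre Q f₀ Bs →
    (∀ Q' f₁ Bs', Bs'.length = r → State c cand h₀ (pre ++ vs.flatten) Q' f₁ Bs' →
      Solvable P Q' f₁ fun _ => 0) →
    Solvable P Q f₀ fun _ => κ * vs.flatten.length := by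
  intro vs
  induction vs with
  | nil =>
    intro Bs pre Q f₀ hm _ _ hS hK
    have := hK Q f₀ Bs (by simpa [Mergeable] using hm) (by simpa using hS)
    simpa using this
  | cons v vs ih =>
    intro Bs pre Q f₀ hm hmem hq hS hK
    obtain ⟨G₀, hG1, hG2, hG3, hG4⟩ := hm
    obtain ⟨l, hl1, hl2⟩ := exists_map_eq_of_perm Box.letters hG2.symm Bs rfl
    obtain ⟨G, rfl, rfl⟩ := exists_groups_of_map_eq Box.letters G₀ l hl2
    rw [← List.map_flatten] at hG3
    have hv : (G.flatten.map Prod.snd).flatten = v := by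
      rw [← hG3.1, List.map_map]
      rfl
    have hmemv : ∀ p ∈ G.flatten, ∀ v' ∈ v :: vs, ∀ a ∈ p.1.letters, a ∈ v' := fun p hp =>
      hmem p.1 (hl1.mem_iff.1 (List.mem_map_of_mem hp))
    have hphase := solvable_phase (P := P) (h₀ := h₀) hn hcand hc hR1 hRn hF hfall hκ hκ0
      (C := κ * vs.flatten.length) (mul_nonneg hκ0 (Nat.cast_nonneg _)) G (D := []) (pre := pre)
      (Q := Q) (f₀ := f₀) ?_ (by simpa using hS.perm hl1.symm) ?_ ?_ (by simp) ?_ ?_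
    · refine hphase.mono_const (le_of_eq ?_)
      rw [hv, List.flatten_cons, List.length_append]
      push_cast
      ring
    · intro g hg
      have := hG1 _ (List.mem_map_of_mem hg)
      simpa using this
    · exact (List.pairwise_map.1 hG3.2).imp id
    · intro p hp a ha
      have hp' : Prod.map Box.letters id p ∈ G.flatten.map (Prod.map Box.letters id) :=
        List.mem_map_of_mem hp
      exact hG3.mem_segment hp' ha (hmemv p hp v (by simp) a ha)
    · intro a
      refine le_trans ?_ (hq a)
      rw [hv, List.flatten_cons, List.count_append, List.count_append, List.count_append]
      omega
    · intro Q' f₁ Bs' hBs' hS'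
      rw [hv] at hS'
      rw [List.map_nil, List.append_nil] at hBs'
      refine ih (pre := pre ++ v) (Mergeable.perm ?_ hBs'.symm) ?_ (by simpa using hq) hS'
        (by simpa using hK)
      · rw [List.map_map] at hG4
        convert hG4 using 2
        funext g
        simp [groupLetters, List.foldr_map]
      · intro B hB v' hv' a ha
        obtain ⟨g, hg, hgB⟩ := List.mem_map.1 (hBs'.mem_iff.1 (List.mem_map_of_mem hB))
        rw [← hgB] at ha
        obtain ⟨p, hp, hap⟩ := mem_groupLetters.1 ha
        exact hmemv p (List.mem_flatten.2 ⟨g, hg, hp⟩) v' (by simp [hv']) a hap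

end phases

/-! ### The first phase: a collision for each single letter -/

section firstPhase

variable {n m : ℕ} {c : Block m} {cand : ℕ → Finset (Block m)} {h₀ : HashValue n}

/-- The blocks read in the word `u` when `a` is assigned `b` and all other letters `c`. -/
def letterBlocks (c : Block m) (a : ℕ) (u : List ℕ) (b : Block m) : List (Block m) :=
  u.map fun a' => if a' = a then b else c

lemma count_letterBlocks {a : ℕ} {u : List ℕ} {b b₁ : Block m} (hb : b₁ ≠ c) :
    (letterBlocks c a u b).count b₁ = if b = b₁ then u.count a else 0 := by
  induction u with
  | nil => simp [letterBlocks]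
  | cons a' u ih =>
    rw [letterBlocks] at ih ⊢
    rw [List.map_cons, List.count_cons, List.count_cons, ih]
    simp only [beq_iff_eq]
    by_cases ha : a' = a <;> by_cases hbb : b = b₁ <;> simp [ha, hbb, hb.symm]

lemma sum_count_letterBlocks {a : ℕ} {u : List ℕ} {b₁ : Block m} (hb : b₁ ≠ c)
    (bl : List (Block m)) :
    (bl.map fun b => (letterBlocks c a u b).count b₁).sum = bl.count b₁ * u.count a := by
  induction bl with
  | nil => simp
  | cons b bl ih =>
    rw [List.map_cons, List.sum_cons, ih, count_letterBlocks hb, List.count_cons]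
    simp only [beq_iff_eq]
    split_ifs <;> ring

lemma State.cons_letter (hcand : ∀ a a', a ≠ a' → Disjoint (cand a) (cand a'))
    (hc : ∀ a, c ∉ cand a) {D : List (Box m)} {pre u : List ℕ} {a : ℕ}
    {Q Q' : Finset (HashValue n × Block m)} {f₀ f₁ : Compression n m}
    (hS : State c cand h₀ pre Q f₀ D) (ha : a ∉ pre) (hau : a ∈ u)
    (havoid : ∀ a' ∈ u, ∀ B ∈ D, a' ∉ B.letters)
    (h₁ : f₁ ∈ agreeing Q f₀) (hQ : Q ⊆ Q') (hzero : ∀ b ∈ cand a, blockCount Q b = 0)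
    (hcol : ∀ b, b ≠ c → blockCount Q' b ≤ blockCount Q b + if b ∈ cand a then u.count a else 0)
    {x : HashValue n} (hx : ∀ f ∈ agreeing Q f₀, ∀ γ, Admissible c D γ → run f h₀ pre γ = x)
    {β : Bool → Block m} (hβ : ∀ s, β s ∈ cand a) (hβne : β false ≠ β true) {y : HashValue n}
    (hval : ∀ s, ∀ f ∈ agreeing Q' f₁, chainEnd f (x, letterBlocks c a u (β s)) = y) :
    State c cand h₀ (pre ++ u) Q' f₁ (⟨{a}, fun s _ => β s⟩ :: D) where
  value := by
    refine ⟨y, fun f hf G hG => ?_⟩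
    obtain ⟨s, hs⟩ := hG.1 ⟨{a}, fun s _ => β s⟩ (by simp)
    have hGa : G a = β s := hs a (by simp)
    have hupd : Admissible c D (Function.update G a c) := by
      refine ⟨fun B hB => ?_, fun a' ha' => ?_⟩
      · obtain ⟨t, ht⟩ := hG.1 B (by simp [hB])
        refine ⟨t, fun a' ha' => ?_⟩
        have hne : a' ≠ a := by
          rintro rfl
          exact havoid _ hau B hB ha'
        rw [Function.update_of_ne hne]
        exact ht a' ha'
      · by_cases hne : a' = a
        · rw [hne, Function.update_self]
        · rw [Function.update_of_ne hne]
          refine hG.2 a' fun B hB => ?_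
          rcases List.mem_cons.1 hB with rfl | hB
          · simpa using hne
          · exact ha' B hB
    have hpre : run f h₀ pre G = x := by
      rw [← hx f (agreeing_trans hQ h₁ hf) _ hupd]
      refine run_congr f h₀ fun a' ha' => ?_
      rw [Function.update_of_ne]
      rintro rfl
      exact ha ha'
    rw [run_append, hpre, ← hval s f hf, run, chainEnd, letterBlocks]
    congr 1
    refine List.map_congr_left fun a' ha' => ?_
    split_ifs with hne
    · rw [hne, hGa]
    · refine hG.2 a' fun B hB => ?_
      rcases List.mem_cons.1 hB with rfl | hB
      · simpa using hne
      · exact havoid a' ha' B hB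
  opt_mem := by
    intro B hB s a' ha'
    rcases List.mem_cons.1 hB with rfl | hB
    · obtain rfl : a' = a := by simpa using ha'
      exact hβ s
    · exact hS.opt_mem B hB s a' ha'
  opt_ne := by
    intro B hB
    rcases List.mem_cons.1 hB with rfl | hB
    · exact ⟨a, by simp, hβne⟩
    · exact hS.opt_ne B hB
  disjoint := by
    refine List.pairwise_cons.2 ⟨fun B hB => ?_, hS.disjoint⟩
    simpa using havoid a hau B hB
  live := by
    have hcne : ∀ {b a}, b ∈ cand a → b ≠ c := fun hb h => hc _ (h ▸ hb)
    intro B hB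
    rcases List.mem_cons.1 hB with rfl | hB
    · refine ⟨a, by simp, fun s => ?_⟩
      have h1 := hcol (β s) (hcne (hβ s))
      rw [if_pos (hβ s), hzero _ (hβ s)] at h1
      show blockCount Q' (β s) ≤ _
      rw [List.count_append]
      omega
    · have hBD : B ∈ D := hB
      obtain ⟨a', ha', hlive⟩ := hS.live B hBD
      refine ⟨a', ha', fun s => ?_⟩
      have hmem := hS.opt_mem B hBD s a' ha'
      have h1 := hcol _ (hcne hmem)
      have hne : a' ≠ a := by
        rintro rfl
        exact havoid _ hau B hBD ha'
      rw [if_neg (Finset.disjoint_left.1 (hcand a' a hne) hmem)] at h1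
      have h2 := hlive s
      rw [List.count_append]
      omega

variable {P : Compression n m → Finset (Message m) → Prop}

/-- For each letter of `L`, with its segment, one looks for two candidate blocks that lead to a
collision. The chains of a search read pairwise distinct new blocks, so their ends are independent
and identically distributed. -/
lemma solvable_first_phase (hcand : ∀ a a', a ≠ a' → Disjoint (cand a) (cand a'))
    (hc : ∀ a, c ∉ cand a) {R : ℝ} (hR1 : 1 ≤ R) (hRn : R ^ 2 = (2 ^ n : ℕ)) {κ : ℝ}
    (hκ : 33 / 20 * R + 2 ≤ κ) {F : ℝ} (hF : 0 ≤ F)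
    (hfall : ∀ Q f₀, Solvable P Q f₀ fun _ => F) {C : ℝ} (hC : 0 ≤ C) {s : ℕ} :
    ∀ (L : List (ℕ × List ℕ)) {D : List (Box m)} {pre : List ℕ}
    {Q : Finset (HashValue n × Block m)} {f₀ : Compression n m},
    L.Pairwise (fun p p' => p'.1 ∉ p.2 ∧ p.1 ∉ p'.2) → (∀ p ∈ L, p.1 ∈ p.2 ∧ p.1 ∉ pre) →
    (∀ p ∈ L, ∀ a ∈ p.2, ∀ B ∈ D, a ∉ B.letters) →
    (∀ p ∈ L, s ≤ (cand p.1).card ∧ ∀ b ∈ cand p.1, blockCount Q b = 0) →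
    State c cand h₀ pre Q f₀ D →
    (∀ Q' f₁ Bs, (Bs.map Box.letters).Perm (L.map (fun p => {p.1}) ++ D.map Box.letters) →
      State c cand h₀ (pre ++ (L.map Prod.snd).flatten) Q' f₁ Bs → Solvable P Q' f₁ fun _ => C) →
    Solvable P Q f₀ fun _ => C + κ * (L.map Prod.snd).flatten.length +
      L.length * (F * noCollision (2 ^ n : ℕ) s) := by
  intro L
  induction L with
  | nil =>
    intro D pre Q f₀ _ _ _ _ hS hK
    have := hK Q f₀ D (by simp) (by simpa using hS)
    simpa using this
  | cons p L ih =>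
    obtain ⟨a, u⟩ := p
    intro D pre Q f₀ hL hmem havoid hnew hS hK
    obtain ⟨hL1, hL2⟩ := List.pairwise_cons.1 hL
    obtain ⟨hau, hapre⟩ := hmem (a, u) (by simp)
    obtain ⟨hs, hzero⟩ := hnew (a, u) (by simp)
    simp only at hL1 hau hapre hs hzero
    obtain ⟨x, hx⟩ := hS.value
    set C₁ := C + κ * (L.map Prod.snd).flatten.length +
      L.length * (F * noCollision (2 ^ n : ℕ) s) with hC₁
    set bl := (cand a).toList with hbl
    set cs : List (HashValue n × List (Block m)) := bl.map fun b => (x, letterBlocks c a u b)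
      with hcs
    have hblnd : bl.Nodup := Finset.nodup_toList _
    have hcslen : cs.length = (cand a).card := by rw [hcs, List.length_map, Finset.length_toList]
    have hsum : ∀ b, b ≠ c → (cs.map fun p => p.2.count b).sum =
        if b ∈ cand a then u.count a else 0 := by
      intro b hb
      have h1 := sum_count_letterBlocks (a := a) (u := u) hb bl
      rw [hcs, List.map_map]
      refine h1.trans ?_
      split_ifs with hbm
      · rw [List.count_eq_one_of_mem hblnd (Finset.mem_toList.2 hbm), one_mul]
      · rw [List.count_eq_zero.2 fun h => hbm (Finset.mem_toList.1 h), zero_mul]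
    have hlen : ∀ p ∈ cs, p.2.length = u.length := by
      intro p hp
      obtain ⟨b, -, rfl⟩ := List.mem_map.1 hp
      simp [letterBlocks]
    have hpair : ∀ p p', [p, p'].Sublist cs → ∃ b ∈ cand a, ∃ b' ∈ cand a, b ≠ b' ∧
        (x, letterBlocks c a u b) = p ∧ (x, letterBlocks c a u b') = p' := by
      intro p p' hpp
      obtain ⟨l, hl, hlp⟩ := List.sublist_map_iff.1 hpp
      rcases l with _ | ⟨b, _ | ⟨b', _ | ⟨b'', l⟩⟩⟩ <;> simp at hlp
      have hnd := hblnd.sublist hl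
      exact ⟨b, Finset.mem_toList.1 (hl.subset (by simp)), b',
        Finset.mem_toList.1 (hl.subset (by simp)), by simpa using hnd, hlp.1.symm, hlp.2.symm⟩
    refine (solvable_search (P := P) (Q := Q) (f₀ := f₀) cs hlen (C₁ := C₁) (C₂ := C₁ + F)
      (by linarith) (fun t => noCollision (2 ^ n : ℕ) t) ?_ ?_ ?_).mono_const ?_
    · intro t ht
      have h1 := sum_nodup_distinct_blocks_le (Q := Q) (f₀ := f₀) u a c x (bl.take t)
        (hblnd.sublist (List.take_sublist _ _))
        (fun h => hc a (Finset.mem_toList.1 (List.mem_of_mem_take h)))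
        (fun b hb => hzero b (Finset.mem_toList.1 (List.mem_of_mem_take hb)))
      rw [hcs, List.length_map] at ht
      rw [List.length_take, min_eq_left ht] at h1
      refine le_trans (le_of_eq (Finset.sum_congr rfl fun f _ => ?_)) h1
      rw [hcs, ← List.map_take, List.map_map]
      rfl
    · intro Q' f₁ h₁ hQ hcol p p' hpp hend
      obtain ⟨b, hb, b', hb', hbb, rfl, rfl⟩ := hpair p p' hpp
      have hcol' : ∀ b, b ≠ c →
          blockCount Q' b ≤ blockCount Q b + if b ∈ cand a then u.count a else 0 := fun b hb => by
        rw [← hsum b hb]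
        exact hcol b
      have hS' := hS.cons_letter hcand hc hapre hau (havoid (a, u) (by simp)) h₁ hQ hzero hcol' hx
        (β := fun s => cond s b' b) (by rintro (_ | _) <;> simpa) (by simpa using hbb)
        (y := chainEnd f₁ (x, letterBlocks c a u b))
        (by rintro (_ | _) f hf <;> simp [hend f hf])
      refine ih hL2 (fun p hp => ⟨(hmem p (by simp [hp])).1, fun h => ?_⟩) ?_ ?_ hS' ?_
      · rcases List.mem_append.1 h with h | h
        · exact (hmem p (by simp [hp])).2 h
        · exact (hL1 p hp).1 h
      · intro p hp a' ha' B hB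
        rcases List.mem_cons.1 hB with rfl | hB
        · intro h
          obtain rfl : a' = a := by simpa using h
          exact (hL1 p hp).2 ha'
        · exact havoid p (by simp [hp]) a' ha' B hB
      · intro p hp
        obtain ⟨h1, h2⟩ := hnew p (by simp [hp])
        refine ⟨h1, fun b hb => ?_⟩
        have hne : p.1 ≠ a := by
          rintro h
          refine (hL1 p hp).2 ?_
          rw [← h]
          exact (hmem p (by simp [hp])).1
        have h3 := hcol' b fun h => hc _ (h ▸ hb)
        rw [if_neg (Finset.disjoint_left.1 (hcand p.1 a hne) hb), h2 b hb] at h3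
        omega
      · intro Q'' f₂ Bs hBs hS''
        refine hK Q'' f₂ Bs (hBs.trans ?_) (by simpa using hS'')
        rw [List.map_cons, List.map_cons, List.cons_append]
        exact List.perm_middle
    · intro Q' f₁ _ _ _ _ _
      refine (hfall Q' f₁).mono_const ?_
      have h1 : 0 ≤ κ * (L.map Prod.snd).flatten.length :=
        mul_nonneg (by linarith) (Nat.cast_nonneg _)
      have h2 : 0 ≤ L.length * (F * noCollision (2 ^ n : ℕ) s) :=
        mul_nonneg (Nat.cast_nonneg _) (mul_nonneg hF (noCollision_nonneg _ _))
      linarith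
    · have h1 : noCollision (2 ^ n : ℕ) cs.length ≤ noCollision (2 ^ n : ℕ) s :=
        noCollision_antitone _ (by rw [hcslen]; exact hs)
      have h2 := mul_le_mul_of_nonneg_left h1 hF
      have h3 := mul_le_mul_of_nonneg_left
        ((sum_noCollision_le (2 ^ n) hR1 hRn cs.length).trans hκ) (Nat.cast_nonneg (α := ℝ) u.length)
      simp only [List.map_cons, List.flatten_cons, List.length_append, List.length_cons, hC₁]
      push_cast at h2 h3 ⊢
      linarith

end firstPhase

/-! ### The final collision -/

section collision

variable {n m r : ℕ} {α : (l : ℕ+) → List (Fin l)} {h₀ : HashValue n}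

lemma hash_eq_run (f : Compression n m) (l : ℕ+) (g : ℕ → Block m) :
    hash α f h₀ ⟨l, fun i => g i⟩ = run f h₀ ((α l).map Fin.val) g := by
  simp [hash, iteratedCompression, run, Function.comp_def]

/-- When the whole word has been read and `r` boxes remain, the `2 ^ r` choices of an option in each
box give distinct messages with the same hash value. -/
lemma State.exists_isCollision {c : Block m} {cand : ℕ → Finset (Block m)} {l : ℕ+}
    {Q : Finset (HashValue n × Block m)} {f₀ : Compression n m} {Bs : List (Box m)}
    (hS : State c cand h₀ ((α l).map Fin.val) Q f₀ Bs) (hlen : Bs.length = r)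
    (hl : ∀ B ∈ Bs, ∀ a ∈ B.letters, a < l) :
    ∃ C, ∀ f ∈ agreeing Q f₀, IsCollision α f h₀ (2 ^ r) C := by
  classical
  subst hlen
  have hex : ∀ χ : Fin Bs.length → Bool, ∃ g, Admissible c Bs g ∧
      ∀ i : Fin Bs.length, ∀ a ∈ Bs[i].letters, g a = Bs[i].opt (χ i) a := by
    intro χ
    have huniq : ∀ (i j : Fin Bs.length) a, a ∈ Bs[i].letters → a ∈ Bs[j].letters → i = j := by
      intro i j a hi hj
      by_contra hne
      have hpw := List.pairwise_iff_getElem.1 hS.disjoint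
      rcases lt_or_gt_of_ne hne with h | h
      · exact Finset.disjoint_left.1 (hpw i j i.2 j.2 h) hi hj
      · exact Finset.disjoint_left.1 (hpw j i j.2 i.2 h) hj hi
    set g : ℕ → Block m := fun a =>
      if h : ∃ i : Fin Bs.length, a ∈ Bs[i].letters then Bs[h.choose].opt (χ h.choose) a else c
      with hg
    have hgi : ∀ i : Fin Bs.length, ∀ a ∈ Bs[i].letters, g a = Bs[i].opt (χ i) a := by
      intro i a ha
      have h : ∃ i : Fin Bs.length, a ∈ Bs[i].letters := ⟨i, ha⟩
      simp only [hg, dif_pos h]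
      exact congrArg (fun j : Fin Bs.length => Bs[j].opt (χ j) a) (huniq _ i a h.choose_spec ha)
    refine ⟨g, ⟨fun B hB => ?_, fun a ha => ?_⟩, hgi⟩
    · obtain ⟨i, hi, rfl⟩ := List.getElem_of_mem hB
      exact ⟨χ ⟨i, hi⟩, hgi ⟨i, hi⟩⟩
    · refine dif_neg ?_
      rintro ⟨i, hi⟩
      exact ha _ (List.getElem_mem i.2) hi
  choose g hg1 hg2 using hex
  obtain ⟨y, hy⟩ := hS.value
  have hinj : Function.Injective fun χ => (⟨l, fun i => g χ i⟩ : Message m) := by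
    intro χ χ' h
    have h' := eq_of_heq (Sigma.mk.inj h).2
    funext i
    obtain ⟨a, ha, hne⟩ := hS.opt_ne Bs[i] (List.getElem_mem i.2)
    have h3 := congrFun h' ⟨a, hl _ (List.getElem_mem i.2) a ha⟩
    simp only [hg2 χ i a ha, hg2 χ' i a ha] at h3
    rcases hs1 : χ i with _ | _ <;> rcases hs2 : χ' i with _ | _ <;> rw [hs1, hs2] at h3
    · exact absurd h3 hne
    · exact absurd h3.symm hne
  refine ⟨Finset.univ.image fun χ => (⟨l, fun i => g χ i⟩ : Message m), fun f hf => ⟨?_, ?_⟩⟩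
  · rw [Finset.card_image_of_injective _ hinj]
    simp
  · intro u hu v hv
    obtain ⟨χ, -, rfl⟩ := Finset.mem_image.1 hu
    obtain ⟨χ', -, rfl⟩ := Finset.mem_image.1 hv
    refine ⟨rfl, ?_⟩
    rw [hash_eq_run, hash_eq_run, hy f hf _ (hg1 χ), hy f hf _ (hg1 χ')]

/-! ### Exhaustive search -/

lemma solvable_of_queries {P : Compression n m → Finset (Message m) → Prop} :
    ∀ (pts : List (HashValue n × Block m)) {Q : Finset (HashValue n × Block m)}
    {f₀ : Compression n m},
    (∀ Q' f₁, Q ⊆ Q' → (∀ p ∈ pts, p ∈ Q') → ∃ C, ∀ f ∈ agreeing Q' f₁, P f C) →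
    Solvable P Q f₀ fun _ => pts.length := by
  intro pts
  induction pts with
  | nil =>
    intro Q f₀ h
    obtain ⟨C, hC⟩ := h Q f₀ subset_rfl (by simp)
    simpa using solvable_output hC
  | cons p pts ih =>
    intro Q f₀ h
    have := solvable_query (P := P) (Q := Q) (f₀ := f₀) p.1 p.2 fun f₁ _ =>
      ih (Q := insert (p.1, p.2) Q) (f₀ := f₁) fun Q' f₂ hQ hp =>
        h Q' f₂ ((Finset.subset_insert _ _).trans hQ) (by
          intro p' hp'
          rcases List.mem_cons.1 hp' with rfl | hp'
          · exact hQ (Finset.mem_insert_self _ _)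
          · exact hp p' hp')
    simpa using this

/-- If `f` is known for two message blocks `b` and `b'`, then a collision is known: the messages of
`n + r` blocks `b` and `b'` outnumber the hash values by the factor `2 ^ r`. -/
lemma exists_isCollision_of_two_blocks (hn : 0 < n) (f₀ : Compression n m) {b b' : Block m}
    (hb : b ≠ b') : ∃ C, ∀ f : Compression n m, (∀ x, f x b = f₀ x b ∧ f x b' = f₀ x b') →
      IsCollision α f h₀ (2 ^ r) C := by
  classical
  set l : ℕ+ := ⟨n + r, by omega⟩ with hl
  set msg : (Fin l → Bool) → Message m := fun χ => ⟨l, fun i => cond (χ i) b b'⟩ with hmsg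
  have hinj : Function.Injective msg := by
    intro χ χ' h
    have h' := eq_of_heq (Sigma.mk.inj h).2
    funext i
    have h3 := congrFun h' i
    rcases hs1 : χ i with _ | _ <;> rcases hs2 : χ' i with _ | _ <;> rw [hs1, hs2] at h3
    · exact absurd h3.symm hb
    · exact absurd h3 hb
  have hhash : ∀ f : Compression n m, (∀ x, f x b = f₀ x b ∧ f x b' = f₀ x b') →
      ∀ χ, hash α f h₀ (msg χ) = hash α f₀ h₀ (msg χ) := by
    intro f hf χ
    simp only [hash, iteratedCompression, List.foldl_map]
    congr 1
    funext x i
    change f x (cond (χ i) b b') = f₀ x (cond (χ i) b b')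
    rcases χ i with _ | _
    · exact (hf x).2
    · exact (hf x).1
  obtain ⟨y, -, hy⟩ := Finset.exists_le_card_fiber_of_mul_le_card_of_maps_to
    (s := (Finset.univ : Finset (Fin l → Bool))) (t := (Finset.univ : Finset (HashValue n)))
    (f := fun χ => hash α f₀ h₀ (msg χ)) (n := 2 ^ r) (fun _ _ => Finset.mem_univ _)
    Finset.univ_nonempty (by simp [HashValue, hl, pow_add])
  obtain ⟨T, hT, hTc⟩ := Finset.exists_subset_card_eq hy
  refine ⟨T.image msg, fun f hf => ⟨by rw [Finset.card_image_of_injective _ hinj, hTc], ?_⟩⟩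
  intro u hu v hv
  obtain ⟨χ, hχ, rfl⟩ := Finset.mem_image.1 hu
  obtain ⟨χ', hχ', rfl⟩ := Finset.mem_image.1 hv
  refine ⟨rfl, ?_⟩
  rw [hhash f hf, hhash f hf, (Finset.mem_filter.1 (hT hχ)).2, (Finset.mem_filter.1 (hT hχ')).2]

/-- All values for two message blocks are queried. -/
lemma solvable_exhaustive (hn : 0 < n) (hm : 0 < m) (Q : Finset (HashValue n × Block m))
    (f₀ : Compression n m) :
    Solvable (fun f C => IsCollision α f h₀ (2 ^ r) C) Q f₀ fun _ => 2 ^ (n + 1) := by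
  classical
  obtain ⟨b, b', hb⟩ : ∃ b b' : Block m, b ≠ b' :=
    ⟨fun _ => false, fun _ => true, fun h => Bool.false_ne_true (congrFun h ⟨0, hm⟩)⟩
  refine (solvable_of_queries ((Finset.univ : Finset (HashValue n)) ×ˢ {b, b'}).toList
    fun Q' f₁ _ hQ' => ?_).mono_const (le_of_eq ?_)
  · obtain ⟨C, hC⟩ := exists_isCollision_of_two_blocks (α := α) (h₀ := h₀) (r := r) hn f₁ hb
    exact ⟨C, fun f hf => hC f fun x =>
      ⟨mem_agreeing.1 hf (x, b) (hQ' _ (by simp)), mem_agreeing.1 hf (x, b') (hQ' _ (by simp))⟩⟩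
  · rw [Finset.length_toList, Finset.card_product, Finset.card_pair hb]
    simp [HashValue, pow_succ]

end collision

/-! ### The attack -/

lemma exists_candidates {m : ℕ} (s : ℕ) (A : Finset ℕ) : ∀ T : Finset (Block m),
    A.card * s ≤ T.card → ∃ cand : ℕ → Finset (Block m), (∀ a, cand a ⊆ T) ∧
      (∀ a ∈ A, (cand a).card = s) ∧ (∀ a ∉ A, cand a = ∅) ∧
      ∀ a a', a ≠ a' → Disjoint (cand a) (cand a') := by
  classical
  induction A using Finset.induction_on with
  | empty => exact fun T _ => ⟨fun _ => ∅, by simp⟩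
  | insert a A ha ih =>
    intro T hT
    rw [Finset.card_insert_of_notMem ha, add_mul, one_mul] at hT
    obtain ⟨S, hS, hSc⟩ := Finset.exists_subset_card_eq (show s ≤ T.card by omega)
    obtain ⟨cand, h1, h2, h3, h4⟩ := ih (T \ S) (by
      rw [Finset.card_sdiff_of_subset hS]
      omega)
    have hdis : ∀ a', Disjoint S (cand a') := fun a' =>
      Finset.disjoint_left.2 fun b hb hb' => (Finset.mem_sdiff.1 (h1 a' hb')).2 hb
    refine ⟨Function.update cand a S, fun a' => ?_, fun a' ha' => ?_, fun a' ha' => ?_,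
      fun a₁ a₂ hne => ?_⟩
    · by_cases h : a' = a
      · rw [h, Function.update_self]; exact hS
      · rw [Function.update_of_ne h]; exact (h1 a').trans Finset.sdiff_subset
    · by_cases h : a' = a
      · rw [h, Function.update_self]; exact hSc
      · rw [Function.update_of_ne h]; exact h2 a' ((Finset.mem_insert.1 ha').resolve_left h)
    · rw [Finset.mem_insert, not_or] at ha'
      rw [Function.update_of_ne ha'.1]; exact h3 a' ha'.2
    · by_cases h : a₁ = a
      · have h' : a₂ ≠ a := fun h'' => hne (h.trans h''.symm)
        rw [h, Function.update_self, Function.update_of_ne h']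
        exact hdis a₂
      · rw [Function.update_of_ne h]
        by_cases h' : a₂ = a
        · rw [h', Function.update_self]; exact (hdis a₁).symm
        · rw [Function.update_of_ne h']; exact h4 a₁ a₂ hne

/-- The choice of single letters from which the merging starts, for a factorization of a word into
`w₁` and the words `vs`. -/
lemma exists_letters_mergeable {n r q : ℕ} (hn : 0 < n) (hr : 0 < r) (hq : 1 < q) {A : Finset ℕ}
    {w₁ : List ℕ} {vs : List (List ℕ)} (hlen : vs.length + 1 ≤ q)
    (hA : n ^ (q - 1) ^ 2 * r ^ (2 * q - 3) ≤ A.card) (hw₁ : Contiguous A w₁)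
    (hvs : ∀ v ∈ vs, Contiguous A v) :
    ∃ L : List (ℕ × List ℕ), (∀ p ∈ L, p.1 ∈ A) ∧ L.length ≤ A.card ∧
      Segmented w₁ (L.map fun p => ({p.1}, p.2)) ∧
      Mergeable n r vs (L.map fun p => ({p.1} : Finset ℕ)) := by
  obtain ⟨Fs, hne, hdisj, hFs, hm⟩ : ∃ Fs : List (Finset ℕ), Fs ≠ [] ∧ Fs.Pairwise Disjoint ∧
      (∀ S ∈ Fs, S ⊆ A ∧ S.card = 1) ∧ Mergeable n r vs Fs := by
    rcases vs with _ | ⟨v, vs⟩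
    · have hrA : r ≤ A.card := by
        refine le_trans ?_ hA
        calc r ≤ r ^ (2 * q - 3) := Nat.le_self_pow (by omega) r
          _ ≤ _ := Nat.le_mul_of_pos_left _ (by positivity)
      obtain ⟨T, hT, hTc⟩ := Finset.exists_subset_card_eq hrA
      refine ⟨T.toList.map fun a => {a}, ?_, ?_, ?_, ?_⟩
      · rw [← List.length_pos_iff]
        simpa [hTc] using hr
      · rw [List.pairwise_map]
        exact (Finset.nodup_toList T).imp fun h => by simpa using h
      · intro S hS
        obtain ⟨a, ha, rfl⟩ := List.mem_map.1 hS
        exact ⟨by simpa using hT (Finset.mem_toList.1 ha), by simp⟩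
      · simpa [Mergeable] using hTc
    · have hcard : n ^ (vs.length + 1) ^ 2 * r ^ (2 * vs.length + 1) * 1 ≤ A.card := by
        rw [mul_one]
        rw [List.length_cons] at hlen
        refine le_trans (Nat.mul_le_mul (Nat.pow_le_pow_right hn ?_)
          (Nat.pow_le_pow_right hr ?_)) hA
        · exact Nat.pow_le_pow_left (by omega) 2
        · omega
      obtain ⟨Fs, h1, h2, h3, h4⟩ := exists_mergeable hn hr vs.length (v :: vs) rfl 1 A hcard hvs
      refine ⟨Fs, ?_, h2, h3, h4⟩
      rw [← List.length_pos_iff, h1]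
      positivity
  have hFne : ∀ S ∈ Fs, S.Nonempty := fun S hS =>
    Finset.card_pos.1 (by rw [(hFs S hS).2]; exact one_pos)
  have hnodup : Fs.Nodup := hdisj.imp_of_mem fun {S S'} hS _ h heq => by
    subst heq
    exact (hFne S hS).ne_empty (Finset.disjoint_self_iff_empty S |>.1 h)
  set A₁ : Finset ℕ := A.filter fun a => {a} ∈ Fs with hA₁
  have hsing : ∀ S ∈ Fs, ∃ a ∈ A₁, S = {a} := by
    intro S hS
    obtain ⟨a, rfl⟩ := Finset.card_eq_one.1 (hFs S hS).2
    exact ⟨a, Finset.mem_filter.2 ⟨(hFs _ hS).1 (by simp), hS⟩, rfl⟩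
  have hpos : 0 < A₁.card := by
    obtain ⟨S, hS⟩ := List.exists_mem_of_ne_nil _ hne
    obtain ⟨a, ha, -⟩ := hsing S hS
    exact Finset.card_pos.2 ⟨a, ha⟩
  have hFlen : Fs.length ≤ A₁.card := by
    rw [← List.toFinset_card_of_nodup hnodup]
    refine (Finset.card_le_card (t := A₁.image fun a => {a}) fun S hS => ?_).trans
      Finset.card_image_le
    obtain ⟨a, ha, rfl⟩ := hsing S (List.mem_toFinset.1 hS)
    exact Finset.mem_image_of_mem _ ha
  obtain ⟨L₀, hL1, hL2, hL3⟩ := exists_segmented_of_card (V := 1)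
    (hw₁.mono (Finset.filter_subset _ _ : A₁ ⊆ A)) hpos (by rw [mul_one])
  obtain ⟨L, rfl⟩ : ∃ L : List (ℕ × List ℕ), L.map (fun p => (({p.1} : Finset ℕ), p.2)) = L₀ := by
    have : L₀ ∈ Set.range (List.map fun p : ℕ × List ℕ => (({p.1} : Finset ℕ), p.2)) := by
      rw [Set.range_list_map]
      intro p hp
      obtain ⟨a, ha⟩ := Finset.card_eq_one.1 (hL2 p hp).2
      exact ⟨(a, p.2), Prod.ext ha.symm rfl⟩
    exact this
  have hLA : ∀ p ∈ L, p.1 ∈ A₁ := fun p hp =>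
    Finset.singleton_subset_iff.1 (hL2 _ (List.mem_map_of_mem hp)).1
  rw [List.length_map] at hL1
  refine ⟨L, fun p hp => (Finset.mem_filter.1 (hLA p hp)).1, ?_, hL3, hm.perm (List.Perm.symm ?_)⟩
  · rw [hL1]
    exact Finset.card_le_card (Finset.filter_subset _ _)
  · have hd := hL3.pairwise_disjoint fun p hp a ha => hw₁.1 a
      ((Finset.filter_subset _ _) ((hL2 p hp).1 ha))
    rw [List.map_map] at hd
    have hnd : (L.map fun p => ({p.1} : Finset ℕ)).Nodup := hd.imp_of_mem fun {S S'} hS _ h heq => by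
      subst heq
      obtain ⟨p, -, rfl⟩ := List.mem_map.1 hS
      simp at h
    refine (List.subperm_of_subset hnd fun S hS => ?_).perm_of_length_le (by simpa [hL1] using hFlen)
    obtain ⟨p, hp, rfl⟩ := List.mem_map.1 hS
    exact (Finset.mem_filter.1 (hLA p hp)).2

/-- The attack, with the bound for its cost in terms of the number `s` of candidate blocks for each
letter. -/
lemma solvable_isCollision {n m q r : ℕ} (hn : 0 < n) (hnm : n < m) (hq : 1 < q) (hr : 0 < r)
    {α : (l : ℕ+) → List (Fin l)} (halph : ∀ (l : ℕ+) (i : Fin l), i ∈ α l)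
    (hbound : IsBounded q α) (h₀ : HashValue n) (f₀ : Compression n m) {M : ℕ}
    (hM : n ^ (q - 1) ^ 2 * r ^ (2 * q - 3) = M) {R : ℝ} (hR1 : 1 ≤ R)
    (hRn : R ^ 2 = (2 ^ n : ℕ)) {s : ℕ} (hs : M * s ≤ 2 ^ n) {κ : ℝ}
    (hκ : 33 / 20 * R + 2 + 2 * (2 * q : ℕ) +
      2 ^ (n + 1) * noCollision (2 ^ n : ℕ) (2 ^ (n - 1) - 2 * q) ≤ κ) :
    Solvable (fun f C => IsCollision α f h₀ (2 ^ r) C) ∅ f₀ fun _ =>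
      κ * (q * N M q) + M * (2 ^ (n + 1) * noCollision (2 ^ n : ℕ) s) := by
  classical
  have hF : (0 : ℝ) ≤ 2 ^ (n + 1) := by positivity
  have hφ := mul_nonneg hF (noCollision_nonneg (2 ^ n) (2 ^ (n - 1) - 2 * q))
  have hq0 : (0 : ℝ) ≤ 2 * (2 * q : ℕ) := by positivity
  have hκ1 : 33 / 20 * R + 2 ≤ κ := by linarith
  have hκ0 : 0 ≤ κ := by linarith
  obtain ⟨hpos, hN⟩ := N_spec M q hq.le
  set l : ℕ+ := ⟨N M q, hpos⟩ with hl
  set w := (α l).map Fin.val with hw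
  have hcount : ∀ a, w.count a ≤ q := by
    intro a
    by_cases ha : a ∈ w
    · obtain ⟨i, -, rfl⟩ := List.mem_map.1 ha
      rw [hw, List.count_map_of_injective _ _ Fin.val_injective]
      exact hbound l i
    · rw [List.count_eq_zero.2 ha]
      exact Nat.zero_le _
  have hwset : w.toFinset = Finset.range l := by
    ext a
    rw [List.mem_toFinset, Finset.mem_range]
    refine ⟨fun ha => ?_, fun ha => List.mem_map.2 ⟨⟨a, ha⟩, halph l _, rfl⟩⟩
    obtain ⟨i, -, rfl⟩ := List.mem_map.1 ha
    exact i.2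
  have hwlen : w.length ≤ q * N M q := by
    rw [← List.sum_toFinset_count_eq_length, hwset]
    refine (Finset.sum_le_card_nsmul _ _ q fun a _ => hcount a).trans (le_of_eq ?_)
    rw [Finset.card_range, smul_eq_mul, mul_comm]
    rfl
  obtain ⟨A, hA, hAc, parts, hp1, hp2, hp3, hp4⟩ := hN w
    (by rw [hwset, Finset.card_range]; rfl) fun a _ => hcount a
  obtain ⟨w₁, vs, rfl⟩ : ∃ w₁ vs, parts = w₁ :: vs := by
    rcases parts with _ | ⟨w₁, vs⟩
    · simp at hp1
    · exact ⟨w₁, vs, rfl⟩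
  have hcon : ∀ v ∈ w₁ :: vs, Contiguous A v := fun v hv => isPermutationOf_collapse_iff.1 (hp4 v hv)
  obtain ⟨L, hL1, hL2, hL3, hL4⟩ := exists_letters_mergeable hn hr hq (by simpa using hp2)
    (by rw [hM, hAc]) (hcon w₁ (by simp)) fun v hv => hcon v (by simp [hv])
  have hLw : (L.map Prod.snd).flatten = w₁ := by
    rw [← hL3.1, List.map_map]
    rfl
  have hww : w₁ ++ vs.flatten = w := by simpa using hp3
  -- The block `c` is not a candidate; as `n < m`, there is room for the candidates beside it.
  set c : Block m := fun _ => false with hc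
  obtain ⟨cand, hc1, hc2, hc3, hc4⟩ := exists_candidates s A (Finset.univ.erase c) (by
    rw [Finset.card_erase_of_mem (Finset.mem_univ _), hAc]
    have h1 : 2 ^ n < 2 ^ m := Nat.pow_lt_pow_right (by norm_num) hnm
    have h2 : Fintype.card (Block m) = 2 ^ m := by simp [Block]
    rw [Finset.card_univ, h2]
    omega)
  have hcc : ∀ a, c ∉ cand a := fun a h => Finset.notMem_erase c _ (hc1 a h)
  have hfall : ∀ (Q : Finset (HashValue n × Block m)) f₀, Solvable (fun f C => IsCollision α f h₀ (2 ^ r) C) Q f₀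
      fun _ => 2 ^ (n + 1) := fun Q f₀ => solvable_exhaustive hn (by omega) Q f₀
  have hcost := mul_le_mul_of_nonneg_left (show (w.length : ℝ) ≤ q * N M q by exact_mod_cast hwlen) hκ0
  have hLM : (L.length : ℝ) ≤ M := by
    rw [hAc] at hL2
    exact_mod_cast hL2
  have hcost2 := mul_le_mul_of_nonneg_right hLM
    (mul_nonneg hF (noCollision_nonneg (2 ^ n) s))
  refine (solvable_first_phase (c := c) (cand := cand) (h₀ := h₀) (κ := κ) (C := κ * vs.flatten.length)
    (s := s) hc4 hcc hR1 hRn hκ1 hF hfall (mul_nonneg hκ0 (Nat.cast_nonneg _)) L (D := [])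
    (pre := []) ?_ ?_ (by simp) ?_ ?_ ?_).mono_const ?_
  · refine (List.pairwise_map.1 hL3.2).imp fun h => ?_
    exact ⟨fun h' => h.1 _ h' (Finset.mem_singleton_self _),
      fun h' => h.2 _ h' (Finset.mem_singleton_self _)⟩
  · intro p hp
    refine ⟨hL3.mem_segment (p := ({p.1}, p.2)) (List.mem_map.2 ⟨p, hp, rfl⟩) (by simp) ?_, by simp⟩
    exact (hcon w₁ (by simp)).1 _ (hL1 p hp)
  · exact fun p hp => ⟨(hc2 _ (hL1 p hp)).ge, fun b _ => by simp [blockCount]⟩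
  · exact ⟨⟨h₀, fun f _ g _ => rfl⟩, by simp, by simp, by simp, by simp⟩
  · intro Q' f₁ Bs hBs hS
    rw [hLw, List.nil_append] at hS
    rw [List.map_nil, List.append_nil] at hBs
    refine solvable_phases hn hc4 hcc hR1 hRn hF hfall hκ hκ0 vs (hL4.perm hBs.symm) ?_
      (fun a => by rw [hww]; exact hcount a) hS ?_
    · intro B hB v hv a ha
      obtain ⟨p, hp, hpB⟩ := List.mem_map.1 (hBs.mem_iff.1 (List.mem_map_of_mem hB))
      rw [← hpB, Finset.mem_singleton] at ha
      rw [ha]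
      exact (hcon v (by simp [hv])).1 _ (hL1 p hp)
    · intro Q'' f₂ Bs' hlen hS'
      rw [hww] at hS'
      -- Letters outside `A` have no candidates, so they belong to no box.
      obtain ⟨C, hC⟩ := hS'.exists_isCollision hlen fun B hB a ha => by
        have h1 := hS'.opt_mem B hB false a ha
        have h2 : a ∈ A := by
          by_contra h
          rw [hc3 a h] at h1
          simp at h1
        have h3 := hA h2
        rwa [hwset, Finset.mem_range] at h3
      exact solvable_output hC
  · rw [hLw]
    have h1 : (w.length : ℝ) = w₁.length + vs.flatten.length := by
      rw [← hww, List.length_append]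
      push_cast
      rfl
    rw [h1] at hcost
    linarith

/-! ### Numerical estimates -/

/-- The bound for the probability of no collision, multiplied by the cost `2 * R ^ 2` of an exhaustive
search. -/
lemma two_mul_sq_mul_noCollision_le {K n : ℕ} {R y : ℝ} (hRn : R ^ 2 = (2 ^ n : ℕ)) (hy : 0 < y)
    (hK : y ≤ K - 1) : 2 ^ (n + 1) * noCollision (2 ^ n : ℕ) K ≤ 4 * (R ^ 2) ^ 2 / y ^ 2 := by
  have h1 := noCollision_mul_le (2 ^ n) (by positivity) K
  have h2 := noCollision_nonneg (2 ^ n) K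
  rw [← hRn] at h1 h2 ⊢
  have h3 : (2 : ℝ) ^ (n + 1) = 2 * R ^ 2 := by
    rw [hRn, pow_succ]
    push_cast
    ring
  have h4 : noCollision (R ^ 2) K * y ^ 2 ≤ 2 * R ^ 2 := by
    refine le_trans (mul_le_mul_of_nonneg_left ?_ h2) h1
    nlinarith
  rw [le_div_iff₀ (by positivity), h3]
  nlinarith [sq_nonneg R]

/-- If exhaustive search is too expensive, then `n` is large. -/
lemma twenty_le_of_lt {n L : ℕ} {R : ℝ} (hRn : R ^ 2 = (2 ^ n : ℕ)) (hL : (n - 1) ^ 2 < L)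
    (h : 5 / 2 * (L : ℝ) < R) : 20 ≤ n := by
  by_contra hlt
  push Not at hlt
  have h1 : (25 * (((n - 1) ^ 2 + 1 : ℕ) : ℝ) ^ 2) < 4 * (2 ^ n : ℕ) := by
    have h2 : (((n - 1) ^ 2 + 1 : ℕ) : ℝ) ≤ L := by exact_mod_cast hL
    have h3 : (0 : ℝ) ≤ (((n - 1) ^ 2 + 1 : ℕ) : ℝ) := Nat.cast_nonneg _
    rw [← hRn]
    nlinarith
  have h2 : 25 * ((n - 1) ^ 2 + 1) ^ 2 < 4 * 2 ^ n := by exact_mod_cast h1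
  -- `25 * ((n - 1) ^ 2 + 1) ^ 2 < 2 ^ (n + 2)` fails for all `n ≤ 19`.
  interval_cases n <;> simp at h2

lemma cost_le {n q M L : ℕ} (hq : 2 ≤ q) (hM : n ≤ M) (hL : (M - 1) ^ 2 < L) (hn : 20 ≤ n)
    {R : ℝ} (hR0 : 0 < R) (hRn : R ^ 2 = (2 ^ n : ℕ)) (h : 5 / 4 * (q * L : ℝ) < R) :
    (33 / 20 * R + 2 + 2 * (2 * q : ℕ) +
      2 ^ (n + 1) * noCollision (2 ^ n : ℕ) (2 ^ (n - 1) - 2 * q)) * (q * L) +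
      M * (2 ^ (n + 1) * noCollision (2 ^ n : ℕ) (2 ^ n / M)) ≤ 5 / 2 * q * L * R := by
  have hM20 : (20 : ℝ) ≤ M := by exact_mod_cast hn.trans hM
  have hq2 : (2 : ℝ) ≤ q := by exact_mod_cast hq
  have hLM : ((M : ℝ) - 1) ^ 2 + 1 ≤ L := by
    have h1 : (((M - 1) ^ 2 + 1 : ℕ) : ℝ) ≤ L := by exact_mod_cast hL
    rw [Nat.cast_add, Nat.cast_pow, Nat.cast_sub (by omega)] at h1
    simpa using h1
  have hL9 : 9 / 10 * (M : ℝ) ^ 2 ≤ L := by nlinarith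
  have hL18 : 18 * (M : ℝ) ≤ L := by nlinarith
  have hL360 : (360 : ℝ) ≤ L := by linarith
  have hqR : 450 * (q : ℝ) ≤ R := by nlinarith
  have hMR : 45 * (M : ℝ) ≤ R := by nlinarith
  have hR900 : (900 : ℝ) ≤ R := by linarith
  have hφ : 2 ^ (n + 1) * noCollision (2 ^ n : ℕ) (2 ^ (n - 1) - 2 * q) ≤ 25 := by
    have hhalf : ((2 ^ (n - 1) : ℕ) : ℝ) = R ^ 2 / 2 := by
      rw [hRn]
      obtain ⟨k, rfl⟩ : ∃ k, n = k + 1 := ⟨n - 1, by omega⟩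
      rw [Nat.add_sub_cancel, pow_succ]
      push_cast
      ring
    have hK : ((2 ^ (n - 1) : ℕ) : ℝ) - (2 * q : ℕ) ≤ ((2 ^ (n - 1) - 2 * q : ℕ) : ℝ) := by
      rw [sub_le_iff_le_add]
      exact_mod_cast (show 2 ^ (n - 1) ≤ 2 ^ (n - 1) - 2 * q + 2 * q by omega)
    rw [hhalf] at hK
    push_cast at hK
    refine (two_mul_sq_mul_noCollision_le hRn (y := 2 / 5 * R ^ 2) (by positivity) ?_).trans ?_
    · nlinarith
    · rw [div_le_iff₀ (by positivity)]
      nlinarith [sq_nonneg (R ^ 2)]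
  have hψ : 2 ^ (n + 1) * noCollision (2 ^ n : ℕ) (2 ^ n / M) ≤ 5 * (M : ℝ) ^ 2 := by
    have hM0 : (0 : ℝ) < M := by linarith
    have hdiv : R ^ 2 / M - 1 ≤ ((2 ^ n / M : ℕ) : ℝ) := by
      rw [hRn, sub_le_iff_le_add, div_le_iff₀ hM0]
      have h1 := Nat.div_add_mod (2 ^ n) M
      have h2 := Nat.mod_lt (2 ^ n) (show 0 < M by omega)
      have h3 : 2 ^ n ≤ (2 ^ n / M + 1) * M := by
        rw [add_mul, one_mul, mul_comm (2 ^ n / M)]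
        omega
      exact_mod_cast h3
    -- Rounding in `2 ^ n / M` is harmless because `R ^ 2 / M` is large.
    have h45 : 45 * R ≤ R ^ 2 / M := by
      rw [le_div_iff₀ hM0]
      nlinarith
    refine (two_mul_sq_mul_noCollision_le hRn (y := 9 / 10 * (R ^ 2 / M)) (by positivity) ?_).trans ?_
    · linarith
    · rw [div_le_iff₀ (by positivity)]
      have h1 : (M : ℝ) * (R ^ 2 / M) = R ^ 2 := mul_div_cancel₀ _ hM0.ne'
      have h2 : 5 * (M : ℝ) ^ 2 * (9 / 10 * (R ^ 2 / M)) ^ 2 = 81 / 20 * (R ^ 2) ^ 2 := by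
        calc _ = 81 / 20 * ((M : ℝ) * (R ^ 2 / M)) ^ 2 := by ring
          _ = _ := by rw [h1]
      rw [h2]
      nlinarith [sq_nonneg (R ^ 2)]
  have hκ : 33 / 20 * R + 2 + 2 * (2 * q : ℕ) +
      2 ^ (n + 1) * noCollision (2 ^ n : ℕ) (2 ^ (n - 1) - 2 * q) ≤ 7 / 4 * R := by
    push_cast at hφ ⊢
    linarith
  have hqL : (0 : ℝ) ≤ q * L := by positivity
  have h1 := mul_le_mul_of_nonneg_right hκ hqL
  have h2 := mul_le_mul_of_nonneg_left hψ (Nat.cast_nonneg (α := ℝ) M)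
  have h5 : (0 : ℝ) ≤ L * R := by positivity
  have h3 : (M : ℝ) * (5 * (M : ℝ) ^ 2) ≤ 1 / 4 * (L * R) := by
    have h4 : (M : ℝ) * (M : ℝ) ^ 2 ≤ R / 45 * (10 / 9 * L) :=
      mul_le_mul (by linarith) (by linarith) (by positivity) (by positivity)
    linarith
  have h6 : (L : ℝ) * R * 2 ≤ L * R * q := mul_le_mul_of_nonneg_left hq2 (by positivity)
  calc _ ≤ 7 / 4 * R * (q * L) + M * (5 * (M : ℝ) ^ 2) := add_le_add h1 h2
    _ ≤ _ := by linarith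

end Gihf

/-- The attacker may depend on `n, m, q, r`, the words `α` and the initial value `h₀`, but sees the
compression function `f` only through queries. It outputs a correct `2^r`-collision for every `f`. -/
theorem theorem1 (n m q : ℕ) (hn : 0 < n) (hnm : n < m) (hq : 1 < q)
    (α : (l : ℕ+) → List (Fin l)) (halph : ∀ (l : ℕ+) (i : Fin l), i ∈ α l)
    (hbound : Gihf.IsBounded q α) (r : ℕ) (hr : 0 < r) :
    ∃ attack : Gihf.HashValue n → Gihf.Attack n m, ∀ h₀ : Gihf.HashValue n,
      (∀ f : Gihf.Compression n m,
        Gihf.IsCollision α f h₀ (2 ^ r) ((attack h₀).result f)) ∧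
      (attack h₀).expectedQueries ≤
        (5 / 2 : ℝ) * q * Gihf.N (n ^ ((q - 1) ^ 2) * r ^ (2 * q - 3)) q *
          (2 : ℝ) ^ ((n : ℝ) / 2) := by
  have hsolve : ∀ h₀ : Gihf.HashValue n,
      Gihf.Solvable (m := m) (fun f C => Gihf.IsCollision α f h₀ (2 ^ r) C) ∅ (fun _ _ => h₀) fun _ =>
        (5 / 2 : ℝ) * q * Gihf.N (n ^ ((q - 1) ^ 2) * r ^ (2 * q - 3)) q *
          (2 : ℝ) ^ ((n : ℝ) / 2) := by
    intro h₀
    set M := n ^ ((q - 1) ^ 2) * r ^ (2 * q - 3) with hM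
    set L := Gihf.N M q with hL
    set R := (2 : ℝ) ^ ((n : ℝ) / 2) with hR
    have hRn : R ^ 2 = (2 ^ n : ℕ) := by
      rw [hR, ← Real.rpow_natCast, ← Real.rpow_mul (by norm_num)]
      push_cast
      rw [div_mul_cancel₀ _ (by norm_num), Real.rpow_natCast]
    have hR1 : 1 ≤ R := Real.one_le_rpow (by norm_num) (by positivity)
    have hnM : n ≤ M := by
      have h1 : n ≤ n ^ (q - 1) ^ 2 :=
        Nat.le_self_pow (pow_ne_zero _ (by omega)) n
      exact h1.trans (Nat.le_mul_of_pos_right _ (by positivity))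
    have hLM : (M - 1) ^ 2 < L := Gihf.sq_lt_N M q (by omega) hq
    -- Exhaustive search takes `2 * R ^ 2` queries.
    rcases le_or_gt (R * R * 2) (5 / 2 * q * L * R) with h | h
    · refine (Gihf.solvable_exhaustive hn (by omega) ∅ _).mono_const (le_trans (le_of_eq ?_) h)
      rw [← sq, hRn, pow_succ]
      push_cast
      rfl
    · have hqL : 5 / 4 * (q * L : ℝ) < R := by nlinarith
      have hq2 : (2 : ℝ) ≤ q := by exact_mod_cast hq
      have hn20 : 20 ≤ n := by
        refine Gihf.twenty_le_of_lt hRn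
          (lt_of_le_of_lt (Nat.pow_le_pow_left (by omega : n - 1 ≤ M - 1) 2) hLM) ?_
        have : (0 : ℝ) ≤ L := Nat.cast_nonneg _
        nlinarith
      exact (Gihf.solvable_isCollision hn hnm hq hr halph hbound h₀ _ hM.symm hR1 hRn
        (Nat.mul_div_le _ _) le_rfl).mono_const
        (Gihf.cost_le hq hnM hLM hn20 (by linarith) hRn hqL)
  -- Nothing is known at the start: every `f` agrees with the arbitrary reference function on `∅`.
  choose attack hcorrect hcost using hsolve
  have huniv : ∀ h₀ : Gihf.HashValue n,
      Gihf.agreeing ∅ (fun _ _ => h₀ : Gihf.Compression n m) = Finset.univ := fun h₀ => by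
    ext f
    simp [Gihf.mem_agreeing]
  refine ⟨attack, fun h₀ => ⟨fun f => hcorrect h₀ f (by rw [huniv]; exact Finset.mem_univ f), ?_⟩⟩
  have h := hcost h₀
  rw [huniv, Finset.sum_const, nsmul_eq_mul] at h
  rw [Gihf.Attack.expectedQueries, Finset.expect_eq_sum_div_card, div_le_iff₀ (by positivity),
    mul_comm _ ((Finset.univ : Finset (Gihf.Compression n m)).card : ℝ)]
  exact h
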